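/- **Setting.** Let $d\ge 1$ and let $\mathfrak L_\star$ be a countable set of labels with a map $\deg:\mathfrak L_\star\to\mathbf R$ and, for every $k\in\mathbf N^d$, an injection $\mathfrak t\mapsto\mathfrak t^{(k)}$ such that $\mathfrak t^{(0)}=\mathfrak t$, $(\mathfrak t^{(k)})^{(\ell)}=\mathfrak t^{(k+\ell)}$, $\deg\mathfrak t^{(k)}=\deg\mathfrak t-|k|$, and such that every label is of the form $\mathfrak t^{(k)}$ with $\mathfrak t$ in a fixed finite set. A smooth kernel assignment $K$ consists of smooth functions $K_{\mathfrak t}:\mathbf R^d\to\mathbf R$, $\mathfrak t\in\mathfrak L_\star$, supported in the closed unit ball, with $K_{\mathfrak t^{(k)}}=D^kK_{\mathfrak t}$ and $|D^kK_{\mathfrak t}(x)|\le C_{\mathfrak t,k}|x|^{\deg\mathfrak t-|k|}$ for $x\ne0$. A Feynman diagram $\Gamma$ with $k$ legs is a finite directed multigraph $(\mathcal V_\star,\mathcal E_\star)$ (self-loops allowed) with edge labels $\mathfrak t(e)\in\mathfrak L_\star$, vertices $v_1,\dots,v_k$ to which the legs are attached, and multiindices $\ell_1,\dots,\ell_k$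 (the $j$th leg has label $\delta^{(\ell_j)}$), such that every connected component contains some $v_j$. Its degree is $\deg\Gamma=\sum_{e\in\mathcal E_\star}\deg\mathfrak t(e)+d(|\mathcal V_\star|-1)$, and its canonical valuation is $$(\Pi^K\Gamma)(\phi)=\int_{(\mathbf R^d)^{\mathcal V_\star}}\prod_{e\in\mathcal E_\star}K_{\mathfrak t(e)}(x_{e_+}-x_{e_-})\,(D_1^{\ell_1}\cdots D_k^{\ell_k}\phi)(x_{v_1},\dots,x_{v_k})\,dx .$$ A connected vacuum diagram $(\Gamma,v_\star,\mathfrak n)$ is a connected graph of this type (without legs) with at least one edge, a distinguished vertex $v_\star$ and a decoration $\mathfrak n:\mathcal V_\star\to\mathbf N^d$; its degree is $\sum_e\deg\mathfrak t(e)+\sum_v|\mathfrak n(v)|+d(|\mathcal V_\star|-1)$, and $$\Pi_-^K(\Gamma,v_\star,\mathfrak n)=\int_{(\mathbf R^d)^{\mathcal V_\star\setminus\{v_\star\}}}\prod_eK_{\mathfrak t(e)}(x_{e_+}-x_{e_-})\prod_w(x_w-x_{v_\star})^{\mathfrak n(w)}\,dx .$$ Let $\hat{\mathcal T}_-$ be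 the free commutative real algebra generated by the isomorphism classes of connected vacuum diagrams. For a half-edge $h$ of $e$, $\partial_h^{\delta_i}$ replaces $\mathfrak t(e)$ by $\mathfrak t(e)^{(\delta_i)}$, with a factor $-1$ if $h$ is outgoing; each edge has two half-edges, also if it is a self-loop. Let $\hat{\mathcal H}_-$ be the quotient of $\hat{\mathcal T}_-$ by the ideal generated by the following elements: * $\sum_{h\sim v}(\partial_h^{\delta_i}\Gamma,v_\star,\mathfrak n)+\mathfrak n(v)_i(\Gamma,v_\star,\mathfrak n-\delta_i\mathbf 1_v)$ for $v\neq v_\star$; * $\sum_{h\sim v_\star}(\partial_h^{\delta_i}\Gamma,v_\star,\mathfrak n)-\sum_{v\ne v_\star}\mathfrak n(v)_i(\Gamma,v_\star,\mathfrak n-\delta_i\mathbf 1_v)$; * $(\Gamma,v_\star,\mathfrak n)-\sum_{\mathfrak m\le\mathfrak n}(-1)^{|\mathfrak m|}\binom{\mathfrak n}{\mathfrak m}(\Gamma,v,\mathfrak n-\mathfrak m+(\Sigma\mathfrak m)\mathbf 1_{v_\star})$ for every vertex $v$. Let $\mathcal H_-$ be the further quotient by all diagrams of strictly positive degree. A subgraph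 $\bar\Gamma\subset\Gamma$ is a set of (internal) edges together with the vertices $\bar{\mathcal V}$ incident to them, and $\partial\bar\Gamma$ is the set of half-edges (including the incoming ends of legs) that do not belong to $\bar\Gamma$ but sit at a vertex of it. For $\ell:\partial\bar\Gamma\to\mathbf N^d$, write $\pi\ell(v)$ for the sum of $\ell$ over the half-edges at $v$, and $\Gamma/(\bar\Gamma,\ell)$ for the diagram obtained by contracting the components of $\bar\Gamma$ to nodes (adding up node decorations) and replacing the label $\mathfrak t$ of each remaining edge or leg by $\mathfrak t^{(k)}$, where $k$ is the sum of $\ell$ over its half-edges. Set $$\Delta\Gamma=\sum_{\bar\Gamma\subset\Gamma}\sum_{\ell}\frac{(-1)^{|\mathrm{out}\,\ell|}}{\ell!}(\bar\Gamma,\pi\ell)\otimes\Gamma/(\bar\Gamma,\ell)$$ for Feynman diagrams and, for connected vacuum diagrams, $$\Delta^-(\Gamma,v_\star,\mathfrak n)=\sum_{\bar\Gamma\subset\Gamma}\sum_{\ell,\ \bar{\mathfrak n}:\bar{\mathcal V}\to\mathbf N^d}\frac{(-1)^{|\mathrm{out}\,\ell|}}{\ell!}\binom{\mathfrak n}{\bar{\mathfrak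 n}}(\bar\Gamma,\bar{\mathfrak n}+\pi\ell)\otimes(\Gamma,v_\star,\mathfrak n-\bar{\mathfrak n})/(\bar\Gamma,\ell).$$ Here the first factors are products over connected components, regarded in $\mathcal H_-$, and $|\mathrm{out}\,\ell|$ is the sum of $|\ell(h)|$ over outgoing $h$. In $\Delta^-$ the second factor is regarded in $\hat{\mathcal H}_-$, and an isolated node is identified with $1$ if its decoration is $0$ and with $0$ otherwise. The distinguished vertices of the components of $\bar\Gamma$ are arbitrary, except that in $\Delta^-$ a component that contains $v_\star$ keeps $v_\star$. A twisted antipode is an algebra morphism $\hat{\mathcal A}:\mathcal H_-\to\hat{\mathcal H}_-$ such that $\mathcal M(\hat{\mathcal A}\otimes\mathrm{id})\Delta^-\Gamma=0$ for every connected vacuum diagram $\Gamma$ (with at least one edge) of degree $\le0$, where $\mathcal M$ is the product. A character $g$ is an algebra morphism $\mathcal H_-\to\mathbf R$, and $\Pi^K_g\Gamma=(g\otimes\Pi^K)\Delta\Gamma$. **Statement.** There is a unique twisted antipode $\hat{\mathcal A}$, and for every smooth kernel assignment $K$ the map $\Pi_-^K$ descends to a character of $\hat{\mathcal H}_-$,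 so that the BPHZ character $g^K_{\mathrm{BPHZ}}=\Pi_-^K\hat{\mathcal A}$ is well defined. It is characterised by a vanishing property. For a connected Feynman diagram $\Gamma$ with $k\ge1$ legs, at least one internal edge and $\deg\Gamma\le0$, and for $C\in\mathbf R$, let $\mathcal P_C(\Gamma)$ be the set of all $\phi\in\mathcal C^\infty_c((\mathbf R^d)^k)$ of the form $\phi=\phi_0\cdot\phi_1$, where $\phi_1$ depends only on $x_1+\dots+x_k$, $\phi_0$ depends only on the differences of the $x_i$, and there is a polynomial $P$ with $\deg P+\deg\Gamma\le0$ and $$\phi_0(x_1,\dots,x_k)=P(x_2-x_1,\dots,x_k-x_1)\qquad\text{for all } |x|\le C .$$ 1. For every such $\Gamma$ there is a constant $C$, depending only on $\Gamma$, such that for every smooth kernel assignment $K$ and every $\phi\in\mathcal P_C(\Gamma)$ one has $(\Pi^K_{\mathrm{BPHZ}}\Gamma)(\phi)=0$, where $\Pi^K_{\mathrm{BPHZ}}=\Pi^K_g$ with $g=g^K_{\mathrm{BPHZ}}$. 2. Conversely, let $K$ be a smooth kernel assignment and let $g$ be a character of $\mathcal H_-$ such that for every such $\Gamma$ there is a constant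 $C$ with $(\Pi^K_g\Gamma)(\phi)=0$ for all $\phi\in\mathcal P_C(\Gamma)$. Then $g=g^K_{\mathrm{BPHZ}}$. -/

import Mathlib

open scoped ContDiff TensorProduct

noncomputable section

namespace Feynman

/-! ## Multiindices, derivatives, labels and kernels -/

abbrev MultiIndex (d : ℕ) : Type := Fin d → ℕ

namespace MultiIndex

variable {d : ℕ}

/-- `|k|` -/
def size (k : MultiIndex d) : ℕ := ∑ i, k i

/-- `k!` -/
def fact (k : MultiIndex d) : ℕ := ∏ i, (k i).factorial

/-- The binomial coefficient `n choose m`; it vanishes unless `m ≤ n`. -/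
def binom (n m : MultiIndex d) : ℕ := ∏ i, (n i).choose (m i)

/-- The `i`th canonical multiindex. -/
def unit (i : Fin d) : MultiIndex d := Pi.single i 1

end MultiIndex

/-- The space `S = ℝ^d`. -/
abbrev Space (d : ℕ) : Type := EuclideanSpace ℝ (Fin d)

/-- The derivative of `f` in the direction `v`. -/
def partialDeriv {X : Type*} [NormedAddCommGroup X] [NormedSpace ℝ X] (v : X) (f : X → ℝ) :
    X → ℝ := fun x => fderiv ℝ f x v

/-- The iterated derivative of `f`, `k i` times in the direction `b i` for every `i`. -/
def multiDeriv {X : Type*} [NormedAddCommGroup X] [NormedSpace ℝ X] {n : ℕ}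
    (b : Fin n → X) (k : Fin n → ℕ) (f : X → ℝ) : X → ℝ :=
  (List.finRange n).foldr (fun i g => (partialDeriv (b i))^[k i] g) f

/-- `D^k f` for a function `f` on `S`. -/
def spaceDeriv {d : ℕ} (k : MultiIndex d) (f : Space d → ℝ) : Space d → ℝ :=
  multiDeriv (fun i => EuclideanSpace.single i 1) k f

/-- `D_1^{ℓ_1} ⋯ D_k^{ℓ_k} φ` for a function `φ` on `S^k`. -/
def legDeriv {d k : ℕ} (l : Fin k → MultiIndex d) (φ : (Fin k → Space d) → ℝ) :
    (Fin k → Space d) → ℝ :=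
  (List.finRange k).foldr
    (fun j g => multiDeriv (fun i => Pi.single j (EuclideanSpace.single i 1)) (l j) g) φ

/-- The labels of internal edges, with their degrees and the maps `t ↦ t^(k)`.
The full set of labels is the disjoint union of `Label` and the labels `δ^(k)` of legs,
where `k` ranges over all multiindices; the latter are represented by `k` itself. -/
structure LabelSystem (d : ℕ) where
  Label : Type
  countable : Countable Label
  deg : Label → ℝ
  shift : MultiIndex d → Label → Label
  shift_injective : ∀ k, Function.Injective (shift k)
  shift_zero : ∀ t, shift 0 t = t
  shift_shift : ∀ k l t, shift l (shift k t) = shift (k + l) t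
  deg_shift : ∀ k t, deg (shift k t) = deg t - k.size
  finitely_generated : ∃ S : Finset Label, ∀ t, ∃ s ∈ S, ∃ k, t = shift k s

variable {d : ℕ}

/-- Smooth kernel assignments: smooth kernels supported in the unit ball, compatible with
the maps `t ↦ t^(k)`, and of order `deg t` at the origin. -/
structure KernelAssignment (𝔏 : LabelSystem d) where
  ker : 𝔏.Label → Space d → ℝ
  smooth : ∀ t, ContDiff ℝ ∞ (ker t)
  support : ∀ t x, 1 < ‖x‖ → ker t x = 0
  bound : ∀ t (k : MultiIndex d), ∃ C : ℝ, ∀ x, x ≠ 0 →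
    |spaceDeriv k (ker t) x| ≤ C * ‖x‖ ^ (𝔏.deg t - k.size)
  ker_shift : ∀ k t, ker (𝔏.shift k t) = spaceDeriv k (ker t)

/-! ## Decorated graphs, subgraphs, contraction -/

/-- A finite directed multigraph (self-loops allowed) with labelled edges. -/
structure DecoratedGraph (𝔏 : LabelSystem d) where
  V : Type
  E : Type
  [fintypeV : Fintype V]
  [fintypeE : Fintype E]
  src : E → V
  tgt : E → V
  label : E → 𝔏.Label

attribute [instance] DecoratedGraph.fintypeV DecoratedGraph.fintypeE

namespace DecoratedGraph

variable {𝔏 : LabelSystem d} (G : DecoratedGraph 𝔏)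

/-- `u` and `v` are joined by a path of edges, irrespective of their directions. -/
def Joined (u v : G.V) : Prop :=
  Relation.EqvGen (fun a b => ∃ e, G.src e = a ∧ G.tgt e = b) u v

def Connected : Prop := Nonempty G.V ∧ ∀ u v, G.Joined u v

/-- The degree `∑_e deg t(e) + d (|V| - 1)`. -/
def deg : ℝ := ∑ e, 𝔏.deg (G.label e) + (d : ℝ) * ((Fintype.card G.V : ℝ) - 1)

/-- Half-edges: `(e, true)` is the incoming one at the target of `e`,
`(e, false)` the outgoing one at the source of `e`. -/
abbrev HalfEdge : Type := G.E × Bool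

/-- The vertex at which a half-edge sits. -/
def endpoint (h : G.HalfEdge) : G.V := if h.2 then G.tgt h.1 else G.src h.1

/-- A subgraph is given by a set `F` of edges; its vertices are those incident to an edge
in `F`. -/
def verts (F : Finset G.E) : Set G.V := {v | ∃ e ∈ F, G.src e = v ∨ G.tgt e = v}

/-- The half-edges adjacent to the subgraph `F`. -/
def boundary (F : Finset G.E) : Set G.HalfEdge := {h | h.1 ∉ F ∧ G.endpoint h ∈ G.verts F}

/-- Two vertices are equivalent if they are joined by edges in `F`. -/
def subSetoid (F : Finset G.E) : Setoid G.V :=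
  Relation.EqvGen.setoid (fun a b => ∃ e ∈ F, G.src e = a ∧ G.tgt e = b)

/-- The vertices of the graph in which every connected component of `F` is contracted to
a node. -/
abbrev Classes (F : Finset G.E) : Type := Quotient (G.subSetoid F)

def cls (F : Finset G.E) (v : G.V) : G.Classes F := Quotient.mk (G.subSetoid F) v

theorem cls_tgt {F : Finset G.E} {e : G.E} (he : e ∈ F) :
    G.cls F (G.tgt e) = G.cls F (G.src e) :=
  (Quotient.sound (s := G.subSetoid F) (Relation.EqvGen.rel _ _ ⟨e, he, rfl, rfl⟩)).symm

open Classical in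
/-- The graph obtained by contracting every connected component of `F` to a node, the label
of `e` being replaced by `t^(ℓ(e,false) + ℓ(e,true))`. -/
def contract (F : Finset G.E) (l : G.HalfEdge → MultiIndex d) : DecoratedGraph 𝔏 where
  V := G.Classes F
  E := {e : G.E // e ∉ F}
  fintypeV := Fintype.ofFinite _
  fintypeE := Fintype.ofFinite _
  src e := G.cls F (G.src e)
  tgt e := G.cls F (G.tgt e)
  label e := 𝔏.shift (l (e, false) + l (e, true)) (G.label e)

theorem joined_contract (F : Finset G.E) (l : G.HalfEdge → MultiIndex d) {u v : G.V}
    (h : G.Joined u v) : (G.contract F l).Joined (G.cls F u) (G.cls F v) := by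
  induction h with
  | rel a b h =>
    obtain ⟨e, rfl, rfl⟩ := h
    by_cases he : e ∈ F
    · rw [G.cls_tgt he]; exact Relation.EqvGen.refl _
    · exact Relation.EqvGen.rel _ _ ⟨⟨e, he⟩, rfl, rfl⟩
  | refl a => exact Relation.EqvGen.refl _
  | symm a b _ ih => exact Relation.EqvGen.symm _ _ ih
  | trans a b c _ _ ih1 ih2 => exact Relation.EqvGen.trans _ _ _ ih1 ih2

theorem connected_contract (hG : G.Connected) (F : Finset G.E)
    (l : G.HalfEdge → MultiIndex d) : (G.contract F l).Connected := by
  refine ⟨hG.1.map (G.cls F), fun u v => ?_⟩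
  induction u using Quotient.inductionOn with
  | _ u =>
    induction v using Quotient.inductionOn with
    | _ v => exact G.joined_contract F l (hG.2 u v)

open Classical in
/-- The part of the subgraph `F` that sits on the class `c`. If it has an edge, it is a
connected component of the subgraph, and all components are of this form. -/
def component (F : Finset G.E) (c : G.Classes F) : DecoratedGraph 𝔏 where
  V := {v : G.V // G.cls F v = c}
  E := {e : G.E // e ∈ F ∧ G.cls F (G.src e) = c}
  fintypeV := Fintype.ofFinite _
  fintypeE := Fintype.ofFinite _
  src e := ⟨G.src e, e.2.2⟩
  tgt e := ⟨G.tgt e, (G.cls_tgt e.2.1).trans e.2.2⟩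
  label e := G.label e

theorem connected_component (F : Finset G.E) (c : G.Classes F) :
    (G.component F c).Connected := by
  have key : ∀ u v : G.V,
      Relation.EqvGen (fun a b => ∃ e ∈ F, G.src e = a ∧ G.tgt e = b) u v →
      ∀ (hu : G.cls F u = c) (hv : G.cls F v = c),
        (G.component F c).Joined ⟨u, hu⟩ ⟨v, hv⟩ := by
    intro u v h
    induction h with
    | rel a b h =>
      obtain ⟨e, he, rfl, rfl⟩ := h
      intro hu hv
      exact Relation.EqvGen.rel _ _ ⟨⟨e, he, hu⟩, rfl, rfl⟩
    | refl a => intro hu hv; exact Relation.EqvGen.refl _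
    | symm a b _ ih => intro hu hv; exact Relation.EqvGen.symm _ _ (ih hv hu)
    | trans a b e h1 _ ih1 ih2 =>
      intro hu hv
      have hb : G.cls F b = c := (Quotient.sound (s := G.subSetoid F) h1).symm.trans hu
      exact Relation.EqvGen.trans _ _ _ (ih1 hu hb) (ih2 hb hv)
  refine ⟨?_, ?_⟩
  · obtain ⟨v, hv⟩ := Quotient.exists_rep c
    exact ⟨⟨v, hv⟩⟩
  · rintro ⟨u, hu⟩ ⟨v, hv⟩
    exact key u v (Quotient.exact (s := G.subSetoid F) (hu.trans hv.symm)) hu hv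

open Classical in
/-- The node decoration `(πℓ)(v) = ∑_{(e,v)} ℓ(e,v)`. -/
def nodeSum (l : G.HalfEdge → MultiIndex d) (v : G.V) : MultiIndex d :=
  ∑ h : G.HalfEdge, if G.endpoint h = v then l h else 0

/-- `|out ℓ|` -/
def outSize (l : G.HalfEdge → MultiIndex d) : ℕ := ∑ e : G.E, (l (e, false)).size

end DecoratedGraph

/-! ## Connected vacuum diagrams and the algebras they generate -/

/-- A connected vacuum diagram `(Γ, v⋆, n)` with at least one (internal) edge. Its unique leg
is represented by the distinguished vertex `root` to which it is attached. -/
structure VacuumDiagram (𝔏 : LabelSystem d) extends DecoratedGraph 𝔏 where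
  root : V
  node : V → MultiIndex d
  connected : toDecoratedGraph.Connected
  nonempty_edge : Nonempty E

namespace VacuumDiagram

variable {𝔏 : LabelSystem d} (Γ : VacuumDiagram 𝔏)

/-- The degree `∑_e deg t(e) + ∑_v |n(v)| + d (|V| - 1)`. -/
def degree : ℝ := Γ.toDecoratedGraph.deg + ∑ v, ((Γ.node v).size : ℝ)

/-- Isomorphism of connected vacuum diagrams. -/
def Iso (Γ Γ' : VacuumDiagram 𝔏) : Prop :=
  ∃ (a : Γ.V ≃ Γ'.V) (b : Γ.E ≃ Γ'.E),
    (∀ e, Γ'.src (b e) = a (Γ.src e)) ∧ (∀ e, Γ'.tgt (b e) = a (Γ.tgt e)) ∧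
    (∀ e, Γ'.label (b e) = Γ.label e) ∧ Γ'.root = a Γ.root ∧
    ∀ v, Γ'.node (a v) = Γ.node v

/-- Replace root and node decoration. -/
def decorate (v : Γ.V) (n : Γ.V → MultiIndex d) : VacuumDiagram 𝔏 :=
  { Γ with root := v, node := n }

open Classical in
/-- Replace the label `t` of the edge `e` by `t^(k)`. -/
def shiftEdge (e : Γ.E) (k : MultiIndex d) : VacuumDiagram 𝔏 :=
  { Γ with
    label := Function.update Γ.label e (𝔏.shift k (Γ.label e))
    connected := Γ.connected }

end VacuumDiagram

/-- The algebra of vacuum diagrams all of whose components have at least one edge, freely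
generated (as a commutative algebra) by the connected ones. Isomorphic diagrams are
identified in the quotients below. -/
abbrev THat (𝔏 : LabelSystem d) : Type 1 := MvPolynomial (VacuumDiagram 𝔏) ℝ

section Relations

variable {𝔏 : LabelSystem d}

/-- The generator of `THat` given by a connected vacuum diagram. -/
def gen (Γ : VacuumDiagram 𝔏) : THat 𝔏 := MvPolynomial.X Γ

open Classical in
/-- `∑_{e ∼ v} (∂_{(e,v)}^{δ_i} Γ, v⋆, n)`, where the sum runs over all half-edges at `v` and
outgoing half-edges come with a minus sign. -/
def derivAt (Γ : VacuumDiagram 𝔏) (v : Γ.V) (i : Fin d) : THat 𝔏 :=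
  ∑ e : Γ.E, ((if Γ.tgt e = v then gen (Γ.shiftEdge e (MultiIndex.unit i)) else 0)
    - (if Γ.src e = v then gen (Γ.shiftEdge e (MultiIndex.unit i)) else 0))

open Classical in
/-- `n(v)_i (Γ, v⋆, n - δ_i 1_v)` -/
def lowerNode (Γ : VacuumDiagram 𝔏) (v : Γ.V) (i : Fin d) : THat 𝔏 :=
  (Γ.node v i : ℝ) • gen (Γ.decorate Γ.root (Γ.node - Pi.single v (MultiIndex.unit i)))

/-- Integration by parts at a vertex other than the distinguished one. -/
def ibpRelation (Γ : VacuumDiagram 𝔏) (v : Γ.V) (i : Fin d) : THat 𝔏 :=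
  derivAt Γ v i + lowerNode Γ v i

open Classical in
/-- Integration by parts at the distinguished vertex. -/
def ibpRootRelation (Γ : VacuumDiagram 𝔏) (i : Fin d) : THat 𝔏 :=
  derivAt Γ Γ.root i - ∑ v ∈ Finset.univ.erase Γ.root, lowerNode Γ v i

open Classical in
/-- Change of the distinguished vertex from `v⋆` to `v`. -/
def moveRelation (Γ : VacuumDiagram 𝔏) (v : Γ.V) : THat 𝔏 :=
  gen Γ - ∑ m ∈ Finset.Iic Γ.node,
    ((-1 : ℝ) ^ (∑ u, (m u).size) * (∏ u, ((Γ.node u).binom (m u) : ℝ))) •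
      gen (Γ.decorate v (Γ.node - m + Pi.single Γ.root (∑ u, m u)))

/-- The ideal generated by all identifications between vacuum diagrams. -/
def relIdeal (𝔏 : LabelSystem d) : Ideal (THat 𝔏) :=
  Ideal.span
    ({x | ∃ Γ Γ' : VacuumDiagram 𝔏, Γ.Iso Γ' ∧ x = gen Γ - gen Γ'} ∪
     {x | ∃ (Γ : VacuumDiagram 𝔏) (v : Γ.V) (i : Fin d), v ≠ Γ.root ∧ x = ibpRelation Γ v i} ∪
     {x | ∃ (Γ : VacuumDiagram 𝔏) (i : Fin d), x = ibpRootRelation Γ i} ∪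
     {x | ∃ (Γ : VacuumDiagram 𝔏) (v : Γ.V), x = moveRelation Γ v})

/-- The ideal generated by the diagrams of strictly positive degree. -/
def posIdeal (𝔏 : LabelSystem d) : Ideal (THat 𝔏) :=
  Ideal.span {x | ∃ Γ : VacuumDiagram 𝔏, 0 < Γ.degree ∧ x = gen Γ}

end Relations

/-- The algebra of all vacuum diagrams modulo the identifications. -/
abbrev HHat (𝔏 : LabelSystem d) : Type 1 := THat 𝔏 ⧸ relIdeal 𝔏

/-- The algebra of divergent vacuum diagrams modulo the identifications, namely the quotient
of the algebra of all vacuum diagrams by the identifications and the diagrams of positive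
degree. -/
abbrev HMinus (𝔏 : LabelSystem d) : Type 1 := THat 𝔏 ⧸ (relIdeal 𝔏 ⊔ posIdeal 𝔏)

def toHHat {𝔏 : LabelSystem d} : THat 𝔏 →ₐ[ℝ] HHat 𝔏 := Ideal.Quotient.mkₐ ℝ _

def toHMinus {𝔏 : LabelSystem d} : THat 𝔏 →ₐ[ℝ] HMinus 𝔏 := Ideal.Quotient.mkₐ ℝ _

namespace DecoratedGraph

variable {𝔏 : LabelSystem d} (G : DecoratedGraph 𝔏)

open Classical in
/-- The vacuum diagram `(Γ̄, n)` given by the subgraph `F` with node decoration `n`: the product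
of its connected components, the one on the class `c` with distinguished vertex `r c`. -/
def extract (F : Finset G.E) (r : G.Classes F → G.V) (hr : ∀ c, G.cls F (r c) = c)
    (n : G.V → MultiIndex d) : THat 𝔏 :=
  letI : Fintype (G.Classes F) := Fintype.ofFinite _
  ∏ c : G.Classes F,
    if h : Nonempty (G.component F c).E then
      gen { G.component F c with
        root := ⟨r c, hr c⟩
        node := fun v => n v.1
        connected := G.connected_component F c
        nonempty_edge := h }
    else 1

end DecoratedGraph

namespace VacuumDiagram

variable {𝔏 : LabelSystem d} (Γ : VacuumDiagram 𝔏)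

open Classical in
/-- `(Γ, v⋆, n) / (F, ℓ)`: nodes get the sum of the decorations of the vertices contracted to
them. If no edge is left, it is a single node, which is identified with `1` if its decoration
vanishes and with `0` otherwise. -/
def quotientBy (F : Finset Γ.E) (l : Γ.toDecoratedGraph.HalfEdge → MultiIndex d)
    (n : Γ.V → MultiIndex d) : THat 𝔏 :=
  if h : Nonempty (Γ.toDecoratedGraph.contract F l).E then
    gen { Γ.toDecoratedGraph.contract F l with
      root := Γ.toDecoratedGraph.cls F Γ.root
      node := fun c => ∑ v : Γ.V, if Γ.toDecoratedGraph.cls F v = c then n v else 0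
      connected := Γ.toDecoratedGraph.connected_contract Γ.connected F l
      nonempty_edge := h }
  else if n = 0 then 1 else 0

open Classical in
/-- The distinguished vertices of the components of a subgraph: the component that contains
`v⋆`, if any, keeps it, and the choice is arbitrary for the others. -/
def rootChoice (F : Finset Γ.E) (c : Γ.toDecoratedGraph.Classes F) : Γ.V :=
  if Γ.toDecoratedGraph.cls F Γ.root = c then Γ.root else c.out

theorem cls_rootChoice (F : Finset Γ.E) (c : Γ.toDecoratedGraph.Classes F) :
    Γ.toDecoratedGraph.cls F (Γ.rootChoice F c) = c := by
  unfold rootChoice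
  split_ifs with h
  · exact h
  · exact Quotient.out_eq c

open Classical in
/-- The map `Δ⁻` from vacuum diagrams to `HMinus ⊗ HHat`, on connected diagrams. The inner sum
runs over `p = (ℓ, n̄)` with `ℓ` supported on the boundary of `F` and `n̄` supported on its
vertices; only finitely many of its terms are nonzero. -/
def coproduct : HMinus 𝔏 ⊗[ℝ] HHat 𝔏 :=
  ∑ F : Finset Γ.E,
    ∑ᶠ p ∈ {p : (Γ.toDecoratedGraph.HalfEdge → MultiIndex d) × (Γ.V → MultiIndex d) |
        (∀ h, h ∉ Γ.toDecoratedGraph.boundary F → p.1 h = 0) ∧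
        (∀ v, v ∉ Γ.toDecoratedGraph.verts F → p.2 v = 0)},
      ((-1 : ℝ) ^ Γ.toDecoratedGraph.outSize p.1 / (∏ h, ((p.1 h).fact : ℝ)) *
        ∏ v, ((Γ.node v).binom (p.2 v) : ℝ)) •
      (toHMinus (Γ.toDecoratedGraph.extract F (Γ.rootChoice F) (Γ.cls_rootChoice F)
          (p.2 + Γ.toDecoratedGraph.nodeSum p.1)) ⊗ₜ[ℝ]
        toHHat (Γ.quotientBy F p.1 (Γ.node - p.2)))

open Classical in
/-- The constant `Π₋^K Γ`. The integrand is invariant under simultaneous translations, and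
`x_{v⋆}`, over which one does not integrate, is set to `0`. -/
def vacuumValue (K : KernelAssignment 𝔏) : ℝ :=
  ∫ y : {v : Γ.V // v ≠ Γ.root} → Space d,
    let x : Γ.V → Space d := fun v => if h : v ≠ Γ.root then y ⟨v, h⟩ else 0
    (∏ e : Γ.E, K.ker (Γ.label e) (x (Γ.tgt e) - x (Γ.src e))) *
      ∏ w : Γ.V, ∏ i : Fin d, ((x w - x Γ.root) i) ^ (Γ.node w i)

end VacuumDiagram

/-- Characters of `HMinus`. -/
abbrev Character (𝔏 : LabelSystem d) : Type 1 := HMinus 𝔏 →ₐ[ℝ] ℝ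

/-- The twisted antipode: the multiplicative map `A : HMinus → HHat` such that
`M (A ⊗ id) Δ⁻ Γ = 0` for every nonempty connected vacuum diagram `Γ` with `deg Γ ≤ 0`. -/
def IsTwistedAntipode {𝔏 : LabelSystem d} (A : HMinus 𝔏 →ₐ[ℝ] HHat 𝔏) : Prop :=
  ∀ Γ : VacuumDiagram 𝔏, Γ.degree ≤ 0 →
    LinearMap.mul' ℝ (HHat 𝔏)
      (TensorProduct.map A.toLinearMap LinearMap.id Γ.coproduct) = 0

/-- `P` is the character `Π₋^K` of `HHat`. -/
def IsVacuumCharacter {𝔏 : LabelSystem d} (K : KernelAssignment 𝔏)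
    (P : HHat 𝔏 →ₐ[ℝ] ℝ) : Prop :=
  ∀ Γ : VacuumDiagram 𝔏, P (toHHat (gen Γ)) = Γ.vacuumValue K

/-- `g` is the BPHZ character `Π₋^K A`, where `A` is the twisted antipode. -/
def IsBPHZ {𝔏 : LabelSystem d} (K : KernelAssignment 𝔏) (g : Character 𝔏) : Prop :=
  ∃ (A : HMinus 𝔏 →ₐ[ℝ] HHat 𝔏) (P : HHat 𝔏 →ₐ[ℝ] ℝ),
    IsTwistedAntipode A ∧ IsVacuumCharacter K P ∧ g = P.comp A

/-! ## Feynman diagrams and valuations -/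

/-- A Feynman diagram with `k` legs. The underlying graph is that of the internal vertices and
edges; the `j`th leg is attached to the vertex `leg j` and has label `δ^(legIndex j)`. -/
structure FeynmanDiagram (𝔏 : LabelSystem d) (k : ℕ) extends DecoratedGraph 𝔏 where
  leg : Fin k → V
  legIndex : Fin k → MultiIndex d
  exists_leg : ∀ v : V, ∃ j, toDecoratedGraph.Joined v (leg j)

namespace FeynmanDiagram

variable {𝔏 : LabelSystem d} {k : ℕ} (Γ : FeynmanDiagram 𝔏 k)

open Classical in
/-- The canonical valuation `(Π^K Γ)(φ)`. -/
def valuation (K : KernelAssignment 𝔏) (φ : (Fin k → Space d) → ℝ) : ℝ :=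
  ∫ x : Γ.V → Space d,
    (∏ e : Γ.E, K.ker (Γ.label e) (x (Γ.tgt e) - x (Γ.src e))) *
      legDeriv Γ.legIndex φ (fun j => x (Γ.leg j))

/-- The Feynman diagram `Γ / (F, ℓ)`; the restriction of `ℓ` to the legs is the argument `q`. -/
def quotientBy (F : Finset Γ.E) (l : Γ.toDecoratedGraph.HalfEdge → MultiIndex d)
    (q : Fin k → MultiIndex d) : FeynmanDiagram 𝔏 k :=
  { Γ.toDecoratedGraph.contract F l with
    leg := fun j => Γ.toDecoratedGraph.cls F (Γ.leg j)
    legIndex := Γ.legIndex + q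
    exists_leg := fun c => by
      obtain ⟨v, rfl⟩ := Quotient.exists_rep c
      obtain ⟨j, hj⟩ := Γ.exists_leg v
      exact ⟨j, Γ.toDecoratedGraph.joined_contract F l hj⟩ }

open Classical in
/-- The node decoration `πℓ`, where the half-edges include those given by the legs. -/
def nodeSum (l : Γ.toDecoratedGraph.HalfEdge → MultiIndex d)
    (q : Fin k → MultiIndex d) (v : Γ.V) : MultiIndex d :=
  Γ.toDecoratedGraph.nodeSum l v + ∑ j, if Γ.leg j = v then q j else 0

open Classical in
/-- The coaction `Δ Γ`, with values in `HMinus ⊗ T_k`, where `T_k` is the free vector space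
generated by Feynman diagrams with `k` legs. The inner sum runs over decorations `p = (ℓ, q)` of
the half-edges and legs adjacent to `F`; only finitely many of its terms are nonzero. -/
def coaction : HMinus 𝔏 ⊗[ℝ] (FeynmanDiagram 𝔏 k →₀ ℝ) :=
  ∑ F : Finset Γ.E,
    ∑ᶠ p ∈ {p : (Γ.toDecoratedGraph.HalfEdge → MultiIndex d) × (Fin k → MultiIndex d) |
        (∀ h, h ∉ Γ.toDecoratedGraph.boundary F → p.1 h = 0) ∧
        (∀ j, Γ.leg j ∉ Γ.toDecoratedGraph.verts F → p.2 j = 0)},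
      ((-1 : ℝ) ^ Γ.toDecoratedGraph.outSize p.1 /
        ((∏ h, ((p.1 h).fact : ℝ)) * ∏ j, ((p.2 j).fact : ℝ))) •
      (toHMinus (Γ.toDecoratedGraph.extract F Quotient.out (fun c => Quotient.out_eq c)
          (Γ.nodeSum p.1 p.2)) ⊗ₜ[ℝ]
        Finsupp.single (Γ.quotientBy F p.1 p.2) (1 : ℝ))

/-- `M^g Γ = (g ⊗ id) Δ Γ` -/
def renormalise (g : Character 𝔏) : FeynmanDiagram 𝔏 k →₀ ℝ :=
  TensorProduct.lid ℝ _ (TensorProduct.map g.toLinearMap LinearMap.id Γ.coaction)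

/-- The renormalised valuation `(Π_g^K Γ)(φ) = (Π^K M^g Γ)(φ)`. -/
def renormValuation (K : KernelAssignment 𝔏) (g : Character 𝔏)
    (φ : (Fin k → Space d) → ℝ) : ℝ :=
  (Γ.renormalise g).sum fun Γ' c => c * Γ'.valuation K φ

end FeynmanDiagram

/-- Test functions `φ = φ₀ φ₁` on `S^{k+1}` such that `φ₁` depends only on the sum of the variables,
`φ₀` depends only on their differences, and `φ₀` coincides on the ball of radius `C` with a
polynomial `P` in the differences, where `deg P + a ≤ 0`. -/
def IsPolyTest {d : ℕ} (k : ℕ) (a C : ℝ) (φ : (Fin (k + 1) → Space d) → ℝ) : Prop :=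
  ContDiff ℝ ∞ φ ∧ HasCompactSupport φ ∧
  ∃ (φ₀ φ₁ : (Fin (k + 1) → Space d) → ℝ) (P : MvPolynomial (Fin k × Fin d) ℝ),
    (∀ x, φ x = φ₀ x * φ₁ x) ∧
    (∀ x y, ∑ i, x i = ∑ i, y i → φ₁ x = φ₁ y) ∧
    (∀ x y, (∀ i j, x i - x j = y i - y j) → φ₀ x = φ₀ y) ∧
    (P.totalDegree : ℝ) + a ≤ 0 ∧
    ∀ x, ‖x‖ ≤ C →
      φ₀ x = MvPolynomial.eval (fun p : Fin k × Fin d => (x p.1.succ - x 0) p.2) P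

end Feynman

end

/-!
The proof treats all node decorations of a vacuum diagram at once. For a map `A` on `THat`, the values
of a diagram with node decorations `n` are the values on the monomials `x^n` of a linear functional
`nodeFun` on polynomials in the positions of the vertices. The relations then read as in analysis:
a derivative distributed over the kernels at a vertex is minus the partial derivative of the
polynomial, and a change of the distinguished vertex is the substitution `recenter`.

A subgraph `F` enters the coproduct through sums over decorations of its boundary. If `A` vanishes on
diagrams of positive degree, then only finitely many decorations matter, and the values of `F` form
the coefficients of a polynomial, `extractSymbol`. It is viewed as a differential operator: a
variable at a vertex is a derivative, to be distributed over the half-edges there that are not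
contracted and over the node decoration. Applying this operator to the contraction of `F` gives
`term`, and a convolution of two maps is the sum of the terms of all subgraphs (`map_coproduct`).
Each term inherits integration by parts (`term_ibp`) and recentring (`term_move`), and does not depend
on the choice of the distinguished vertices of the components (`term_eq_term`), because changing
one of these modifies the operator by total derivatives at a node of the contraction, which vanish by
integration by parts there (`pairing_classSum_mul`).

The term of the full subgraph is the diagram itself, so the equation of a twisted antipode expresses
the value of a diagram by those of its proper subgraphs. This is a recursion on the number of edges.
It preserves the relations, since all other terms do (`respectsBelow_antipodeStep`), which yields
existence; the same recursion yields uniqueness (`eq_of_map_coproduct_eq_zero`).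

On the analytic side, the product of the kernels is translation invariant and forces all vertices to
be close to each other. By Fubini, a test function is therefore only seen through its average over
translations, restricted to a fixed ball (`integral_mul_eq_integral_extendZero`). For the test
functions of the theorem this average is a polynomial in the differences there (`HasPolyAverage`), in
a way that is compatible with derivatives. The ball does not depend on the kernels, and contractions
only make it smaller. Hence the renormalised valuation is the sum of the terms of all subgraphs for
the underlying vacuum diagram, the polynomial taking the place of the node decoration
(`renormValuation_eq_sum_term`). This is a convolution with `Π₋^K`, which vanishes for the BPHZ
character in nonpositive degree by definition of the twisted antipode. Conversely, attaching legs to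
all vertices and choosing a test function with nonzero average recovers the convolution at every
vacuum diagram of nonpositive degree without decoration at the distinguished vertex, which
determines the character.
-/

noncomputable section

namespace Feynman

/-! ### Linear functionals on polynomials and constant coefficient operators -/

section Polynomials

open MvPolynomial

variable {R : Type*} [CommRing R] {W S H L : Type*}

/-- The linear functional on polynomials with prescribed values on the monomials. -/
def monoFun (β : (W →₀ ℕ) → R) : MvPolynomial W R →ₗ[R] R :=
  (basisMonomials W R).constr R β

theorem monoFun_monomial (β : (W →₀ ℕ) → R) (s : W →₀ ℕ) (a : R) :
    monoFun β (monomial s a) = a * β s := by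
  have h : (monomial s a : MvPolynomial W R) = a • basisMonomials W R s := by
    simp [coe_basisMonomials, smul_monomial]
  rw [h, map_smul, monoFun, Module.Basis.constr_basis, smul_eq_mul]

theorem linearMap_ext_monomial {M : Type*} [AddCommMonoid M] [Module R M]
    {f g : MvPolynomial W R →ₗ[R] M} (h : ∀ s, f (monomial s 1) = g (monomial s 1)) : f = g :=
  (basisMonomials W R).ext fun s => by simpa [coe_basisMonomials] using h s

theorem linearMap₂_ext_monomial
    {f g : MvPolynomial S R →ₗ[R] MvPolynomial W R →ₗ[R] R}
    (h : ∀ s n, f (monomial s 1) (monomial n 1) = g (monomial s 1) (monomial n 1)) : f = g :=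
  linearMap_ext_monomial fun s => linearMap_ext_monomial fun n => h s n

theorem monoFun_eq (f : MvPolynomial W R →ₗ[R] R) (p : MvPolynomial W R) :
    monoFun (fun s => f (monomial s 1)) p = f p :=
  congrArg (fun g : MvPolynomial W R →ₗ[R] R => g p) <|
    linearMap_ext_monomial fun s => by rw [monoFun_monomial, one_mul]

theorem monoFun_X_mul (β : (W →₀ ℕ) → R) (w : W) (p : MvPolynomial W R) :
    monoFun β (X w * p) = monoFun (fun s => β (s + Finsupp.single w 1)) p := by
  have : (monoFun β).comp (LinearMap.mulLeft R (X w)) =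
      monoFun (fun s => β (s + Finsupp.single w 1)) :=
    linearMap_ext_monomial fun s => by
      simp only [LinearMap.comp_apply, LinearMap.mulLeft_apply, X, monomial_mul,
        monoFun_monomial, one_mul]
      rw [add_comm]
  exact congrArg (fun g : MvPolynomial W R →ₗ[R] R => g p) this

theorem monoFun_C (β : (W →₀ ℕ) → R) (a : R) : monoFun β (C a) = a * β 0 := by
  rw [C_apply, monoFun_monomial]

theorem monoFun_eq_sum (β : (W →₀ ℕ) → R) (p : MvPolynomial W R) :
    monoFun β p = ∑ s ∈ p.support, coeff s p * β s := by
  conv_lhs => rw [p.as_sum]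
  rw [map_sum]
  exact Finset.sum_congr rfl fun s _ => monoFun_monomial _ _ _

theorem monoFun_rename (f : W → S) (β : (S →₀ ℕ) → R) (p : MvPolynomial W R) :
    monoFun β (rename f p) = monoFun (fun s => β (s.mapDomain f)) p := by
  have : (monoFun β).comp (rename f : MvPolynomial W R →ₐ[R] MvPolynomial S R).toLinearMap =
      monoFun (fun s => β (s.mapDomain f)) :=
    linearMap_ext_monomial fun s => by
      simp [monoFun_monomial, rename_monomial]
  exact congrArg (fun g : MvPolynomial W R →ₗ[R] R => g p) this

/-- Substituting polynomials without constant term does not change the constant term. -/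
theorem coeff_zero_aeval (g : W → MvPolynomial S R) (hg : ∀ w, coeff 0 (g w) = 0)
    (p : MvPolynomial W R) : coeff 0 (aeval g p) = coeff 0 p := by
  induction p using MvPolynomial.induction_on with
  | C a => simp [algebraMap_eq]
  | add p q hp hq => rw [map_add, coeff_add, coeff_add, hp, hq]
  | mul_X p w _ =>
    rw [map_mul, aeval_X]
    simp only [← constantCoeff_eq] at hg ⊢
    simp [hg]

open Classical in
/-- The substitution of `∑_{f s = w} X s` for `X w`. -/
def pull [Fintype S] (f : S → W) : MvPolynomial W R →ₐ[R] MvPolynomial S R :=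
  aeval fun w => ∑ s, if f s = w then X s else 0

open Classical in
theorem pull_X [Fintype S] (f : S → W) (w : W) :
    pull (R := R) f (X w) = ∑ s, if f s = w then X s else 0 := by
  rw [pull, aeval_X]

theorem pull_C [Fintype S] (f : S → W) (a : R) : pull f (C a) = C a := by simp [pull, algebraMap_eq]

/-- The factorial `∏ s_w!` of an exponent. -/
def expFact [Fintype W] (s : W →₀ ℕ) : ℕ := ∏ w, (s w).factorial

theorem expFact_ne_zero [Fintype W] (s : W →₀ ℕ) : expFact s ≠ 0 :=
  Finset.prod_ne_zero_iff.2 fun _ _ => Nat.factorial_ne_zero _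

theorem expFact_add_single [Fintype W] (s : W →₀ ℕ) (w : W) :
    expFact (s + Finsupp.single w 1) = (s w + 1) * expFact s := by
  classical
  unfold expFact
  rw [← Finset.mul_prod_erase _ _ (Finset.mem_univ w),
    ← Finset.mul_prod_erase _ (fun x => (s x).factorial) (Finset.mem_univ w), ← mul_assoc]
  congr 1
  · simp [Nat.factorial_succ]
  · refine Finset.prod_congr rfl fun x hx => ?_
    have : w ≠ x := fun h => (Finset.mem_erase.1 hx).1 h.symm
    simp [this]

/-- The apolar pairing `⟨q, p⟩ = (q(∂) p)(0)`, as a functional of `q`. -/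
def apolar [Fintype W] (p : MvPolynomial W R) : MvPolynomial W R →ₗ[R] R :=
  monoFun fun s => (expFact s : R) * coeff s p

section

variable [Fintype W] [Fintype S]

theorem apolar_monomial (p : MvPolynomial W R) (s : W →₀ ℕ) (a : R) :
    apolar p (monomial s a) = a * ((expFact s : R) * coeff s p) := monoFun_monomial _ _ _

theorem apolar_C (p : MvPolynomial W R) (a : R) : apolar p (C a) = a * coeff 0 p := by
  rw [apolar, monoFun_C]; simp [expFact]

/-- Multiplication by a variable is adjoint to the corresponding partial derivative. -/
theorem apolar_X_mul (p : MvPolynomial W R) (w : W) (q : MvPolynomial W R) :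
    apolar p (X w * q) = apolar (pderiv w p) q := by
  rw [apolar, monoFun_X_mul, apolar]
  congr 2
  funext s
  rw [coeff_pderiv, expFact_add_single]
  push_cast
  ring

theorem apolar_add (p p' q : MvPolynomial W R) :
    apolar (p + p') q = apolar p q + apolar p' q := by
  have : apolar (p + p') = apolar p + apolar p' :=
    linearMap_ext_monomial fun s => by simp [apolar_monomial, mul_add]
  rw [this, LinearMap.add_apply]

theorem apolar_C_mul (a : R) (p q : MvPolynomial W R) :
    apolar (C a * p) q = a * apolar p q := by
  have : apolar (C a * p) = a • apolar p :=
    linearMap_ext_monomial fun s => by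
      simp only [apolar_monomial, coeff_C_mul, LinearMap.smul_apply, smul_eq_mul]; ring
  rw [this, LinearMap.smul_apply, smul_eq_mul]

/-- The pairing `⟨q, p⟩`, linear in `p`. -/
def apolarₗ (q : MvPolynomial W R) : MvPolynomial W R →ₗ[R] R where
  toFun p := apolar p q
  map_add' p p' := apolar_add p p' q
  map_smul' a p := by rw [smul_eq_C_mul, apolar_C_mul]; rfl

theorem apolar_sum {ι : Type*} (t : Finset ι) (p : ι → MvPolynomial W R) (q : MvPolynomial W R) :
    apolar (∑ i ∈ t, p i) q = ∑ i ∈ t, apolar (p i) q := map_sum (apolarₗ q) p t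

theorem apolar_comm (p q : MvPolynomial W R) : apolar p q = apolar q p := by
  have : apolar p = apolarₗ (W := W) p :=
    linearMap_ext_monomial fun s => by
      change _ = apolar (monomial s 1) p
      rw [apolar_monomial, apolar, monoFun_eq_sum]
      classical
      simp only [coeff_monomial, mul_ite, mul_one, mul_zero, Finset.sum_ite_eq,
        mem_support_iff, one_mul]
      split_ifs with h
      · ring
      · rw [not_not.1 h]; simp
  rw [this]; rfl

theorem apolar_X_mul_left (p : MvPolynomial W R) (w : W) (q : MvPolynomial W R) :
    apolar (X w * p) q = apolar p (pderiv w q) := by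
  rw [apolar_comm, apolar_X_mul, apolar_comm]

/-- Transposed linear substitutions are adjoint for the apolar pairing. -/
theorem apolar_aeval (M : W → S → R) (p : MvPolynomial S R) (q : MvPolynomial W R) :
    apolar p (aeval (fun w => ∑ s, C (M w s) * X s) q) =
      apolar (aeval (fun s => ∑ w, C (M w s) * X w) p) q := by
  have chain : ∀ (w : W) (p : MvPolynomial S R),
      pderiv w (aeval (fun s => ∑ w, C (M w s) * X w) p) =
        ∑ s, C (M w s) * aeval (fun s => ∑ w, C (M w s) * X w) (pderiv s p) := by
    classical
    intro w p
    induction p using MvPolynomial.induction_on with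
    | C a => simp [algebraMap_eq]
    | add p q hp hq => simp only [map_add, hp, hq, mul_add, Finset.sum_add_distrib]
    | mul_X p t hp =>
      simp only [map_mul, Derivation.leibniz, smul_eq_mul, map_add, aeval_X, hp, pderiv_X,
        mul_add, Finset.sum_add_distrib, map_sum, pderiv_C, Pi.single_apply, mul_zero, add_zero,
        mul_ite, mul_one, Finset.sum_ite_eq', Finset.mem_univ, if_true,
        apply_ite (aeval (fun s => ∑ w, C (M w s) * X w)), map_zero,
        Finset.mul_sum, Finset.sum_mul, Finset.sum_ite_eq]
      congr 1
      · ring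
      · rw [Finset.sum_comm]
        refine Finset.sum_congr rfl fun _ _ => Finset.sum_congr rfl fun _ _ => ?_
        ring
  induction q using MvPolynomial.induction_on generalizing p with
  | C a =>
    rw [aeval_C, algebraMap_eq, apolar_C, apolar_C, coeff_zero_aeval]
    intro s
    simp [coeff_sum, coeff_C_mul, coeff_zero_X]
  | add q q' h h' => simp only [map_add, h, h']
  | mul_X q w h =>
    rw [map_mul, aeval_X, mul_comm q, apolar_X_mul, mul_comm (aeval _ q), Finset.sum_mul, map_sum,
      chain, apolar_sum]
    refine Finset.sum_congr rfl fun s _ => ?_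
    rw [apolar_C_mul, ← h, mul_assoc, ← smul_eq_C_mul, map_smul, smul_eq_mul, apolar_X_mul]

omit [Fintype W] in
open Classical in
theorem pull_sumElim_X [Fintype H] [Fintype L] (f : H → W) (g : L → W) (w : W) :
    pull (R := R) (Sum.elim f g) (X w) = ∑ h, (if f h = w then X (Sum.inl h) else 0) +
      ∑ j, if g j = w then X (Sum.inr j) else 0 := by
  rw [pull_X, Fintype.sum_sum_type]; rfl

open Classical in
theorem pull_sumElim_id_X [Fintype H] (f : H → W) (w : W) :
    pull (R := R) (Sum.elim f id) (X w) =
      ∑ h, (if f h = w then X (Sum.inl h) else 0) + X (Sum.inr w) := by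
  rw [pull_sumElim_X]
  congr 1
  simp

/-- In terms of the values `s! · coeff s`, the substitution `pull f` adds up exponents along `f`: a
decoration of half-edges contributes through the node decoration that it induces. -/
theorem expFact_mul_coeff_pull (f : S → W) (p : MvPolynomial W R) (s : S →₀ ℕ) :
    (expFact s : R) * coeff s (pull f p) =
      (expFact (s.mapDomain f) : R) * coeff (s.mapDomain f) p := by
  classical
  have h := apolar_aeval (fun (s : S) (w : W) => if f s = w then (1 : R) else 0) p (monomial s 1)
  have h1 : aeval (fun s : S => ∑ w, C (if f s = w then (1 : R) else 0) * X w)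
        (monomial s (1 : R)) =
      (monomial (s.mapDomain f) 1 : MvPolynomial W R) := by
    rw [← rename_monomial, ← aeval_X_left_apply (rename f _), aeval_rename]
    congr 2
    funext s
    simp [apply_ite C]
  have h2 : (aeval (fun w : W => ∑ s, C (if f s = w then (1 : R) else 0) * X s) p) =
      pull f p := by
    rw [pull]
    congr 2
    funext s
    refine Finset.sum_congr rfl fun t _ => ?_
    split_ifs <;> simp
  rw [h1, h2, apolar_monomial, apolar_monomial] at h
  simpa using h.symm

end

/-- Substituting congruent elements gives congruent results. -/
theorem aeval_sub_self_mem (I : Ideal (MvPolynomial W R)) (g : W → MvPolynomial W R)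
    (hg : ∀ w, g w - X w ∈ I) (p : MvPolynomial W R) : aeval g p - p ∈ I := by
  induction p using MvPolynomial.induction_on with
  | C a => simp [algebraMap_eq]
  | add p q hp hq =>
    rw [map_add, add_sub_add_comm]; exact I.add_mem hp hq
  | mul_X p w hp =>
    rw [map_mul, aeval_X]
    have : aeval g p * g w - p * X w = (aeval g p - p) * g w + p * (g w - X w) := by ring
    rw [this]
    exact I.add_mem (I.mul_mem_right _ hp) (I.mul_mem_left _ (hg w))

/-- A finite product of elements that are congruent one by one. -/
theorem prod_sub_prod_mem {A ι : Type*} [CommRing A] (I : Ideal A) (t : Finset ι) (a b : ι → A)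
    (h : ∀ i ∈ t, a i - b i ∈ I) : ∏ i ∈ t, a i - ∏ i ∈ t, b i ∈ I := by
  rw [← Ideal.Quotient.eq, map_prod, map_prod]
  exact Finset.prod_congr rfl fun i hi => Ideal.Quotient.eq.2 (h i hi)

/-! ### Operators paired with a family of functionals -/

section OpPair

variable [Fintype W]

/-- The pairing of a symbol `p`, a polynomial in formal derivatives `X (inl h)` of kernels and
partial derivatives `X (inr w)` of polynomials, with a polynomial `q`: the partial derivatives act
on `q`, the exponents `ℓ` of the formal derivatives pick the functional `β ℓ`, and this functional is
applied to the result. -/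
def opPair (β : (H →₀ ℕ) → (W →₀ ℕ) → R) :
    MvPolynomial (H ⊕ W) R →ₗ[R] MvPolynomial W R →ₗ[R] R :=
  (basisMonomials (H ⊕ W) R).constr R fun s => monoFun fun n =>
    ((∏ w, (n w).descFactorial (s (Sum.inr w)) : ℕ) : R) *
      β (s.comapDomain Sum.inl Sum.inl_injective.injOn)
        (n - s.comapDomain Sum.inr Sum.inr_injective.injOn)

theorem opPair_monomial (β : (H →₀ ℕ) → (W →₀ ℕ) → R) (s : H ⊕ W →₀ ℕ) (a : R) (n : W →₀ ℕ)
    (b : R) : opPair β (monomial s a) (monomial n b) =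
      a * b * (((∏ w, (n w).descFactorial (s (Sum.inr w)) : ℕ) : R) *
      β (s.comapDomain Sum.inl Sum.inl_injective.injOn)
        (n - s.comapDomain Sum.inr Sum.inr_injective.injOn)) := by
  have h : (monomial s a : MvPolynomial (H ⊕ W) R) = a • basisMonomials (H ⊕ W) R s := by
    simp [coe_basisMonomials, smul_monomial]
  rw [h, map_smul, opPair, Module.Basis.constr_basis, LinearMap.smul_apply, monoFun_monomial,
    smul_eq_mul, mul_assoc]

theorem opPair_C (β : (H →₀ ℕ) → (W →₀ ℕ) → R) (a : R) (q : MvPolynomial W R) :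
    opPair β (C a) q = a * monoFun (β 0) q := by
  have : opPair β (C a) = a • monoFun (β 0) :=
    linearMap_ext_monomial fun n => by
      rw [C_apply, opPair_monomial, LinearMap.smul_apply, monoFun_monomial, smul_eq_mul]
      have e1 : (0 : H ⊕ W →₀ ℕ).comapDomain Sum.inl Sum.inl_injective.injOn = 0 := by ext; simp
      have e2 : (0 : H ⊕ W →₀ ℕ).comapDomain Sum.inr Sum.inr_injective.injOn = 0 := by ext; simp
      rw [e1, e2]
      simp
  rw [this]; rfl

theorem opPair_inl_mul (β : (H →₀ ℕ) → (W →₀ ℕ) → R) (h : H) (p : MvPolynomial (H ⊕ W) R)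
    (q : MvPolynomial W R) : opPair β (X (Sum.inl h) * p) q =
      opPair (fun l n => β (l + Finsupp.single h 1) n) p q := by
  have : (opPair β).comp (LinearMap.mulLeft R (X (Sum.inl h))) =
      opPair (fun l n => β (l + Finsupp.single h 1) n) :=
    linearMap₂_ext_monomial fun s n => by
      classical
      rw [LinearMap.comp_apply, LinearMap.mulLeft_apply, X, monomial_mul, opPair_monomial,
        opPair_monomial]
      have e1 : (Finsupp.single (Sum.inl h) 1 + s : H ⊕ W →₀ ℕ).comapDomain Sum.inl
          Sum.inl_injective.injOn = s.comapDomain Sum.inl Sum.inl_injective.injOn +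
            Finsupp.single h 1 := by
        ext x; simp [Finsupp.single_apply, add_comm]
      have e2 : (Finsupp.single (Sum.inl h) 1 + s : H ⊕ W →₀ ℕ).comapDomain Sum.inr
          Sum.inr_injective.injOn = s.comapDomain Sum.inr Sum.inr_injective.injOn := by
        ext x; simp
      rw [e1, e2]
      simp
  exact congrArg (fun g : MvPolynomial (H ⊕ W) R →ₗ[R] MvPolynomial W R →ₗ[R] R => g p q) this

theorem opPair_inr_mul (β : (H →₀ ℕ) → (W →₀ ℕ) → R) (w : W) (p : MvPolynomial (H ⊕ W) R)
    (q : MvPolynomial W R) : opPair β (X (Sum.inr w) * p) q = opPair β p (pderiv w q) := by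
  have : (opPair β).comp (LinearMap.mulLeft R (X (Sum.inr w))) =
      (opPair β).compl₂ (pderiv w).toLinearMap :=
    linearMap₂_ext_monomial fun s n => by
      classical
      rw [LinearMap.comp_apply, LinearMap.mulLeft_apply, X, monomial_mul, opPair_monomial,
        LinearMap.compl₂_apply, show (pderiv w).toLinearMap (monomial n (1 : R)) = pderiv w (monomial n 1) from rfl,
        pderiv_monomial, opPair_monomial]
      have e1 : (Finsupp.single (Sum.inr w) 1 + s : H ⊕ W →₀ ℕ).comapDomain Sum.inl
          Sum.inl_injective.injOn = s.comapDomain Sum.inl Sum.inl_injective.injOn := by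
        ext x; simp
      have e2 : n - (Finsupp.single (Sum.inr w) 1 + s : H ⊕ W →₀ ℕ).comapDomain Sum.inr
          Sum.inr_injective.injOn =
            n - Finsupp.single w 1 - s.comapDomain Sum.inr Sum.inr_injective.injOn := by
        ext x; simp [Finsupp.single_apply, Nat.sub_sub]
      rw [e1, e2, ← Finset.mul_prod_erase _ _ (Finset.mem_univ w),
        ← Finset.mul_prod_erase _ (fun x => ((n - Finsupp.single w 1 : W →₀ ℕ) x).descFactorial _)
          (Finset.mem_univ w)]
      have e3 : ∏ x ∈ Finset.univ.erase w, (n x).descFactorial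
            ((Finsupp.single (Sum.inr w) 1 + s : H ⊕ W →₀ ℕ) (Sum.inr x)) =
          ∏ x ∈ Finset.univ.erase w,
            ((n - Finsupp.single w 1 : W →₀ ℕ) x).descFactorial (s (Sum.inr x)) := by
        refine Finset.prod_congr rfl fun x hx => ?_
        have : w ≠ x := fun h => (Finset.mem_erase.1 hx).1 h.symm
        simp [this]
      have e4 : (n w).descFactorial
            ((Finsupp.single (Sum.inr w) 1 + s : H ⊕ W →₀ ℕ) (Sum.inr w)) =
          n w * ((n - Finsupp.single w 1 : W →₀ ℕ) w).descFactorial (s (Sum.inr w)) := by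
        simp only [Finsupp.add_apply, Finsupp.single_eq_same, Finsupp.coe_tsub, Pi.sub_apply]
        rcases n w with _ | k
        · simp [add_comm 1]
        · rw [add_comm 1, Nat.succ_descFactorial_succ]; simp
      rw [e3, e4]
      push_cast
      ring
  exact congrArg (fun g : MvPolynomial (H ⊕ W) R →ₗ[R] MvPolynomial W R →ₗ[R] R => g p q) this

theorem opPair_zero (p : MvPolynomial (H ⊕ W) R) (q : MvPolynomial W R) :
    opPair (fun _ _ => 0) p q = 0 := by
  have : opPair (fun (_ : H →₀ ℕ) (_ : W →₀ ℕ) => (0 : R)) = 0 :=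
    linearMap₂_ext_monomial fun s n => by simp [opPair_monomial]
  rw [this]; rfl

theorem opPair_neg (β : (H →₀ ℕ) → (W →₀ ℕ) → R) (p : MvPolynomial (H ⊕ W) R)
    (q : MvPolynomial W R) : opPair (fun l n => -β l n) p q = -opPair β p q := by
  have : opPair (fun l n => -β l n) = -opPair β :=
    linearMap₂_ext_monomial fun s n => by simp [opPair_monomial]
  rw [this]; rfl

/-- Integration by parts for the functionals `β ℓ` on one side yields integration by parts for the
pairing with symbols. -/
theorem opPair_sum_mul_eq_zero (s : Finset H) (t : Finset W) (β : (H →₀ ℕ) → (W →₀ ℕ) → R)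
    (hβ : ∀ l n, ∑ h ∈ s, β (l + Finsupp.single h 1) n +
      ∑ w ∈ t, (n w : R) * β l (n - Finsupp.single w 1) = 0)
    (p : MvPolynomial (H ⊕ W) R) (q : MvPolynomial W R) :
    opPair β ((∑ h ∈ s, X (Sum.inl h) + ∑ w ∈ t, X (Sum.inr w)) * p) q = 0 := by
  induction p using MvPolynomial.induction_on generalizing β q with
  | C a =>
    rw [mul_comm, ← smul_eq_C_mul, map_smul, LinearMap.smul_apply, smul_eq_mul]
    refine mul_eq_zero_of_right _ ?_
    have : opPair β (∑ h ∈ s, X (Sum.inl h) + ∑ w ∈ t, X (Sum.inr w)) = 0 :=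
      linearMap_ext_monomial fun n => by
        have h1 : ∀ x : H ⊕ W, (X x : MvPolynomial (H ⊕ W) R) = X x * C 1 := by simp
        simp only [map_add, map_sum, LinearMap.add_apply, LinearMap.sum_apply]
        rw [LinearMap.zero_apply, ← hβ 0 n]
        congr 1
        · refine Finset.sum_congr rfl fun h _ => ?_
          rw [h1, opPair_inl_mul, opPair_C, monoFun_monomial]; simp
        · refine Finset.sum_congr rfl fun h _ => ?_
          rw [h1, opPair_inr_mul, opPair_C, pderiv_monomial, monoFun_monomial]; simp
    rw [this]; rfl
  | add p p' h h' => rw [mul_add, map_add, LinearMap.add_apply, h β hβ, h' β hβ, add_zero]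
  | mul_X p x h =>
    rw [mul_comm p, mul_left_comm]
    rcases x with x | x
    · rw [opPair_inl_mul]
      refine h _ (fun l n => ?_) q
      rw [← hβ (l + Finsupp.single x 1) n]
      simp only [add_right_comm]
    · rw [opPair_inr_mul]; exact h β hβ _

/-- If the functionals `β ℓ` and `β' ℓ` are related by a substitution `τ`, then so are their pairings
with symbols that only involve partial derivatives commuting with `τ`, here those at `w ∉ Z`. -/
theorem opPair_eq_opPair_of_commute [Fintype H] (f : H → W) (β β' : (H →₀ ℕ) → (W →₀ ℕ) → R)
    (Z : Set W) [DecidablePred (· ∈ Z)] (τ : MvPolynomial W R →ₐ[R] MvPolynomial W R)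
    (hτ : ∀ w ∉ Z, ∀ q, pderiv w (τ q) = τ (pderiv w q))
    (hβ : ∀ l q, monoFun (β l) q = monoFun (β' l) (τ q)) (p q : MvPolynomial W R) :
    opPair β (pull (Sum.elim f id) (aeval (fun w => if w ∈ Z then 0 else X w) p)) q =
      opPair β' (pull (Sum.elim f id) (aeval (fun w => if w ∈ Z then 0 else X w) p)) (τ q) := by
  induction p using MvPolynomial.induction_on generalizing β β' q with
  | C a =>
    simp only [aeval_C, algebraMap_eq]
    rw [pull_C,
      opPair_C, opPair_C, hβ]
  | add p p' h h' =>
    simp only [map_add, LinearMap.add_apply, h β β' hβ, h' β β' hβ]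
  | mul_X p w h =>
    rw [mul_comm p, map_mul, aeval_X]
    by_cases hw : w ∈ Z
    · simp [hw]
    · classical
      rw [if_neg hw, map_mul, pull_sumElim_id_X, add_mul, Finset.sum_mul]
      simp only [map_add, map_sum, LinearMap.add_apply, LinearMap.sum_apply, opPair_inr_mul, hτ w hw,
        h β β' hβ, ite_mul, zero_mul]
      congr 1
      refine Finset.sum_congr rfl fun x _ => ?_
      split_ifs
      · rw [opPair_inl_mul, opPair_inl_mul]
        exact h _ _ (fun l q => hβ _ q) q
      · simp

/-- The pairing can be computed on other variables `L` in place of the partial derivatives, if these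
act on a family of polynomials in the same way. -/
theorem monoFun_pull_eq_opPair [Fintype H] [Fintype L] (f : H → W) (g : L → W)
    (β : (H →₀ ℕ) → (W →₀ ℕ) → R) (γ : (H ⊕ L →₀ ℕ) → R) (q : (L →₀ ℕ) → MvPolynomial W R)
    (hγ : ∀ s, γ s = monoFun (β (s.comapDomain Sum.inl Sum.inl_injective.injOn))
      (q (s.comapDomain Sum.inr Sum.inr_injective.injOn)))
    (hq : ∀ s w, pderiv w (q s) =
      ∑ j, open Classical in if g j = w then q (s + Finsupp.single j 1) else 0)
    (p : MvPolynomial W R) :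
    monoFun γ (pull (Sum.elim f g) p) = opPair β (pull (Sum.elim f id) p) (q 0) := by
  classical
  induction p using MvPolynomial.induction_on generalizing β γ q with
  | C a =>
    rw [pull_C, pull_C,
      opPair_C, monoFun_C, hγ]
    have e1 : (0 : H ⊕ L →₀ ℕ).comapDomain Sum.inl Sum.inl_injective.injOn = 0 := by ext; simp
    have e2 : (0 : H ⊕ L →₀ ℕ).comapDomain Sum.inr Sum.inr_injective.injOn = 0 := by ext; simp
    rw [e1, e2]
  | add p p' h h' =>
    simp only [map_add, LinearMap.add_apply, h β γ q hγ hq, h' β γ q hγ hq]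
  | mul_X p w h =>
    rw [mul_comm p, map_mul (pull _), map_mul (pull _), pull_sumElim_X, pull_sumElim_id_X, add_mul,
      add_mul, Finset.sum_mul, Finset.sum_mul, Finset.sum_mul]
    rw [map_add, map_add, LinearMap.add_apply, map_sum, map_sum, map_sum (opPair β), opPair_inr_mul, LinearMap.sum_apply]
    simp only [ite_mul, zero_mul]
    congr 1
    · refine Finset.sum_congr rfl fun x _ => ?_
      split_ifs
      · rw [opPair_inl_mul, monoFun_X_mul]
        refine h _ _ q (fun s => ?_) hq
        rw [hγ]
        have e1 : (s + Finsupp.single (Sum.inl x) 1 : H ⊕ L →₀ ℕ).comapDomain Sum.inl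
            Sum.inl_injective.injOn = s.comapDomain Sum.inl Sum.inl_injective.injOn +
              Finsupp.single x 1 := by
          ext y; simp [Finsupp.single_apply]
        have e2 : (s + Finsupp.single (Sum.inl x) 1 : H ⊕ L →₀ ℕ).comapDomain Sum.inr
            Sum.inr_injective.injOn = s.comapDomain Sum.inr Sum.inr_injective.injOn := by
          ext y; simp
        rw [e1, e2]
      · simp
    · rw [hq, map_sum]
      refine Finset.sum_congr rfl fun x _ => ?_
      split_ifs
      · rw [monoFun_X_mul, zero_add,
          h β _ (fun s => q (s + Finsupp.single x 1)) (fun s => ?_) (fun s w => ?_), zero_add]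
        · rw [hγ]
          have e1 : (s + Finsupp.single (Sum.inr x) 1 : H ⊕ L →₀ ℕ).comapDomain Sum.inl
              Sum.inl_injective.injOn = s.comapDomain Sum.inl Sum.inl_injective.injOn := by
            ext y; simp
          have e2 : (s + Finsupp.single (Sum.inr x) 1 : H ⊕ L →₀ ℕ).comapDomain Sum.inr
              Sum.inr_injective.injOn = s.comapDomain Sum.inr Sum.inr_injective.injOn +
                Finsupp.single x 1 := by
            ext y; simp [Finsupp.single_apply]
          rw [e1, e2]
        · rw [hq]; simp only [add_right_comm]
      · simp

end OpPair

end Polynomials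

/-! ### Symbols of finitely supported families and changes of the origin -/

section Symbols

open MvPolynomial

variable {R : Type*} [CommRing R] [Algebra ℝ R]

section

variable {W : Type*} [Fintype W]

/-- The generating polynomial `∑ α(s) ζ^s / s!` of a finitely supported family. -/
def finSymbol (α : (W →₀ ℕ) → R) : MvPolynomial W R :=
  ∑ᶠ s, monomial s ((expFact s : ℝ)⁻¹ • α s)

theorem coeff_finSymbol {α : (W →₀ ℕ) → R} (hα : α.support.Finite) (s : W →₀ ℕ) :
    coeff s (finSymbol α) = (expFact s : ℝ)⁻¹ • α s := by
  classical
  rw [finSymbol, finsum_eq_sum_of_support_subset (s := hα.toFinset), coeff_sum]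
  · simp only [coeff_monomial, Finset.sum_ite_eq']
    split_ifs with h
    · rfl
    · have : α s = 0 := by simpa using h
      rw [this, smul_zero]
  · intro t ht
    simp only [Set.Finite.coe_toFinset, Function.mem_support] at ht ⊢
    rintro h
    exact ht (by rw [h, smul_zero, map_zero])

theorem expFact_mul_coeff_finSymbol {α : (W →₀ ℕ) → R} (hα : α.support.Finite) (s : W →₀ ℕ) :
    (expFact s : R) * coeff s (finSymbol α) = α s := by
  rw [coeff_finSymbol hα, ← nsmul_eq_mul, ← Nat.cast_smul_eq_nsmul ℝ, smul_smul,
    mul_inv_cancel₀ (Nat.cast_ne_zero.2 (expFact_ne_zero s)), one_smul]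

theorem apolar_finSymbol {α : (W →₀ ℕ) → R} (hα : α.support.Finite) (q : MvPolynomial W R) :
    apolar (finSymbol α) q = monoFun α q := by
  rw [apolar]
  congr 2
  funext s
  exact expFact_mul_coeff_finSymbol hα s

theorem natCast_mul_cancel {n : ℕ} (hn : n ≠ 0) {a b : R} (h : (n : R) * a = n * b) : a = b := by
  have := congrArg (fun x => (n : ℝ)⁻¹ • x) h
  simpa only [← nsmul_eq_mul, ← Nat.cast_smul_eq_nsmul ℝ, smul_smul,
    inv_mul_cancel₀ (Nat.cast_ne_zero.2 hn : (n : ℝ) ≠ 0), one_smul] using this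

/-- The pairing is nondegenerate, since factorials are invertible in a real algebra. -/
theorem apolar_injective {p p' : MvPolynomial W R} (h : ∀ q, apolar p q = apolar p' q) :
    p = p' := by
  ext s
  have := h (monomial s 1)
  rw [apolar_monomial, apolar_monomial, one_mul, one_mul] at this
  exact natCast_mul_cancel (expFact_ne_zero s) this

end

variable {d : ℕ} {V : Type*}

/-- The exponent given by a node decoration. -/
def expo [Fintype V] (m : V → MultiIndex d) : V × Fin d →₀ ℕ :=
  Finsupp.equivFunOnFinite.symm fun x => m x.1 x.2

/-- The node decoration given by an exponent. -/
def deco (s : V × Fin d →₀ ℕ) : V → MultiIndex d := fun v i => s (v, i)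

section

variable [Fintype V]

@[simp] theorem expo_apply (m : V → MultiIndex d) (x : V × Fin d) : expo m x = m x.1 x.2 := rfl

theorem deco_expo (m : V → MultiIndex d) : deco (expo m) = m := rfl

theorem expo_deco (s : V × Fin d →₀ ℕ) : expo (deco s) = s := by ext; rfl

omit [Fintype V] in
theorem deco_add (s t : V × Fin d →₀ ℕ) : deco (s + t) = deco s + deco t := rfl

omit [Fintype V] in
theorem deco_sub (s t : V × Fin d →₀ ℕ) : deco (s - t) = deco s - deco t := by
  funext v i; simp [deco]

omit [Fintype V] in
open Classical in
theorem deco_single (v : V) (i : Fin d) :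
    deco (Finsupp.single (v, i) 1) = Pi.single v (MultiIndex.unit i) := by
  funext w j
  unfold deco MultiIndex.unit
  rcases eq_or_ne v w with rfl | h
  · rcases eq_or_ne i j with rfl | h'
    · simp
    · simp [h'.symm]
  · simp [h.symm]

theorem finite_setOf_le (N : ℕ) : {s : V × Fin d →₀ ℕ | ∀ x, s x ≤ N}.Finite := by
  classical
  refine (Set.finite_Iic (Finsupp.equivFunOnFinite.symm fun _ => N : V × Fin d →₀ ℕ)).subset ?_
  intro s hs x
  exact hs x

/-- The change of variables `x_w ↦ x_w - x_r`. -/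
def recenter (r : V) : MvPolynomial (V × Fin d) R →ₐ[R] MvPolynomial (V × Fin d) R :=
  aeval fun x => X x - X (r, x.2)

open Classical in
/-- The adjoint of `recenter r`. -/
def corecenter (r : V) : MvPolynomial (V × Fin d) R →ₐ[R] MvPolynomial (V × Fin d) R :=
  aeval fun x => X x - if x.1 = r then ∑ u, X (u, x.2) else 0

omit [Algebra ℝ R] in
theorem apolar_recenter (r : V) (p q : MvPolynomial (V × Fin d) R) :
    apolar p (recenter r q) = apolar (corecenter r p) q := by
  classical
  have h := apolar_aeval (fun x y : V × Fin d => (if x = y then (1 : R) else 0) -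
    if (r, x.2) = y then 1 else 0) p q
  convert h using 2
  · congr 1
    unfold recenter
    congr 1
    funext x
    simp [sub_mul, apply_ite C, ite_mul, Finset.sum_sub_distrib]
  · congr 1
    unfold corecenter
    congr 2
    funext x
    simp only [sub_mul, apply_ite C, ite_mul, Finset.sum_sub_distrib, map_sub, map_one, map_zero,
      one_mul, zero_mul, Finset.sum_ite_eq', Finset.mem_univ, if_true]
    congr 1
    rw [Fintype.sum_prod_type]
    obtain ⟨v, i⟩ := x
    by_cases hv : v = r
    · subst hv
      simp
    · have hv' : ¬ r = v := fun h => hv h.symm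
      simp [hv, hv']

omit [Algebra ℝ R] in
/-- The adjoint of recentring is the identity up to multiples of total derivatives. -/
theorem corecenter_sub_self_mem (r : V) (p : MvPolynomial (V × Fin d) R) :
    corecenter r p - p ∈ Ideal.span (Set.range fun i : Fin d => ∑ u, X (u, i)) := by
  classical
  refine aeval_sub_self_mem _ _ (fun x => ?_) p
  rw [sub_sub_cancel_left]
  refine Ideal.neg_mem_iff _ |>.2 ?_
  split_ifs
  · exact Ideal.subset_span ⟨x.2, rfl⟩
  · exact Ideal.zero_mem _

omit [Algebra ℝ R] in
open Classical in
/-- The image of `corecenter r` consists of polynomials that do not involve the variables at `r`. -/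
theorem corecenter_eq_aeval (r : V) (p : MvPolynomial (V × Fin d) R) :
    aeval (fun x => if x ∈ {x : V × Fin d | x.1 = r} then 0 else X x) (corecenter r p) =
      corecenter r p := by
  unfold corecenter
  have : ∀ (f g : MvPolynomial (V × Fin d) R →ₐ[R] MvPolynomial (V × Fin d) R),
    (∀ x, f (g (X x)) = g (X x)) → f (g p) = g p := fun f g h =>
      congrArg (fun k : MvPolynomial (V × Fin d) R →ₐ[R] MvPolynomial (V × Fin d) R => k p)
        (algHom_ext h : f.comp g = g)
  refine this _ _ fun x => ?_
  obtain ⟨v, i⟩ := x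
  have h1 : ∀ u ∈ Finset.univ.erase r, (if (u, i) ∈ {x : V × Fin d | x.1 = r} then
      (0 : MvPolynomial (V × Fin d) R) else X (u, i)) = X (u, i) := fun u hu =>
    if_neg (Finset.mem_erase.1 hu).1
  simp only [aeval_X]
  by_cases hv : v = r
  · subst hv
    simp only [if_true, map_sub, aeval_X, map_sum]
    rw [← Finset.add_sum_erase _ (fun u => (X (u, i) : MvPolynomial (V × Fin d) R))
      (Finset.mem_univ v), ← Finset.add_sum_erase _ _ (Finset.mem_univ v),
      Finset.sum_congr rfl h1]
    simp
  · simp [hv]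

omit [Algebra ℝ R] [Fintype V] in
/-- Recentring at `r` commutes with the derivatives at all points other than `r`. -/
theorem pderiv_recenter (r : V) {x : V × Fin d} (hx : x.1 ≠ r) (q : MvPolynomial (V × Fin d) R) :
    pderiv x (recenter r q) = recenter r (pderiv x q) := by
  classical
  induction q using MvPolynomial.induction_on with
  | C a => simp [recenter, algebraMap_eq]
  | add p q hp hq => simp only [map_add, hp, hq]
  | mul_X p y hp =>
    have h1 : x ≠ (r, y.2) := fun h => hx (by rw [h])
    have h2 : recenter (R := R) r (X y) = X y - X (r, y.2) := aeval_X _ _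
    have h3 : pderiv x (X y - X (r, y.2) : MvPolynomial (V × Fin d) R) =
        (Pi.single x 1 : V × Fin d → MvPolynomial (V × Fin d) R) y := by
      rw [map_sub, pderiv_X, pderiv_X, Pi.single_eq_of_ne h1.symm, sub_zero]
    have h4 : recenter (R := R) r ((Pi.single x 1 : V × Fin d → MvPolynomial (V × Fin d) R) y) =
        (Pi.single x 1 : V × Fin d → MvPolynomial (V × Fin d) R) y := by
      rcases eq_or_ne y x with rfl | h
      · simp
      · simp [Pi.single_eq_of_ne h]
    simp only [map_mul, Derivation.leibniz, smul_eq_mul, map_add, hp, h2, h3, pderiv_X, h4]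

omit [Algebra ℝ R] in
/-- A recentred polynomial is invariant under translations. -/
theorem sum_pderiv_recenter (r : V) (i : Fin d) (q : MvPolynomial (V × Fin d) R) :
    ∑ v, pderiv (v, i) (recenter r q) = 0 := by
  classical
  induction q using MvPolynomial.induction_on with
  | C a => simp [recenter, algebraMap_eq]
  | add p q hp hq => simp only [map_add, Finset.sum_add_distrib, hp, hq, add_zero]
  | mul_X p y hp =>
    have h2 : recenter (R := R) r (X y) = X y - X (r, y.2) := aeval_X _ _
    have h3 : ∑ v, pderiv (v, i) (X y - X (r, y.2) : MvPolynomial (V × Fin d) R) = 0 := by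
      obtain ⟨u, j⟩ := y
      simp only [map_sub, pderiv_X, Finset.sum_sub_distrib]
      rw [Finset.sum_eq_single u, Finset.sum_eq_single r, sub_eq_zero]
      · simp [Pi.single_apply]
      · intro b _ hb; simp [hb.symm]
      · simp
      · intro b _ hb; simp [hb.symm]
      · simp
    simp only [map_mul, Derivation.leibniz, smul_eq_mul, Finset.sum_add_distrib, ← Finset.mul_sum,
      hp, h2, h3, mul_zero, add_zero]

omit [Algebra ℝ R] in
open Classical in
/-- The binomial expansion of a recentred monomial. -/
theorem recenter_monomial (r : V) (n : V → MultiIndex d) :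
    recenter r (monomial (expo n) (1 : R)) =
      ∑ m ∈ Finset.Iic n, C ((-1 : R) ^ (∑ u, (m u).size) *
        (∏ u, (((n u).binom (m u) : ℕ) : R))) *
          monomial (expo (n - m + Pi.single r (∑ u, m u))) 1 := by
  have mono : ∀ m : V → MultiIndex d, (monomial (expo m) (1 : R)) = ∏ v, ∏ i, X (v, i) ^ m v i := by
    intro m
    rw [monomial_eq, Finsupp.prod_fintype _ _ (fun _ => pow_zero _), Fintype.prod_prod_type]
    simp
  have h1 : recenter r (monomial (expo n) (1 : R)) =
      ∏ v, ∏ i, (X (v, i) - X (r, i)) ^ n v i := by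
    rw [mono, map_prod]
    simp [map_prod, recenter]
  have h2 : ∀ v i, ((X (v, i) - X (r, i)) ^ n v i : MvPolynomial (V × Fin d) R) =
      ∑ k ∈ Finset.range (n v i + 1), C ((-1 : R) ^ k * ((n v i).choose k : R)) *
        (X (v, i) ^ (n v i - k) * X (r, i) ^ k) := by
    intro v i
    rw [sub_eq_add_neg, add_comm, add_pow]
    refine Finset.sum_congr rfl fun k _ => ?_
    rw [neg_pow]; simp; ring
  have h3 : Finset.Iic n = Fintype.piFinset fun v => Fintype.piFinset fun i =>
      Finset.range (n v i + 1) := by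
    ext m
    simp only [Finset.mem_Iic, Fintype.mem_piFinset, Finset.mem_range, Nat.lt_succ_iff, Pi.le_def]
  rw [h1, h3]
  simp only [h2, Finset.prod_univ_sum]
  refine Finset.sum_congr rfl fun m _ => ?_
  simp only [Finset.prod_mul_distrib, mono, Pi.add_apply, Pi.sub_apply, pow_add]
  rw [← mul_assoc, mul_assoc]
  congr 1
  · simp only [MultiIndex.size, MultiIndex.binom, map_mul, map_prod, map_pow, Nat.cast_prod,
      Finset.prod_mul_distrib, Finset.prod_pow_eq_pow_sum]
  · congr 1
    rw [Finset.prod_comm, Finset.prod_comm (s := (Finset.univ : Finset V))]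
    refine Finset.prod_congr rfl fun i _ => ?_
    rw [Finset.prod_pow_eq_pow_sum, Finset.prod_eq_single r]
    · simp
    · intro b _ hb
      simp [hb]
    · simp

end

end Symbols

/-! ### Relations between vacuum diagrams as properties of functionals -/

section Relations

open MvPolynomial

variable {d : ℕ} {𝔏 : LabelSystem d} {R : Type*} [CommRing R] [Algebra ℝ R]

/-- The same underlying graph with other labels, distinguished vertex and node decoration. -/
def VacuumDiagram.vary (Γ : VacuumDiagram 𝔏) (lab : Γ.E → 𝔏.Label) (r : Γ.V)
    (n : Γ.V → MultiIndex d) : VacuumDiagram 𝔏 :=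
  { Γ with label := lab, root := r, node := n, connected := Γ.connected }

open Classical in
/-- Replacement of the label `t` of the edge `e` by `t^(δ_i)`. -/
def bump {E : Type} (lab : E → 𝔏.Label) (e : E) (i : Fin d) : E → 𝔏.Label :=
  Function.update lab e (𝔏.shift (MultiIndex.unit i) (lab e))

/-- The functional sending `x^n` to the value of `Γ` with the given labels and distinguished vertex
and with node decoration `n`. -/
def nodeFun (A : THat 𝔏 →ₐ[ℝ] R) (Γ : VacuumDiagram 𝔏) (lab : Γ.E → 𝔏.Label) (r : Γ.V) :
    MvPolynomial (Γ.V × Fin d) R →ₗ[R] R :=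
  monoFun fun s => A (gen (Γ.vary lab r (deco s)))

theorem nodeFun_monomial (A : THat 𝔏 →ₐ[ℝ] R) (Γ : VacuumDiagram 𝔏) (lab : Γ.E → 𝔏.Label)
    (r : Γ.V) (n : Γ.V → MultiIndex d) :
    nodeFun A Γ lab r (monomial (expo n) 1) = A (gen (Γ.vary lab r n)) := by
  rw [nodeFun, monoFun_monomial, one_mul]; rfl

/-- The relation that changes the distinguished vertex is recentring of polynomials. -/
theorem map_moveRelation (A : THat 𝔏 →ₐ[ℝ] R) (Γ : VacuumDiagram 𝔏) (v : Γ.V) :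
    A (moveRelation Γ v) = nodeFun A Γ Γ.label Γ.root (monomial (expo Γ.node) 1) -
      nodeFun A Γ Γ.label v (recenter Γ.root (monomial (expo Γ.node) 1)) := by
  classical
  rw [nodeFun_monomial, recenter_monomial, map_sum, moveRelation, map_sub, map_sum]
  congr 1
  refine Finset.sum_congr rfl fun m _ => ?_
  rw [map_smul, ← smul_eq_C_mul, map_smul, nodeFun_monomial, Algebra.smul_def]
  simp only [map_mul, map_pow, map_neg, map_one, map_prod, map_natCast, smul_eq_mul]
  rfl

open Classical in
/-- The relation at a vertex other than the distinguished one is integration by parts, the last term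
being the partial derivative of the polynomial. -/
theorem map_ibpRelation (A : THat 𝔏 →ₐ[ℝ] R) (Γ : VacuumDiagram 𝔏) (v : Γ.V) (i : Fin d) :
    A (ibpRelation Γ v i) =
      ∑ e, ((if Γ.tgt e = v then nodeFun A Γ (bump Γ.label e i) Γ.root (monomial (expo Γ.node) 1)
          else 0) -
        (if Γ.src e = v then nodeFun A Γ (bump Γ.label e i) Γ.root (monomial (expo Γ.node) 1)
          else 0)) +
      nodeFun A Γ Γ.label Γ.root (pderiv (v, i) (monomial (expo Γ.node) 1)) := by
  rw [ibpRelation, derivAt, lowerNode, map_add, map_sum]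
  congr 1
  · simp only [nodeFun_monomial, map_sub, apply_ite A, map_zero]; rfl
  · rw [pderiv_monomial, map_smul, nodeFun, monoFun_monomial, deco_sub, deco_single, deco_expo,
      one_mul, Algebra.smul_def]
    simp only [map_natCast, expo_apply]
    rfl

/-- The relations, for diagrams with less than `N` edges. All terms of a relation have the same
number of edges, which allows inductions on the number of edges. The relation at the distinguished vertex is omitted
because it follows from the others. -/
structure RespectsBelow (N : ℕ) (A : THat 𝔏 →ₐ[ℝ] R) : Prop where
  iso : ∀ Γ Γ' : VacuumDiagram 𝔏, Nat.card Γ.E < N → Γ.Iso Γ' → A (gen Γ) = A (gen Γ')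
  ibp : ∀ (Γ : VacuumDiagram 𝔏) (v : Γ.V) (i : Fin d), Nat.card Γ.E < N → v ≠ Γ.root →
    A (ibpRelation Γ v i) = 0
  move : ∀ (Γ : VacuumDiagram 𝔏) (v : Γ.V), Nat.card Γ.E < N → A (moveRelation Γ v) = 0

/-- Integration by parts at the distinguished vertex follows from integration by parts at all other
vertices, since the sum of all derivatives vanishes. -/
theorem ibpRootRelation_eq (Γ : VacuumDiagram 𝔏) (i : Fin d) :
    ibpRootRelation Γ i = -∑ v ∈ {v | v ≠ Γ.root}.toFinite.toFinset, ibpRelation Γ v i := by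
  classical
  have h : ∑ v, derivAt Γ v i = 0 := by
    unfold derivAt
    rw [Finset.sum_comm]
    refine Finset.sum_eq_zero fun e _ => ?_
    rw [Finset.sum_sub_distrib]
    simp
  have hs : {v | v ≠ Γ.root}.toFinite.toFinset = Finset.univ.erase Γ.root := by ext; simp
  rw [hs]
  rw [← Finset.add_sum_erase _ _ (Finset.mem_univ Γ.root)] at h
  simp only [ibpRelation, ibpRootRelation, Finset.sum_add_distrib]
  rw [eq_neg_of_add_eq_zero_left h]
  ring

theorem relIdeal_le_ker {A : THat 𝔏 →ₐ[ℝ] R} (hA : ∀ N, RespectsBelow N A) :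
    ∀ x ∈ relIdeal 𝔏, A x = 0 := by
  classical
  intro x hx
  have : relIdeal 𝔏 ≤ RingHom.ker A := by
    rw [relIdeal, Ideal.span_le]
    rintro _ (((⟨Γ, Γ', h, rfl⟩ | ⟨Γ, v, i, hv, rfl⟩) | ⟨Γ, i, rfl⟩) | ⟨Γ, v, rfl⟩)
    · simp [RingHom.mem_ker, (hA _).iso Γ Γ' (Nat.lt_succ_self _) h]
    · exact (hA _).ibp Γ v i (Nat.lt_succ_self _) hv
    · change A _ = 0
      rw [ibpRootRelation_eq, map_neg, map_sum, neg_eq_zero]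
      refine Finset.sum_eq_zero fun v hv => (hA _).ibp Γ v i (Nat.lt_succ_self _) (by simpa using hv)
    · exact (hA _).move Γ v (Nat.lt_succ_self _)
  exact this hx

theorem respectsBelow_of_relIdeal {A : THat 𝔏 →ₐ[ℝ] R} (hA : ∀ x ∈ relIdeal 𝔏, A x = 0) (N : ℕ) :
    RespectsBelow N A where
  iso Γ Γ' _ h := by
    rw [← sub_eq_zero, ← map_sub]
    exact hA _ (Ideal.subset_span (Or.inl (Or.inl (Or.inl ⟨Γ, Γ', h, rfl⟩))))
  ibp Γ v i _ hv := hA _ (Ideal.subset_span (Or.inl (Or.inl (Or.inr ⟨Γ, v, i, hv, rfl⟩))))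
  move Γ v _ := hA _ (Ideal.subset_span (Or.inr ⟨Γ, v, rfl⟩))

/-- Vanishing on diagrams of positive degree. -/
def KillsPositive (A : THat 𝔏 →ₐ[ℝ] R) : Prop :=
  ∀ Γ : VacuumDiagram 𝔏, 0 < Γ.degree → A (gen Γ) = 0

theorem respectsBelow_toHHat (N : ℕ) : RespectsBelow N (toHHat (𝔏 := 𝔏)) :=
  respectsBelow_of_relIdeal (fun _ hx => Ideal.Quotient.eq_zero_iff_mem.2 hx) N

theorem respectsBelow_comp_toHMinus (A : HMinus 𝔏 →ₐ[ℝ] R) (N : ℕ) :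
    RespectsBelow N (A.comp toHMinus) :=
  respectsBelow_of_relIdeal (fun x hx => by
    have : toHMinus x = 0 := Ideal.Quotient.eq_zero_iff_mem.2 (Ideal.mem_sup_left hx)
    rw [AlgHom.comp_apply, this, map_zero]) N

theorem killsPositive_toHMinus : KillsPositive (toHMinus (𝔏 := 𝔏)) := fun Γ h =>
  Ideal.Quotient.eq_zero_iff_mem.2 (Ideal.mem_sup_right (Ideal.subset_span ⟨Γ, h, rfl⟩))

theorem KillsPositive.comp {A : THat 𝔏 →ₐ[ℝ] R} (hA : KillsPositive A) {R' : Type*} [CommRing R']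
    [Algebra ℝ R'] (f : R →ₐ[ℝ] R') : KillsPositive (f.comp A) := fun Γ h => by
  rw [AlgHom.comp_apply, hA Γ h, map_zero]

theorem RespectsBelow.nodeFun_move {N : ℕ} {A : THat 𝔏 →ₐ[ℝ] R} (hA : RespectsBelow N A)
    (Γ : VacuumDiagram 𝔏) (hΓ : Nat.card Γ.E < N) (lab : Γ.E → 𝔏.Label) (r v : Γ.V)
    (q : MvPolynomial (Γ.V × Fin d) R) :
    nodeFun A Γ lab r q = nodeFun A Γ lab v (recenter r q) := by
  have : nodeFun A Γ lab r = (nodeFun A Γ lab v).comp (recenter r).toLinearMap :=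
    linearMap_ext_monomial fun s => by
      have h := (map_moveRelation A (Γ.vary lab r (deco s)) v).symm.trans
        (hA.move (Γ.vary lab r (deco s)) v hΓ)
      rw [← expo_deco s]
      exact sub_eq_zero.1 h
  exact congrArg (fun g : MvPolynomial (Γ.V × Fin d) R →ₗ[R] R => g q) this

open Classical in
theorem RespectsBelow.nodeFun_ibp {N : ℕ} {A : THat 𝔏 →ₐ[ℝ] R} (hA : RespectsBelow N A)
    (Γ : VacuumDiagram 𝔏) (hΓ : Nat.card Γ.E < N) (lab : Γ.E → 𝔏.Label) (r v : Γ.V) (hv : v ≠ r)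
    (i : Fin d) (q : MvPolynomial (Γ.V × Fin d) R) :
    ∑ e, ((if Γ.tgt e = v then nodeFun A Γ (bump lab e i) r q else 0) -
        (if Γ.src e = v then nodeFun A Γ (bump lab e i) r q else 0)) +
      nodeFun A Γ lab r (pderiv (v, i) q) = 0 := by
  have : ∑ e, ((if Γ.tgt e = v then nodeFun A Γ (bump lab e i) r else 0) -
        (if Γ.src e = v then nodeFun A Γ (bump lab e i) r else 0)) +
      (nodeFun A Γ lab r).comp (pderiv (v, i)).toLinearMap = 0 :=
    linearMap_ext_monomial fun s => by
      have h := (map_ibpRelation A (Γ.vary lab r (deco s)) v i).symm.trans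
        (hA.ibp (Γ.vary lab r (deco s)) v i hΓ hv)
      refine Eq.trans ?_ h
      rw [LinearMap.add_apply, LinearMap.sum_apply, ← expo_deco s]
      congr 1
      refine Finset.sum_congr rfl fun e _ => ?_
      rw [LinearMap.sub_apply, apply_ite (fun f : MvPolynomial (Γ.V × Fin d) R →ₗ[R] R =>
        f (monomial (expo (deco s)) 1)), apply_ite (fun f : MvPolynomial (Γ.V × Fin d) R →ₗ[R] R =>
        f (monomial (expo (deco s)) 1))]
      rfl
  have h := congrArg (fun g : MvPolynomial (Γ.V × Fin d) R →ₗ[R] R => g q) this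
  refine Eq.trans ?_ h
  simp only [LinearMap.add_apply, LinearMap.sum_apply, LinearMap.sub_apply]
  congr 1
  refine Finset.sum_congr rfl fun e _ => ?_
  congr 1 <;> split_ifs <;> rfl

/-- The generating polynomial of the values of a diagram with all its node decorations. -/
def symbol (A : THat 𝔏 →ₐ[ℝ] R) (Γ : VacuumDiagram 𝔏) (lab : Γ.E → 𝔏.Label) (r : Γ.V) :
    MvPolynomial (Γ.V × Fin d) R :=
  finSymbol fun s => A (gen (Γ.vary lab r (deco s)))

/-- Node decorations raise the degree, hence only finitely many of them have a nonzero value. -/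
theorem KillsPositive.finite {A : THat 𝔏 →ₐ[ℝ] R} (hA : KillsPositive A) (Γ : VacuumDiagram 𝔏)
    (lab : Γ.E → 𝔏.Label) (r : Γ.V) :
    (fun s : Γ.V × Fin d →₀ ℕ => A (gen (Γ.vary lab r (deco s)))).support.Finite := by
  refine (finite_setOf_le ⌈-(Γ.vary lab r 0).toDecoratedGraph.deg⌉₊).subset fun s hs x => ?_
  have h1 : ¬ 0 < (Γ.vary lab r (deco s)).degree := fun h => hs (hA _ h)
  have h2 : (Γ.vary lab r (deco s)).degree =
      (Γ.vary lab r 0).toDecoratedGraph.deg + ∑ v : Γ.V, ((deco s v).size : ℝ) := rfl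
  have h3 : (s x : ℝ) ≤ ∑ v : Γ.V, ((deco s v).size : ℝ) := by
    have h4 : s x ≤ ∑ v : Γ.V, (deco s v).size :=
      (Finset.single_le_sum (f := fun i => s (x.1, i)) (fun _ _ => Nat.zero_le _)
        (Finset.mem_univ x.2)).trans
        (Finset.single_le_sum (f := fun v : Γ.V => (deco s v).size) (fun _ _ => Nat.zero_le _)
        (Finset.mem_univ x.1))
    exact_mod_cast h4
  have h5 : (s x : ℝ) ≤ ⌈-(Γ.vary lab r 0).toDecoratedGraph.deg⌉₊ :=
    le_trans (by linarith) (Nat.le_ceil _)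
  exact_mod_cast h5

theorem apolar_symbol {A : THat 𝔏 →ₐ[ℝ] R} (hA : KillsPositive A) (Γ : VacuumDiagram 𝔏)
    (lab : Γ.E → 𝔏.Label) (r : Γ.V) (q : MvPolynomial (Γ.V × Fin d) R) :
    apolar (symbol A Γ lab r) q = nodeFun A Γ lab r q :=
  apolar_finSymbol (hA.finite Γ lab r) q

theorem expFact_mul_coeff_symbol {A : THat 𝔏 →ₐ[ℝ] R} (hA : KillsPositive A)
    (Γ : VacuumDiagram 𝔏) (lab : Γ.E → 𝔏.Label) (r : Γ.V) (s : Γ.V × Fin d →₀ ℕ) :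
    (expFact s : R) * coeff s (symbol A Γ lab r) = A (gen (Γ.vary lab r (deco s))) :=
  expFact_mul_coeff_finSymbol (hA.finite Γ lab r) s

/-- The dual form of `nodeFun_move` for generating polynomials. -/
theorem RespectsBelow.symbol_move {N : ℕ} {A : THat 𝔏 →ₐ[ℝ] R} (hA : RespectsBelow N A)
    (hA' : KillsPositive A) (Γ : VacuumDiagram 𝔏) (hΓ : Nat.card Γ.E < N) (lab : Γ.E → 𝔏.Label)
    (r v : Γ.V) : symbol A Γ lab r = corecenter r (symbol A Γ lab v) := by
  refine apolar_injective fun q => ?_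
  rw [apolar_symbol hA', ← apolar_recenter, hA.nodeFun_move Γ hΓ lab r v, apolar_symbol hA']

open Classical in
/-- The dual form of `nodeFun_ibp`: a derivative acting on the adjacent kernels is minus the
multiplication of the generating polynomial by a variable. -/
theorem RespectsBelow.symbol_ibp {N : ℕ} {A : THat 𝔏 →ₐ[ℝ] R} (hA : RespectsBelow N A)
    (hA' : KillsPositive A) (Γ : VacuumDiagram 𝔏) (hΓ : Nat.card Γ.E < N) (lab : Γ.E → 𝔏.Label)
    (r v : Γ.V) (hv : v ≠ r) (i : Fin d) :
    ∑ e, ((if Γ.tgt e = v then symbol A Γ (bump lab e i) r else 0) -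
        (if Γ.src e = v then symbol A Γ (bump lab e i) r else 0)) =
      -(X (v, i) * symbol A Γ lab r) := by
  rw [eq_neg_iff_add_eq_zero]
  refine apolar_injective fun q => ?_
  have h0 : apolar (0 : MvPolynomial (Γ.V × Fin d) R) q = 0 := (apolarₗ q).map_zero
  have hsub : ∀ a b : MvPolynomial (Γ.V × Fin d) R, apolar (a - b) q = apolar a q - apolar b q :=
    fun a b => (apolarₗ q).map_sub a b
  rw [apolar_add, apolar_X_mul_left, apolar_symbol hA', apolar_sum, h0,
    ← hA.nodeFun_ibp Γ hΓ lab r v hv i q]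
  congr 1
  refine Finset.sum_congr rfl fun e _ => ?_
  rw [hsub]
  rw [apply_ite (fun p => apolar p q), apply_ite (fun p => apolar p q), apolar_symbol hA', h0]

end Relations

/-! ### Symbols of subgraphs -/

section Subgraphs

open MvPolynomial

/-- The coefficients of a product of polynomials in disjoint sets of variables are products of
coefficients. -/
theorem coeff_prod_rename {R C W : Type*} [CommRing R] [Fintype C] {U : C → Type*}
    (j : ∀ c, U c → W)
    (hj : Function.Bijective fun x : Σ c, U c => j x.1 x.2)
    (hinj : ∀ c, Function.Injective (j c)) (p : ∀ c, MvPolynomial (U c) R) (s : W →₀ ℕ) :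
    coeff s (∏ c, rename (j c) (p c)) =
      ∏ c, coeff (s.comapDomain (j c) (hinj c).injOn) (p c) := by
  classical
  have h1 : ∀ c, rename (j c) (p c) =
      ∑ m ∈ (p c).support, monomial (m.mapDomain (j c)) (coeff m (p c)) := by
    intro c
    conv_lhs => rw [(p c).as_sum, map_sum]
    simp only [rename_monomial]
  have h2 : ∀ f : (∀ c, U c →₀ ℕ),
      ∏ c, monomial ((f c).mapDomain (j c)) (coeff (f c) (p c)) =
        (monomial (∑ c, (f c).mapDomain (j c)) (∏ c, coeff (f c) (p c)) : MvPolynomial W R) := by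
    intro f
    rw [monomial_sum_index]
    simp only [C_apply, map_prod]
    rw [← Finset.prod_mul_distrib]
    simp [← C_apply, C_mul_monomial]
  have h3 : ∀ f : (∀ c, U c →₀ ℕ), (∑ c, (f c).mapDomain (j c) = s) ↔
      f = fun c => s.comapDomain (j c) (hinj c).injOn := by
    intro f
    have key : ∀ c u, (∑ c', (f c').mapDomain (j c')) (j c u) = f c u := by
      intro c u
      rw [Finsupp.finsetSum_apply, Finset.sum_eq_single c]
      · exact Finsupp.mapDomain_apply (hinj c) _ _
      · intro c' _ hc'
        refine Finsupp.mapDomain_of_notMem_range _ _ ?_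
        rintro ⟨u', hu'⟩
        exact hc' (congrArg Sigma.fst (@hj.1 ⟨c', u'⟩ ⟨c, u⟩ hu'))
      · simp
    constructor
    · rintro h
      funext c
      ext u
      rw [← key c u, h]; rfl
    · rintro h
      ext w
      obtain ⟨⟨c, u⟩, rfl⟩ := hj.2 w
      rw [key c u, h]; rfl
  simp only [h1, Finset.prod_univ_sum, h2, coeff_sum, coeff_monomial, h3]
  rw [Finset.sum_ite_eq']
  split_ifs with h
  · rfl
  · simp only [Fintype.mem_piFinset, not_forall, mem_support_iff, not_not] at h
    obtain ⟨c, hc⟩ := h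
    exact (Finset.prod_eq_zero (Finset.mem_univ c) hc).symm

theorem expFact_eq_prod {C W : Type*} [Fintype C] [Fintype W] {U : C → Type*} [∀ c, Fintype (U c)]
    (j : ∀ c, U c → W) (hj : Function.Bijective fun x : Σ c, U c => j x.1 x.2)
    (hinj : ∀ c, Function.Injective (j c)) (s : W →₀ ℕ) :
    expFact s = ∏ c, expFact (s.comapDomain (j c) (hinj c).injOn) := by
  classical
  rw [expFact, ← (Equiv.ofBijective _ hj).prod_comp, Fintype.prod_sigma]
  rfl

variable {d : ℕ} {𝔏 : LabelSystem d} {R : Type*} [CommRing R] [Algebra ℝ R]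

theorem bump_self {E : Type} (lab : E → 𝔏.Label) (e : E) (i : Fin d) :
    bump lab e i e = 𝔏.shift (MultiIndex.unit i) (lab e) := by
  classical exact Function.update_self _ _ _

theorem bump_of_ne {E : Type} (lab : E → 𝔏.Label) {e e' : E} (h : e' ≠ e) (i : Fin d) :
    bump lab e i e' = lab e' := by
  classical exact Function.update_of_ne h _ _

namespace DecoratedGraph

instance fintypeClasses (G : DecoratedGraph 𝔏) (F : Finset G.E) : Fintype (G.Classes F) :=
  Fintype.ofFinite _

variable (G : DecoratedGraph 𝔏) (F : Finset G.E)

/-- The vertices of a component. -/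
abbrev CompV (c : G.Classes F) : Type := {v : G.V // G.cls F v = c}

/-- The edges of a component. -/
abbrev CompE (c : G.Classes F) : Type := {e : G.E // e ∈ F ∧ G.cls F (G.src e) = c}

instance fintypeCompV (c : G.Classes F) : Fintype (G.CompV F c) := Fintype.ofFinite _

instance fintypeCompE (c : G.Classes F) : Fintype (G.CompE F c) := Fintype.ofFinite _

/-- The component on a class as a vacuum diagram. -/
@[reducible] def compDiagram (c : G.Classes F) (h : Nonempty (G.CompE F c)) : VacuumDiagram 𝔏 where
  V := G.CompV F c
  E := G.CompE F c
  src e := ⟨G.src e, e.2.2⟩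
  tgt e := ⟨G.tgt e, (G.cls_tgt e.2.1).trans e.2.2⟩
  label e := G.label e
  root := ⟨c.out, Quotient.out_eq c⟩
  node := 0
  connected := G.connected_component F c
  nonempty_edge := h

open Classical in
/-- The symbol of the component on a class; it is `1` if the component has no edges. -/
def compSymbol (A : THat 𝔏 →ₐ[ℝ] R) (lab : G.E → 𝔏.Label) (c : G.Classes F)
    (r : G.CompV F c) : MvPolynomial (G.CompV F c × Fin d) R :=
  if h : Nonempty (G.CompE F c) then symbol A (G.compDiagram F c h) (fun e => lab e.1) r else 1

theorem compSymbol_of_nonempty (A : THat 𝔏 →ₐ[ℝ] R) (lab : G.E → 𝔏.Label) (c : G.Classes F)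
    (r : G.CompV F c) (h : Nonempty (G.CompE F c)) :
    G.compSymbol F A lab c r = symbol A (G.compDiagram F c h) (fun e => lab e.1) r := dif_pos h

theorem compSymbol_of_not_nonempty (A : THat 𝔏 →ₐ[ℝ] R) (lab : G.E → 𝔏.Label) (c : G.Classes F)
    (r : G.CompV F c) (h : ¬ Nonempty (G.CompE F c)) :
    G.compSymbol F A lab c r = 1 := dif_neg h

/-- The inclusion of the variables of a component into those of the graph. -/
def compVar (c : G.Classes F) : G.CompV F c × Fin d → G.V × Fin d :=
  Prod.map Subtype.val id

theorem compVar_injective (c : G.Classes F) : Function.Injective (G.compVar F c) :=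
  Subtype.val_injective.prodMap Function.injective_id

theorem compVar_bijective :
    Function.Bijective fun x : Σ c, G.CompV F c × Fin d => G.compVar F x.1 x.2 := by
  constructor
  · rintro ⟨c, ⟨v, hv⟩, i⟩ ⟨c', ⟨v', hv'⟩, i'⟩ h
    obtain ⟨rfl, rfl⟩ := Prod.mk.inj h
    obtain rfl : c = c' := hv.symm.trans hv'
    rfl
  · rintro ⟨v, i⟩
    exact ⟨⟨G.cls F v, ⟨v, rfl⟩, i⟩, rfl⟩

/-- The generating polynomial of the values of a subgraph with all its node decorations, namely the
product of the symbols of its components. -/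
def extractSymbol (A : THat 𝔏 →ₐ[ℝ] R) (lab : G.E → 𝔏.Label) (r : G.Classes F → G.V)
    (hr : ∀ c, G.cls F (r c) = c) : MvPolynomial (G.V × Fin d) R :=
  ∏ c, rename (G.compVar F c) (G.compSymbol F A lab c ⟨r c, hr c⟩)

variable {F} in
/-- A class with more than one vertex consists of vertices of the subgraph. -/
theorem mem_verts_of_cls_eq {u v : G.V} (h : G.cls F u = G.cls F v) (huv : u ≠ v) :
    u ∈ G.verts F := by
  have key : ∀ u v : G.V, Relation.EqvGen (fun a b => ∃ e ∈ F, G.src e = a ∧ G.tgt e = b) u v →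
      u = v ∨ (u ∈ G.verts F ∧ v ∈ G.verts F) := by
    intro u v h
    induction h with
    | rel a b h =>
      obtain ⟨e, he, rfl, rfl⟩ := h
      exact Or.inr ⟨⟨e, he, Or.inl rfl⟩, ⟨e, he, Or.inr rfl⟩⟩
    | refl a => exact Or.inl rfl
    | symm a b _ ih => exact ih.imp Eq.symm And.symm
    | trans a b c _ _ h1 h2 =>
      rcases h1 with rfl | h1
      · exact h2
      · rcases h2 with rfl | h2
        · exact Or.inr h1
        · exact Or.inr ⟨h1.1, h2.2⟩
  exact ((key u v (Quotient.exact (s := G.subSetoid F) h)).resolve_left huv).1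

variable {F} in
theorem nonempty_component_iff (v : G.V) :
    Nonempty (G.CompE F (G.cls F v)) ↔ v ∈ G.verts F := by
  constructor
  · rintro ⟨e, he, hv⟩
    by_cases h : v = G.src e
    · exact ⟨e, he, Or.inl h.symm⟩
    · exact G.mem_verts_of_cls_eq hv.symm h
  · rintro ⟨e, he, rfl | rfl⟩
    · exact ⟨⟨e, he, rfl⟩⟩
    · exact ⟨⟨e, he, (G.cls_tgt he).symm⟩⟩

theorem map_extract (A : THat 𝔏 →ₐ[ℝ] R) (r : G.Classes F → G.V) (hr : ∀ c, G.cls F (r c) = c)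
    (n : G.V → MultiIndex d) : A (G.extract F r hr n) =
      ∏ c, open Classical in if h : Nonempty (G.CompE F c) then
        A (gen ((G.compDiagram F c h).vary (fun e => G.label e.1) ⟨r c, hr c⟩ fun v => n v.1))
        else 1 := by
  unfold extract
  rw [map_prod]
  refine Finset.prod_congr rfl fun c _ => ?_
  rw [apply_dite A, map_one]
  rfl

open Classical in
/-- The coefficients of the symbol are the values of the subgraph. Vertices outside of the subgraph are
classes without edges, so no decoration can sit there. -/
theorem expFact_mul_coeff_extractSymbol {A : THat 𝔏 →ₐ[ℝ] R} (hA : KillsPositive A)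
    (r : G.Classes F → G.V) (hr : ∀ c, G.cls F (r c) = c) (s : G.V × Fin d →₀ ℕ) :
    (expFact s : R) * coeff s (G.extractSymbol F A G.label r hr) =
      if ∀ v, v ∉ G.verts F → deco s v = 0 then A (G.extract F r hr (deco s)) else 0 := by
  rw [extractSymbol, coeff_prod_rename (G.compVar F) (G.compVar_bijective F) (G.compVar_injective F),
    expFact_eq_prod (G.compVar F) (G.compVar_bijective F) (G.compVar_injective F), Nat.cast_prod,
    ← Finset.prod_mul_distrib]
  split_ifs with hs
  · rw [map_extract]
    refine Finset.prod_congr rfl fun c _ => ?_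
    split_ifs with h
    · rw [compSymbol_of_nonempty _ _ _ _ _ _ h]
      exact expFact_mul_coeff_symbol hA (G.compDiagram F c h) (fun e => G.label e.1) ⟨r c, hr c⟩
        (s.comapDomain (G.compVar F c) (G.compVar_injective F c).injOn)
    · have : s.comapDomain (G.compVar F c) (G.compVar_injective F c).injOn = 0 := by
        ext ⟨⟨v, rfl⟩, i⟩
        exact congrFun (hs v fun hv => h ((G.nonempty_component_iff v).2 hv)) i
      rw [this, compSymbol_of_not_nonempty _ _ _ _ _ _ h]
      simp [expFact]
  · push Not at hs
    obtain ⟨v, hv, hsv⟩ := hs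
    refine Finset.prod_eq_zero (Finset.mem_univ (G.cls F v)) ?_
    have h : ¬ Nonempty (G.CompE F (G.cls F v)) := fun h =>
      hv ((G.nonempty_component_iff v).1 h)
    rw [compSymbol_of_not_nonempty _ _ _ _ _ _ h, coeff_one, if_neg, mul_zero]
    intro h0
    refine hsv (funext fun i => ?_)
    exact (DFunLike.congr_fun h0 (⟨v, rfl⟩, i)).symm

theorem card_component_le (c : G.Classes F) : Nat.card (G.CompE F c) ≤ F.card := by
  have := Nat.card_le_card_of_injective
    (fun e : (G.CompE F c) => (⟨e.1, e.2.1⟩ : {e // e ∈ F}))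
    fun e e' h => Subtype.ext (congrArg (fun x : {e // e ∈ F} => x.1) h)
  rwa [Nat.card_eq_fintype_card (α := {e // e ∈ F}), Fintype.card_coe] at this

open Classical in
/-- The sum of the variables at the vertices of a class. -/
def classSum (c : G.Classes F) (i : Fin d) : MvPolynomial (G.V × Fin d) R :=
  ∑ v, if G.cls F v = c then X (v, i) else 0

omit [Algebra ℝ R] in
theorem rename_sum_compVar (c : G.Classes F) (i : Fin d) :
    rename (G.compVar F c) (∑ u, X (u, i)) = (G.classSum F c i : MvPolynomial (G.V × Fin d) R) := by
  classical
  rw [map_sum, classSum, ← Finset.sum_filter]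
  simp only [rename_X]
  exact (Finset.sum_subtype _ (by simp) fun v => (X (v, i) : MvPolynomial (G.V × Fin d) R)).symm

/-- Symbols with different choices of the distinguished vertices are congruent. -/
theorem extractSymbol_sub_mem {N : ℕ} {A : THat 𝔏 →ₐ[ℝ] R} (hA : RespectsBelow N A)
    (hA' : KillsPositive A) (hF : F.card < N) (lab : G.E → 𝔏.Label) (r r' : G.Classes F → G.V)
    (hr : ∀ c, G.cls F (r c) = c) (hr' : ∀ c, G.cls F (r' c) = c) :
    G.extractSymbol F A lab r hr - G.extractSymbol F A lab r' hr' ∈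
      Ideal.span {x | ∃ c i, r c ≠ r' c ∧ x = G.classSum F c i} := by
  refine prod_sub_prod_mem _ _ _ _ fun c _ => ?_
  by_cases hc : r c = r' c
  · have : (⟨r c, hr c⟩ : G.CompV F c) = ⟨r' c, hr' c⟩ := Subtype.ext hc
    rw [this, sub_self]
    exact Ideal.zero_mem _
  by_cases h : Nonempty (G.CompE F c)
  · rw [compSymbol_of_nonempty _ _ _ _ _ _ h, compSymbol_of_nonempty _ _ _ _ _ _ h, ← map_sub,
      hA.symbol_move hA' (G.compDiagram F c h) ((G.card_component_le F c).trans_lt hF)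
        (fun e => lab e.1) ⟨r c, hr c⟩ ⟨r' c, hr' c⟩]
    have h1 := corecenter_sub_self_mem (V := G.CompV F c) (⟨r c, hr c⟩)
      (symbol A (G.compDiagram F c h) (fun e => lab e.1) ⟨r' c, hr' c⟩)
    have h2 : Ideal.span (Set.range fun i : Fin d =>
        (∑ u, X (u, i) : MvPolynomial (G.CompV F c × Fin d) R)) ≤
        (Ideal.span {x | ∃ c i, r c ≠ r' c ∧ x = G.classSum F c i}).comap
          (rename (G.compVar F c) : _ →ₐ[R] MvPolynomial (G.V × Fin d) R) := by
      rw [Ideal.span_le]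
      rintro _ ⟨i, rfl⟩
      exact Ideal.subset_span ⟨c, i, hc, G.rename_sum_compVar F c i⟩
    exact h2 h1
  · rw [compSymbol_of_not_nonempty _ _ _ _ _ _ h, compSymbol_of_not_nonempty _ _ _ _ _ _ h,
      sub_self]
    exact Ideal.zero_mem _

open Classical in
/-- If `u` is the distinguished vertex of its component, then the symbol does not depend on the
variables at `u`. -/
theorem extractSymbol_eq_aeval {N : ℕ} {A : THat 𝔏 →ₐ[ℝ] R} (hA : RespectsBelow N A)
    (hA' : KillsPositive A) (hF : F.card < N) (lab : G.E → 𝔏.Label) (r : G.Classes F → G.V)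
    (hr : ∀ c, G.cls F (r c) = c) (u : G.V) (hu : r (G.cls F u) = u) :
    aeval (fun x => if x ∈ {x : G.V × Fin d | x.1 = u} then 0 else X x)
      (G.extractSymbol F A lab r hr) = G.extractSymbol F A lab r hr := by
  rw [extractSymbol, map_prod]
  refine Finset.prod_congr rfl fun c _ => ?_
  by_cases h : Nonempty (G.CompE F c)
  · have key : ∀ (f : MvPolynomial (G.CompV F c × Fin d) R →ₐ[R] _)
        (hf : ∀ x, rename (G.compVar F c) (f (X x)) =
          if (G.compVar F c x).1 = u then 0 else X (G.compVar F c x)) (p : _),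
        aeval (fun x => if x ∈ {x : G.V × Fin d | x.1 = u} then (0 : MvPolynomial _ R) else X x)
          (rename (G.compVar F c) p) = rename (G.compVar F c) (f p) := fun f hf p =>
      congrArg (fun k : MvPolynomial (G.CompV F c × Fin d) R →ₐ[R]
        MvPolynomial (G.V × Fin d) R => k p)
        (algHom_ext (fun x => by
          simp only [AlgHom.comp_apply, rename_X, aeval_X, hf]; rfl) :
          (aeval (fun x => if x ∈ {x : G.V × Fin d | x.1 = u} then
            (0 : MvPolynomial _ R) else X x)).comp (rename (G.compVar F c)) =
            (rename (G.compVar F c)).comp f)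
    by_cases hc : c = G.cls F u
    · subst hc
      rw [compSymbol_of_nonempty _ _ _ _ _ _ h,
        hA.symbol_move hA' (G.compDiagram F _ h) ((G.card_component_le F _).trans_lt hF)
        (fun e => lab e.1) ⟨r _, hr _⟩ ⟨r _, hr _⟩]
      have h1 := corecenter_eq_aeval (V := G.CompV F (G.cls F u)) ⟨r _, hr _⟩
        (symbol A (G.compDiagram F _ h) (fun e => lab e.1) ⟨r _, hr _⟩)
      refine (key _ (fun x => ?_) _).trans (congrArg _ h1)
      have hx : x ∈ {x : G.CompV F (G.cls F u) × Fin d | x.1 = ⟨r (G.cls F u), hr _⟩} ↔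
          (G.compVar F _ x).1 = u := by
        rw [Set.mem_ofPred_eq, Subtype.ext_iff, compVar, Prod.map_fst]
        simp only [hu]
      rw [aeval_X]
      by_cases h2 : (G.compVar F _ x).1 = u
      · rw [if_pos h2, if_pos (hx.2 h2), map_zero]
      · rw [if_neg h2, if_neg (fun h3 => h2 (hx.1 h3)), rename_X]
    · refine (key (AlgHom.id R _) (fun x => ?_) _)
      rw [AlgHom.id_apply, rename_X, if_neg]
      intro hx
      exact hc (x.1.2.symm.trans (congrArg _ hx))
  · rw [compSymbol_of_not_nonempty _ _ _ _ _ _ h, map_one, map_one]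

theorem extractSymbol_bump_of_notMem (A : THat 𝔏 →ₐ[ℝ] R) (lab : G.E → 𝔏.Label)
    (r : G.Classes F → G.V) (hr : ∀ c, G.cls F (r c) = c) {e : G.E} (he : e ∉ F) (i : Fin d) :
    G.extractSymbol F A (bump lab e i) r hr = G.extractSymbol F A lab r hr := by
  have h1 : ∀ c, (fun e' : (G.CompE F c) => bump lab e i e'.1) = fun e' => lab e'.1 :=
    fun c => funext fun e' => bump_of_ne lab (fun h : e'.1 = e => he (by rw [← h]; exact e'.2.1)) i
  unfold extractSymbol compSymbol
  simp only [h1]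

open Classical in
/-- Replacing the label of an edge only affects the component containing the edge. -/
theorem extractSymbol_bump_of_mem (A : THat 𝔏 →ₐ[ℝ] R) (lab : G.E → 𝔏.Label)
    (r : G.Classes F → G.V) (hr : ∀ c, G.cls F (r c) = c) (c : G.Classes F)
    (h : Nonempty (G.CompE F c)) (e : (G.CompE F c)) (i : Fin d) :
    G.extractSymbol F A (bump lab e.1 i) r hr =
      rename (G.compVar F c)
        (symbol A (G.compDiagram F c h) (bump (fun e => lab e.1) e i) ⟨r c, hr c⟩) *
        ∏ c' ∈ Finset.univ.erase c,
          rename (G.compVar F c') (G.compSymbol F A lab c' ⟨r c', hr c'⟩) := by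
  rw [extractSymbol, ← Finset.mul_prod_erase _ _ (Finset.mem_univ c)]
  congr 1
  · rw [compSymbol_of_nonempty _ _ _ _ _ _ h]
    congr 2
    funext e'
    rcases eq_or_ne e' e with rfl | hne
    · rw [bump_self, bump_self]
    · rw [bump_of_ne _ hne, bump_of_ne _ fun h => hne (Subtype.ext h)]
  · refine Finset.prod_congr rfl fun c' hc' => ?_
    have h1 : (fun e' : G.CompE F c' => bump lab e.1 i e'.1) = fun e' => lab e'.1 :=
      funext fun e' => bump_of_ne _ (fun h => (Finset.mem_erase.1 hc').1 (by
        rw [← e'.2.2, ← e.2.2, h])) i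
    unfold compSymbol
    simp only [h1]

open Classical in
/-- Integration by parts in a subgraph at a vertex that is not the distinguished one of its component. -/
theorem sum_extractSymbol_bump_of_ne {N : ℕ} {A : THat 𝔏 →ₐ[ℝ] R} (hA : RespectsBelow N A)
    (hA' : KillsPositive A) (hF : F.card < N) (lab : G.E → 𝔏.Label) (r : G.Classes F → G.V)
    (hr : ∀ c, G.cls F (r c) = c) (v : G.V) (i : Fin d) (hv : v ≠ r (G.cls F v)) :
    ∑ e ∈ F, ((if G.tgt e = v then G.extractSymbol F A (bump lab e i) r hr else 0) -
        (if G.src e = v then G.extractSymbol F A (bump lab e i) r hr else 0)) =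
      -(X (v, i) * G.extractSymbol F A lab r hr) := by
  have h : Nonempty (G.CompE F (G.cls F v)) :=
    (G.nonempty_component_iff v).2 (G.mem_verts_of_cls_eq (hr _).symm hv)
  have h1 := hA.symbol_ibp hA' (G.compDiagram F _ h) ((G.card_component_le F _).trans_lt hF)
    (fun e => lab e.1) ⟨r (G.cls F v), hr _⟩ ⟨v, rfl⟩ (fun h => hv (congrArg Subtype.val h)) i
  have h2 := congrArg (fun p => rename (G.compVar F (G.cls F v)) p *
    ∏ c' ∈ Finset.univ.erase (G.cls F v),
      rename (G.compVar F c') (G.compSymbol F A lab c' ⟨r c', hr c'⟩)) h1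
  simp only [map_sum, map_sub, map_neg, map_mul, apply_ite (rename _), map_zero, Finset.sum_mul,
    sub_mul, ite_mul, zero_mul, neg_mul, rename_X] at h2
  have h3 : ∑ e ∈ F, ((if G.tgt e = v then G.extractSymbol F A (bump lab e i) r hr else 0) -
        (if G.src e = v then G.extractSymbol F A (bump lab e i) r hr else 0)) =
      ∑ e : (G.CompE F (G.cls F v)),
        ((if G.tgt e.1 = v then G.extractSymbol F A (bump lab e.1 i) r hr else 0) -
        (if G.src e.1 = v then G.extractSymbol F A (bump lab e.1 i) r hr else 0)) := by
    rw [← Finset.sum_subtype (F.filter fun e => G.cls F (G.src e) = G.cls F v) (by simp)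
      fun e => ((if G.tgt e = v then G.extractSymbol F A (bump lab e i) r hr else 0) -
        (if G.src e = v then G.extractSymbol F A (bump lab e i) r hr else 0)),
      Finset.sum_filter_of_ne]
    intro e he hne
    by_contra hcls
    refine hne ?_
    rw [if_neg, if_neg, sub_zero]
    · rintro rfl; exact hcls rfl
    · rintro rfl; exact hcls (G.cls_tgt he).symm
  rw [h3, extractSymbol, ← Finset.mul_prod_erase _ _ (Finset.mem_univ (G.cls F v)),
    compSymbol_of_nonempty _ _ _ _ _ _ h, ← mul_assoc]
  refine Eq.trans (Finset.sum_congr rfl fun e _ => ?_) h2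
  rw [G.extractSymbol_bump_of_mem F A lab r hr _ h]
  congr 1
  · exact if_congr (Subtype.ext_iff (a1 := (G.compDiagram F (G.cls F v) h).tgt e)
      (a2 := ⟨v, rfl⟩)).symm rfl rfl
  · exact if_congr (Subtype.ext_iff (a1 := (G.compDiagram F (G.cls F v) h).src e)
      (a2 := ⟨v, rfl⟩)).symm rfl rfl

open Classical in
/-- Integration by parts in a subgraph. -/
theorem sum_extractSymbol_bump {N : ℕ} {A : THat 𝔏 →ₐ[ℝ] R} (hA : RespectsBelow N A)
    (hA' : KillsPositive A) (hF : F.card < N) (lab : G.E → 𝔏.Label) (r : G.Classes F → G.V)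
    (hr : ∀ c, G.cls F (r c) = c) (v : G.V) (i : Fin d) :
    ∑ e ∈ F, ((if G.tgt e = v then G.extractSymbol F A (bump lab e i) r hr else 0) -
        (if G.src e = v then G.extractSymbol F A (bump lab e i) r hr else 0)) +
      X (v, i) * G.extractSymbol F A lab r hr =
      if v = r (G.cls F v) then G.classSum F (G.cls F v) i * G.extractSymbol F A lab r hr else 0 := by
  split_ifs with hv
  · set S : G.V → MvPolynomial (G.V × Fin d) R := fun w =>
      ∑ e ∈ F, ((if G.tgt e = w then G.extractSymbol F A (bump lab e i) r hr else 0) -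
        (if G.src e = w then G.extractSymbol F A (bump lab e i) r hr else 0)) with hS
    -- every edge of the subgraph contributes twice to its component, with opposite signs
    have h0 : ∑ w ∈ Finset.univ.filter fun w => G.cls F w = G.cls F v, S w = 0 := by
      rw [hS, Finset.sum_comm]
      refine Finset.sum_eq_zero fun e he => ?_
      rw [Finset.sum_sub_distrib, Finset.sum_ite_eq, Finset.sum_ite_eq]
      simp only [Finset.mem_filter, Finset.mem_univ, true_and, G.cls_tgt he, sub_self]
    have hmem : v ∈ Finset.univ.filter fun w => G.cls F w = G.cls F v := by simp
    rw [← Finset.add_sum_erase _ _ hmem] at h0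
    change S v + _ = _
    rw [eq_neg_of_add_eq_zero_left h0, classSum, ← Finset.sum_filter,
      ← Finset.add_sum_erase _ _ hmem, add_mul, add_comm, Finset.sum_mul, ← Finset.sum_neg_distrib]
    congr 1
    refine Finset.sum_congr rfl fun w hw => ?_
    simp only [Finset.mem_erase, Finset.mem_filter, Finset.mem_univ, true_and] at hw
    rw [hS]
    simp only
    rw [G.sum_extractSymbol_bump_of_ne F hA hA' hF lab r hr w i (by rw [hw.2, ← hv]; exact hw.1),
      neg_neg]
  · rw [G.sum_extractSymbol_bump_of_ne F hA hA' hF lab r hr v i hv, neg_add_cancel]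

end DecoratedGraph

end Subgraphs

/-! ### Contractions -/

section Contractions

open MvPolynomial

variable {d : ℕ} {𝔏 : LabelSystem d} {R : Type*} [CommRing R] [Algebra ℝ R]

namespace VacuumDiagram

variable (Γ : VacuumDiagram 𝔏) (F : Finset Γ.E)

/-- The edges that remain after contraction. -/
abbrev QuotE : Type := {e : Γ.E // e ∉ F}

instance fintypeQuotE : Fintype (Γ.QuotE F) := Fintype.ofFinite _

/-- The vacuum diagram obtained by contracting the components of `F`, with unchanged labels and
without node decoration. -/
@[reducible] def quotDiagram (h : Nonempty (Γ.QuotE F)) : VacuumDiagram 𝔏 where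
  V := Γ.toDecoratedGraph.Classes F
  E := Γ.QuotE F
  src e := Γ.toDecoratedGraph.cls F (Γ.src e)
  tgt e := Γ.toDecoratedGraph.cls F (Γ.tgt e)
  label e := Γ.label e
  root := Γ.toDecoratedGraph.cls F Γ.root
  node := 0
  connected := Γ.toDecoratedGraph.connected_contract Γ.connected F 0
  nonempty_edge := h

/-- The labels after contraction. -/
def quotLabel (lab : Γ.E → 𝔏.Label) (l : Γ.toDecoratedGraph.HalfEdge × Fin d →₀ ℕ)
    (e : Γ.QuotE F) : 𝔏.Label :=
  𝔏.shift (deco l (e.1, false) + deco l (e.1, true)) (lab e.1)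

/-- The projection of the variables of a diagram to those of its contraction. -/
def quotVar : Γ.V × Fin d → Γ.toDecoratedGraph.Classes F × Fin d :=
  Prod.map (Γ.toDecoratedGraph.cls F) id

open Classical in
/-- The functional sending `x^n` to the value of the contraction of `F`, where `n` is the node
decoration before contraction. -/
def quotFun (B : THat 𝔏 →ₐ[ℝ] R) (lab : Γ.E → 𝔏.Label) (r : Γ.V)
    (l : Γ.toDecoratedGraph.HalfEdge × Fin d →₀ ℕ) : MvPolynomial (Γ.V × Fin d) R →ₗ[R] R :=
  if h : Nonempty (Γ.QuotE F) then
    (nodeFun B (Γ.quotDiagram F h) (Γ.quotLabel F lab l) (Γ.toDecoratedGraph.cls F r)).comp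
      (rename (Γ.quotVar F)).toLinearMap
  else monoFun fun s => if s = 0 then 1 else 0

theorem quotFun_of_nonempty (B : THat 𝔏 →ₐ[ℝ] R) (lab : Γ.E → 𝔏.Label) (r : Γ.V)
    (l : Γ.toDecoratedGraph.HalfEdge × Fin d →₀ ℕ) (h : Nonempty (Γ.QuotE F))
    (q : MvPolynomial (Γ.V × Fin d) R) : Γ.quotFun F B lab r l q =
    nodeFun B (Γ.quotDiagram F h) (Γ.quotLabel F lab l) (Γ.toDecoratedGraph.cls F r)
      (rename (Γ.quotVar F) q) := by
  rw [quotFun, dif_pos h]; rfl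

open Classical in
theorem quotFun_of_not_nonempty (B : THat 𝔏 →ₐ[ℝ] R) (lab : Γ.E → 𝔏.Label) (r : Γ.V)
    (l : Γ.toDecoratedGraph.HalfEdge × Fin d →₀ ℕ) (h : ¬ Nonempty (Γ.QuotE F))
    (q : MvPolynomial (Γ.V × Fin d) R) : Γ.quotFun F B lab r l q = coeff 0 q := by
  rw [quotFun, dif_neg h, monoFun_eq_sum]
  simp only [mul_ite, mul_one, mul_zero, Finset.sum_ite_eq', mem_support_iff]
  split_ifs with h
  · rfl
  · exact (not_not.1 h).symm

/-- If no edge is left, then the contraction is a single node. It is identified with `1` or `0`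
according to its decoration, which is the constant coefficient in `quotFun_of_not_nonempty`. -/
theorem map_quotientBy (B : THat 𝔏 →ₐ[ℝ] R) (l : Γ.toDecoratedGraph.HalfEdge × Fin d →₀ ℕ)
    (n : Γ.V → MultiIndex d) : B (Γ.quotientBy F (deco l) n) =
      Γ.quotFun F B Γ.label Γ.root l (monomial (expo n) 1) := by
  classical
  by_cases h : Nonempty (Γ.QuotE F)
  · rw [quotFun_of_nonempty _ _ _ _ _ _ h, quotientBy, dif_pos (show
      Nonempty (Γ.toDecoratedGraph.contract F (deco l)).E from h), rename_monomial, nodeFun,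
      monoFun_monomial, one_mul]
    have hn : deco ((expo n).mapDomain (Γ.quotVar F)) =
        fun c => ∑ v, if Γ.toDecoratedGraph.cls F v = c then n v else 0 := by
      funext c i
      simp only [deco, Finsupp.mapDomain, Finsupp.sum_apply, Finsupp.single_apply, quotVar]
      rw [Finsupp.sum_fintype _ _ (by simp), Fintype.sum_prod_type, Finset.sum_apply]
      refine Finset.sum_congr rfl fun v _ => ?_
      by_cases hv : Γ.toDecoratedGraph.cls F v = c
      · simp [hv]
      · simp [hv]
    refine Eq.trans ?_ (congrArg (fun n => B (gen ((Γ.quotDiagram F h).vary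
      (Γ.quotLabel F Γ.label l) (Γ.toDecoratedGraph.cls F Γ.root) n))) hn.symm)
    refine congrArg (fun n => B (gen ((Γ.quotDiagram F h).vary
      (Γ.quotLabel F Γ.label l) (Γ.toDecoratedGraph.cls F Γ.root) n))) ?_
    funext c
    refine Finset.sum_congr rfl fun v _ => ?_
    congr
  · rw [quotFun_of_not_nonempty _ _ _ _ _ _ h, quotientBy, dif_neg (show
      ¬ Nonempty (Γ.toDecoratedGraph.contract F (deco l)).E from h), coeff_monomial]
    have : n = 0 ↔ expo n = 0 := by
      constructor
      · rintro rfl; ext; rfl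
      · intro h; rw [← deco_expo n, h]; rfl
    rw [apply_ite B, map_one, map_zero]
    exact if_congr this rfl rfl

open Classical in
/-- The functionals of the contractions of `F`, with their signs. They vanish if a half-edge of `F`
is decorated, so that sums over the boundary can be extended to all half-edges. -/
def quotVal (B : THat 𝔏 →ₐ[ℝ] R) (lab : Γ.E → 𝔏.Label) (r : Γ.V)
    (l : Γ.toDecoratedGraph.HalfEdge × Fin d →₀ ℕ) (n : Γ.V × Fin d →₀ ℕ) : R :=
  if ∀ h : Γ.toDecoratedGraph.HalfEdge, h.1 ∈ F → deco l h = 0 then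
    (-1) ^ Γ.toDecoratedGraph.outSize (deco l) * Γ.quotFun F B lab r l (monomial n 1) else 0

open Classical in
theorem monoFun_quotVal (B : THat 𝔏 →ₐ[ℝ] R) (lab : Γ.E → 𝔏.Label) (r : Γ.V)
    (l : Γ.toDecoratedGraph.HalfEdge × Fin d →₀ ℕ) (q : MvPolynomial (Γ.V × Fin d) R) :
    monoFun (Γ.quotVal F B lab r l) q =
      if ∀ h : Γ.toDecoratedGraph.HalfEdge, h.1 ∈ F → deco l h = 0 then
        (-1) ^ Γ.toDecoratedGraph.outSize (deco l) * Γ.quotFun F B lab r l q else 0 := by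
  unfold quotVal
  split_ifs with h
  · exact monoFun_eq (((-1 : R) ^ Γ.toDecoratedGraph.outSize (deco l)) • Γ.quotFun F B lab r l) q
  · exact monoFun_eq 0 q

theorem quotLabel_bump_of_mem (lab : Γ.E → 𝔏.Label) {e : Γ.E} (he : e ∈ F) (i : Fin d)
    (l : Γ.toDecoratedGraph.HalfEdge × Fin d →₀ ℕ) :
    Γ.quotLabel F (bump lab e i) l = Γ.quotLabel F lab l := by
  funext e'
  unfold quotLabel
  rw [bump_of_ne lab (fun h => e'.2 (by rw [h]; exact he))]

theorem quotLabel_bump_of_notMem (lab : Γ.E → 𝔏.Label) {e : Γ.E} (he : e ∉ F) (i : Fin d)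
    (l : Γ.toDecoratedGraph.HalfEdge × Fin d →₀ ℕ) :
    Γ.quotLabel F (bump lab e i) l = bump (Γ.quotLabel F lab l) ⟨e, he⟩ i := by
  funext e'
  unfold quotLabel
  by_cases h : e' = ⟨e, he⟩
  · subst h
    rw [bump_self, bump_self, 𝔏.shift_shift, 𝔏.shift_shift, add_comm]
  · rw [bump_of_ne _ h, bump_of_ne _ fun h' => h (Subtype.ext h')]

theorem quotLabel_add_single (lab : Γ.E → 𝔏.Label) (e : Γ.E) (b : Bool) (i : Fin d)
    (l : Γ.toDecoratedGraph.HalfEdge × Fin d →₀ ℕ) :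
    Γ.quotLabel F lab (l + Finsupp.single ((e, b), i) 1) = Γ.quotLabel F (bump lab e i) l := by
  classical
  funext e'
  unfold quotLabel
  rw [deco_add, deco_single]
  by_cases h : e'.1 = e
  · rw [h, bump_self, 𝔏.shift_shift]
    congr 1
    cases b <;> simp <;> abel
  · rw [bump_of_ne _ h]
    simp [h]

theorem quotVal_bump_of_mem (B : THat 𝔏 →ₐ[ℝ] R) (lab : Γ.E → 𝔏.Label) (r : Γ.V) {e : Γ.E}
    (he : e ∈ F) (i : Fin d) : Γ.quotVal F B (bump lab e i) r = Γ.quotVal F B lab r := by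
  funext l n
  unfold quotVal quotFun
  rw [quotLabel_bump_of_mem _ _ _ he]

theorem quotVal_add_single_of_mem (B : THat 𝔏 →ₐ[ℝ] R) (lab : Γ.E → 𝔏.Label) (r : Γ.V) {e : Γ.E}
    (he : e ∈ F) (b : Bool) (i : Fin d) (l : Γ.toDecoratedGraph.HalfEdge × Fin d →₀ ℕ)
    (n : Γ.V × Fin d →₀ ℕ) :
    Γ.quotVal F B lab r (l + Finsupp.single ((e, b), i) 1) n = 0 := by
  refine if_neg fun h => ?_
  have := congrFun (h (e, b) he) i
  simp [deco] at this

theorem outSize_add_single (e : Γ.E) (b : Bool) (i : Fin d)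
    (l : Γ.toDecoratedGraph.HalfEdge × Fin d →₀ ℕ) :
    Γ.toDecoratedGraph.outSize (deco (l + Finsupp.single ((e, b), i) 1)) =
      Γ.toDecoratedGraph.outSize (deco l) + if b then 0 else 1 := by
  classical
  unfold DecoratedGraph.outSize
  rw [deco_add, deco_single]
  simp only [Pi.add_apply, MultiIndex.size, Finset.sum_add_distrib]
  congr 1
  cases b
  · rw [Finset.sum_eq_single e]
    · simp [MultiIndex.unit]
    · intro e' _ he'; simp [he']
    · simp
  · simp

/-- Decorating a half-edge of a remaining edge means replacing its label, with a sign if the half-edge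
is outgoing. -/
theorem quotVal_add_single_of_notMem (B : THat 𝔏 →ₐ[ℝ] R) (lab : Γ.E → 𝔏.Label) (r : Γ.V)
    {e : Γ.E} (he : e ∉ F) (b : Bool) (i : Fin d)
    (l : Γ.toDecoratedGraph.HalfEdge × Fin d →₀ ℕ) (n : Γ.V × Fin d →₀ ℕ) :
    Γ.quotVal F B lab r (l + Finsupp.single ((e, b), i) 1) n =
      if b then Γ.quotVal F B (bump lab e i) r l n else -Γ.quotVal F B (bump lab e i) r l n := by
  classical
  have h1 : (∀ h : Γ.toDecoratedGraph.HalfEdge, h.1 ∈ F →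
      deco (l + Finsupp.single ((e, b), i) 1) h = 0) ↔
      ∀ h : Γ.toDecoratedGraph.HalfEdge, h.1 ∈ F → deco l h = 0 := by
    refine forall_congr' fun h => forall_congr' fun hh => ?_
    have : h ≠ (e, b) := fun h' => he (by rw [h'] at hh; exact hh)
    rw [deco_add, deco_single, Pi.add_apply]
    simp [this]
  unfold quotVal
  rw [Γ.outSize_add_single]
  have h2 : Γ.quotFun F B lab r (l + Finsupp.single ((e, b), i) 1) =
      Γ.quotFun F B (bump lab e i) r l := by
    unfold quotFun
    rw [quotLabel_add_single]
  rw [h2]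
  simp only [h1]
  split_ifs <;> simp [pow_succ]

omit [Algebra ℝ R] in
/-- Contraction identifies variables, so a derivative at a node is the sum of the derivatives at the
vertices of the class. -/
theorem pderiv_rename_quotVar (c : Γ.toDecoratedGraph.Classes F) (i : Fin d)
    (q : MvPolynomial (Γ.V × Fin d) R) :
    pderiv (c, i) (rename (Γ.quotVar F) q) =
      ∑ w, open Classical in if Γ.toDecoratedGraph.cls F w = c then
        rename (Γ.quotVar F) (pderiv (w, i) q) else 0 := by
  classical
  induction q using MvPolynomial.induction_on with
  | C a => simp
  | add p q hp hq =>
    simp only [map_add, hp, hq, ← Finset.sum_add_distrib]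
    refine Finset.sum_congr rfl fun w _ => ?_
    split_ifs <;> simp
  | mul_X p x hp =>
    obtain ⟨v, j⟩ := x
    have h1 : pderiv (c, i) (X (Γ.quotVar F (v, j)) : MvPolynomial _ R) =
        ∑ w, if Γ.toDecoratedGraph.cls F w = c then
          rename (Γ.quotVar F) (pderiv (w, i) (X (v, j) : MvPolynomial _ R)) else 0 := by
      rw [Finset.sum_eq_single v]
      · simp only [pderiv_X, quotVar, Prod.map, id]
        by_cases hc : Γ.toDecoratedGraph.cls F v = c
        · rw [if_pos hc]
          by_cases hj : j = i
          · subst hj; subst hc; simp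
          · rw [Pi.single_eq_of_ne (by simp [hj]), Pi.single_eq_of_ne (by simp [hj]), map_zero]
        · rw [if_neg hc, Pi.single_eq_of_ne (by simp [hc])]
      · intro w _ hw
        rw [pderiv_X, Pi.single_eq_of_ne (by simp [hw.symm]), map_zero, ite_self]
      · simp
    simp only [map_mul, Derivation.leibniz, smul_eq_mul, map_add, hp, rename_X, h1,
      Finset.mul_sum, ← Finset.sum_add_distrib]
    refine Finset.sum_congr rfl fun w _ => ?_
    split_ifs <;> simp

/-- The vertices at which half-edges sit, with directions of derivatives. -/
def halfVar : Γ.toDecoratedGraph.HalfEdge × Fin d → Γ.V × Fin d :=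
  Prod.map Γ.toDecoratedGraph.endpoint id

/-- A sum over half-edges, one direction of the derivatives being fixed. -/
theorem sum_halfEdge {M : Type*} [AddCommMonoid M]
    (f : Γ.toDecoratedGraph.HalfEdge → M) : ∑ h, f h = ∑ e, (f (e, true) + f (e, false)) := by
  rw [Fintype.sum_prod_type]
  refine Finset.sum_congr rfl fun e _ => ?_
  simp

open Classical in
/-- Integration by parts at a node of the contraction. -/
theorem sum_quotVal_add_single {B : THat 𝔏 →ₐ[ℝ] R} (hB : ∀ N, RespectsBelow N B)
    (lab : Γ.E → 𝔏.Label) (r : Γ.V) (c : Γ.toDecoratedGraph.Classes F)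
    (hc : c ≠ Γ.toDecoratedGraph.cls F r) (i : Fin d)
    (l : Γ.toDecoratedGraph.HalfEdge × Fin d →₀ ℕ) (n : Γ.V × Fin d →₀ ℕ) :
    ∑ h, (if Γ.toDecoratedGraph.cls F (Γ.toDecoratedGraph.endpoint h) = c then
        Γ.quotVal F B lab r (l + Finsupp.single (h, i) 1) n else 0) +
      ∑ w, (if Γ.toDecoratedGraph.cls F w = c then
        (n (w, i) : R) * Γ.quotVal F B lab r l (n - Finsupp.single (w, i) 1) else 0) = 0 := by
  by_cases hl : ∀ h : Γ.toDecoratedGraph.HalfEdge, h.1 ∈ F → deco l h = 0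
  swap
  · have h1 : ∀ lab n, Γ.quotVal F B lab r l n = 0 := fun lab n => if_neg hl
    simp only [h1, mul_zero, ite_self, Finset.sum_const_zero, add_zero]
    refine Finset.sum_eq_zero fun h _ => ?_
    obtain ⟨e, b⟩ := h
    by_cases he : e ∈ F
    · rw [quotVal_add_single_of_mem _ _ _ _ _ he, ite_self]
    · rw [quotVal_add_single_of_notMem _ _ _ _ _ he, h1]; simp
  -- if no edge remained, then the connected diagram would be contracted to a single node
  have h : Nonempty (Γ.QuotE F) := by
    by_contra h
    refine hc ?_
    obtain ⟨v, rfl⟩ := Quotient.exists_rep c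
    refine Quotient.sound (s := Γ.toDecoratedGraph.subSetoid F) ?_
    have := Γ.connected.2 v r
    refine Relation.EqvGen.mono (fun a b hab => ?_) _ _ this
    obtain ⟨e, he⟩ := hab
    exact ⟨e, by_contra fun he => h ⟨⟨e, he⟩⟩, he⟩
  have key := (hB _).nodeFun_ibp (Γ.quotDiagram F h) (Nat.lt_succ_self _) (Γ.quotLabel F lab l)
    (Γ.toDecoratedGraph.cls F r) c hc i (rename (Γ.quotVar F) (monomial n 1))
  rw [pderiv_rename_quotVar, map_sum] at key
  have hv : ∀ lab n, Γ.quotVal F B lab r l n = (-1) ^ Γ.toDecoratedGraph.outSize (deco l) *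
      nodeFun B (Γ.quotDiagram F h) (Γ.quotLabel F lab l) (Γ.toDecoratedGraph.cls F r)
      (rename (Γ.quotVar F) (monomial n 1)) := fun lab n => by
    rw [quotVal, if_pos hl, quotFun_of_nonempty _ _ _ _ _ _ h]
  have key' := congrArg (fun x => (-1) ^ Γ.toDecoratedGraph.outSize (deco l) * x) key
  simp only [mul_add, mul_zero, Finset.mul_sum] at key'
  refine Eq.trans ?_ key'
  congr 1
  · rw [sum_halfEdge, ← Finset.sum_subset (Finset.subset_univ (Finset.univ.filter fun e => e ∉ F)),
      Finset.sum_subtype (p := fun e => e ∉ F) _ (by simp)]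
    · refine Finset.sum_congr rfl fun e _ => ?_
      rw [quotVal_add_single_of_notMem _ _ _ _ _ e.2, quotVal_add_single_of_notMem _ _ _ _ _ e.2,
        hv, quotLabel_bump_of_notMem _ _ _ e.2]
      simp only [if_true, Bool.false_eq_true, if_false, DecoratedGraph.endpoint,
        sub_eq_add_neg]
      split_ifs <;> simp
    · intro e _ he
      have he : e ∈ F := by simpa using he
      rw [quotVal_add_single_of_mem _ _ _ _ _ he, quotVal_add_single_of_mem _ _ _ _ _ he]
      simp
  · refine Finset.sum_congr rfl fun w _ => ?_
    split_ifs
    · rw [hv, pderiv_monomial]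
      have : (monomial (n - Finsupp.single (w, i) 1) (1 * (n (w, i) : R))) =
          (n (w, i) : R) • monomial (n - Finsupp.single (w, i) 1) (1 : R) := by
        rw [smul_monomial]; simp
      rw [this, map_smul, map_smul, smul_eq_mul]
      ring
    · simp

end VacuumDiagram

end Contractions

/-! ### The terms of the coproduct -/

section Terms

open MvPolynomial

variable {d : ℕ} {𝔏 : LabelSystem d} {R : Type*} [CommRing R] [Algebra ℝ R]

namespace VacuumDiagram

variable (Γ : VacuumDiagram 𝔏) (F : Finset Γ.E)

/-- The symbol of a subgraph in terms of derivatives at the half-edges and of the node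
decoration: a derivative at a vertex is distributed over all half-edges at this vertex and the node
decoration. -/
def pullSymbol (p : MvPolynomial (Γ.V × Fin d) R) :
    MvPolynomial (Γ.toDecoratedGraph.HalfEdge × Fin d ⊕ Γ.V × Fin d) R :=
  pull (Sum.elim Γ.halfVar id) p

omit [Algebra ℝ R] in
theorem pullSymbol_mul (p q : MvPolynomial (Γ.V × Fin d) R) :
    Γ.pullSymbol (p * q) = Γ.pullSymbol p * Γ.pullSymbol q := map_mul (pull _) p q

omit [Algebra ℝ R] in
theorem sum_halfVar {M : Type*} [AddCommMonoid M] (P : Γ.V → Prop) [DecidablePred P] (i : Fin d)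
    (f : Γ.toDecoratedGraph.HalfEdge × Fin d → M) :
    ∑ x, (if P (Γ.halfVar x).1 ∧ x.2 = i then f x else 0) =
      ∑ h, if P (Γ.toDecoratedGraph.endpoint h) then f (h, i) else 0 := by
  rw [Fintype.sum_prod_type]
  refine Finset.sum_congr rfl fun h _ => ?_
  rw [Finset.sum_eq_single i]
  · simp [halfVar]
  · intro j _ hj; simp [hj]
  · simp

omit [Algebra ℝ R] in
/-- The derivatives at a set of vertices, distributed over the half-edges. -/
theorem pullSymbol_sum (P : Γ.V → Prop) [DecidablePred P] (i : Fin d) :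
    Γ.pullSymbol (∑ v, if P v then X (v, i) else 0 : MvPolynomial (Γ.V × Fin d) R) =
      ∑ h ∈ Finset.univ.filter fun h => P (Γ.toDecoratedGraph.endpoint h), X (Sum.inl (h, i)) +
      ∑ v ∈ Finset.univ.filter P, X (Sum.inr (v, i)) := by
  classical
  unfold pullSymbol
  rw [map_sum, Finset.sum_filter, Finset.sum_filter]
  have h1 : ∀ v, pull (Sum.elim Γ.halfVar id)
        (if P v then (X (v, i) : MvPolynomial (Γ.V × Fin d) R) else 0) =
      (∑ h, if P v then if Γ.halfVar h = (v, i) then X (Sum.inl h) else 0 else 0) +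
        if P v then X (Sum.inr (v, i)) else 0 := by
    intro v
    split_ifs
    · rw [pull_sumElim_id_X]
      congr!
    · simp
  simp only [h1, Finset.sum_add_distrib]
  congr 1
  rw [Finset.sum_comm]
  refine Eq.trans ?_ (Γ.sum_halfVar P i fun x => X (Sum.inl x))
  refine Finset.sum_congr rfl fun h _ => ?_
  obtain ⟨h, j⟩ := h
  rw [Finset.sum_eq_single (Γ.toDecoratedGraph.endpoint h)]
  · simp only [halfVar, Prod.map, id]
    by_cases hj : j = i
    · simp [hj]
    · simp [hj]
  · intro v _ hv
    simp [halfVar, hv.symm]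
  · simp

/-- The pairing of a symbol with the contractions of `F`. -/
def pairing (B : THat 𝔏 →ₐ[ℝ] R) (lab : Γ.E → 𝔏.Label) (r : Γ.V)
    (p q : MvPolynomial (Γ.V × Fin d) R) : R :=
  opPair (Γ.quotVal F B lab r) (Γ.pullSymbol p) q

section

variable (B : THat 𝔏 →ₐ[ℝ] R) (lab : Γ.E → 𝔏.Label) (r : Γ.V)

theorem pairing_add_left (p p' q : MvPolynomial (Γ.V × Fin d) R) :
    Γ.pairing F B lab r (p + p') q = Γ.pairing F B lab r p q + Γ.pairing F B lab r p' q := by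
  simp only [pairing, pullSymbol, map_add, LinearMap.add_apply]

theorem pairing_sub_left (p p' q : MvPolynomial (Γ.V × Fin d) R) :
    Γ.pairing F B lab r (p - p') q = Γ.pairing F B lab r p q - Γ.pairing F B lab r p' q := by
  simp only [pairing, pullSymbol, map_sub, LinearMap.sub_apply]

theorem pairing_zero_left (q : MvPolynomial (Γ.V × Fin d) R) :
    Γ.pairing F B lab r 0 q = 0 := by
  simp only [pairing, pullSymbol, map_zero, LinearMap.zero_apply]

theorem pairing_sum_left {ι : Type*} (s : Finset ι) (p : ι → MvPolynomial (Γ.V × Fin d) R)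
    (q : MvPolynomial (Γ.V × Fin d) R) :
    Γ.pairing F B lab r (∑ i ∈ s, p i) q = ∑ i ∈ s, Γ.pairing F B lab r (p i) q := by
  simp only [pairing, pullSymbol, map_sum (pull _), map_sum (opPair _), LinearMap.sum_apply]

open Classical in
/-- A derivative at a vertex acts on all adjacent edges that are not contracted, and on the node
decoration. -/
theorem pairing_X_mul (v : Γ.V) (i : Fin d) (p q : MvPolynomial (Γ.V × Fin d) R) :
    Γ.pairing F B lab r (X (v, i) * p) q =
      ∑ e ∈ Finset.univ.filter (· ∉ F),
        ((if Γ.tgt e = v then Γ.pairing F B (bump lab e i) r p q else 0) -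
        (if Γ.src e = v then Γ.pairing F B (bump lab e i) r p q else 0)) +
      Γ.pairing F B lab r p (pderiv (v, i) q) := by
  have h1 : (X (v, i) : MvPolynomial (Γ.V × Fin d) R) =
      ∑ w, if w = v then X (w, i) else 0 := by simp
  unfold pairing
  rw [pullSymbol_mul, h1, pullSymbol_sum, add_mul, map_add, LinearMap.add_apply]
  congr 1
  · rw [Finset.sum_mul, map_sum (opPair _), LinearMap.sum_apply, Finset.sum_filter, sum_halfEdge,
      Finset.sum_filter]
    refine Finset.sum_congr rfl fun e _ => ?_
    have h2 : ∀ b : Bool, opPair (Γ.quotVal F B lab r) (X (Sum.inl ((e, b), i)) * Γ.pullSymbol p) q =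
        if e ∉ F then (if b then opPair (Γ.quotVal F B (bump lab e i) r) (Γ.pullSymbol p) q else
          -opPair (Γ.quotVal F B (bump lab e i) r) (Γ.pullSymbol p) q) else 0 := by
      intro b
      rw [opPair_inl_mul]
      split_ifs with he hb
      · rw [← opPair_zero (H := Γ.toDecoratedGraph.HalfEdge × Fin d) (Γ.pullSymbol p) q]
        congr 3
        funext l n
        rw [quotVal_add_single_of_mem _ _ _ _ _ he]
      · subst hb
        congr 3
        funext l n
        rw [quotVal_add_single_of_notMem _ _ _ _ _ he]; rfl
      · rw [← opPair_neg]
        congr 3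
        funext l n
        rw [quotVal_add_single_of_notMem _ _ _ _ _ he, if_neg hb]
    rw [h2, h2]
    simp only [DecoratedGraph.endpoint, if_true, Bool.false_eq_true, if_false]
    split_ifs <;> simp
  · rw [Finset.sum_filter, Finset.sum_ite_eq' Finset.univ v, if_pos (Finset.mem_univ _),
      opPair_inr_mul]

end

/-- Total derivatives at a node of the contraction other than the distinguished one vanish, by
integration by parts in the contraction. -/
theorem pairing_classSum_mul {B : THat 𝔏 →ₐ[ℝ] R} (hB : ∀ N, RespectsBelow N B)
    (lab : Γ.E → 𝔏.Label) (r : Γ.V) (c : Γ.toDecoratedGraph.Classes F)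
    (hc : c ≠ Γ.toDecoratedGraph.cls F r) (i : Fin d) (p q : MvPolynomial (Γ.V × Fin d) R) :
    Γ.pairing F B lab r (Γ.toDecoratedGraph.classSum F c i * p) q = 0 := by
  classical
  unfold pairing DecoratedGraph.classSum
  rw [pullSymbol_mul, Γ.pullSymbol_sum (fun v => Γ.toDecoratedGraph.cls F v = c)]
  have := opPair_sum_mul_eq_zero
    ((Finset.univ.filter fun h => Γ.toDecoratedGraph.cls F (Γ.toDecoratedGraph.endpoint h) = c).map
      ⟨fun h => (h, i), fun a b h => congrArg Prod.fst h⟩)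
    ((Finset.univ.filter fun v => Γ.toDecoratedGraph.cls F v = c).map
      ⟨fun h => (h, i), fun a b h => congrArg Prod.fst h⟩) (Γ.quotVal F B lab r)
    (fun l n => by
      rw [Finset.sum_map, Finset.sum_map, Finset.sum_filter, Finset.sum_filter]
      exact Γ.sum_quotVal_add_single F hB lab r c hc i l n) (Γ.pullSymbol p) q
  rw [Finset.sum_map, Finset.sum_map] at this
  exact this

/-- The sum of the derivatives at all vertices only acts on the node decoration, since the two
half-edges of each edge contribute with opposite signs. -/
theorem pairing_sum_X_mul (B : THat 𝔏 →ₐ[ℝ] R) (lab : Γ.E → 𝔏.Label) (r : Γ.V) (i : Fin d)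
    (p q : MvPolynomial (Γ.V × Fin d) R) :
    Γ.pairing F B lab r ((∑ v, X (v, i)) * p) q =
      Γ.pairing F B lab r p (∑ v, pderiv (v, i) q) := by
  classical
  rw [Finset.sum_mul, pairing_sum_left]
  simp only [pairing_X_mul, Finset.sum_add_distrib]
  rw [Finset.sum_comm, Finset.sum_eq_zero, zero_add]
  · unfold pairing; rw [map_sum]
  · intro e _
    rw [Finset.sum_sub_distrib]
    simp

/-- If the polynomial is invariant under translations, then the derivatives at all nodes of the
contraction vanish. -/
theorem pairing_classSum_mul_of_invariant {B : THat 𝔏 →ₐ[ℝ] R} (hB : ∀ N, RespectsBelow N B)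
    (lab : Γ.E → 𝔏.Label) (r : Γ.V) (c : Γ.toDecoratedGraph.Classes F) (i : Fin d)
    (p q : MvPolynomial (Γ.V × Fin d) R) (hq : ∀ i, ∑ v, pderiv (v, i) q = 0) :
    Γ.pairing F B lab r (Γ.toDecoratedGraph.classSum F c i * p) q = 0 := by
  classical
  by_cases hc : c = Γ.toDecoratedGraph.cls F r
  · have h1 : (∑ v, X (v, i) : MvPolynomial (Γ.V × Fin d) R) =
        ∑ c, Γ.toDecoratedGraph.classSum F c i := by
      unfold DecoratedGraph.classSum
      rw [Finset.sum_comm]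
      refine Finset.sum_congr rfl fun v _ => ?_
      simp
    have h2 := Γ.pairing_sum_X_mul F B lab r i p q
    rw [hq, h1, ← Finset.add_sum_erase _ _ (Finset.mem_univ c), add_mul, Finset.sum_mul,
      pairing_add_left, pairing_sum_left, Finset.sum_eq_zero (fun c' hc' =>
        Γ.pairing_classSum_mul F hB lab r c' (hc ▸ (Finset.mem_erase.1 hc').1) i p q), add_zero] at h2
    rw [h2, pairing, map_zero]
  · exact Γ.pairing_classSum_mul F hB lab r c hc i p q

/-- The term of a subgraph in the coproduct, as a functional of the node decoration. -/
def term (A B : THat 𝔏 →ₐ[ℝ] R) (lab : Γ.E → 𝔏.Label) (ρ : Γ.toDecoratedGraph.Classes F → Γ.V)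
    (hρ : ∀ c, Γ.toDecoratedGraph.cls F (ρ c) = c) (r : Γ.V)
    (q : MvPolynomial (Γ.V × Fin d) R) : R :=
  Γ.pairing F B lab r (Γ.toDecoratedGraph.extractSymbol F A lab ρ hρ) q

section

variable {N : ℕ} {A B : THat 𝔏 →ₐ[ℝ] R} (hA : RespectsBelow N A) (hA' : KillsPositive A)
  (hF : F.card < N) (hB : ∀ N, RespectsBelow N B) (lab : Γ.E → 𝔏.Label)
  (ρ ρ' : Γ.toDecoratedGraph.Classes F → Γ.V) (hρ : ∀ c, Γ.toDecoratedGraph.cls F (ρ c) = c)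
  (hρ' : ∀ c, Γ.toDecoratedGraph.cls F (ρ' c) = c) (r : Γ.V)

include hA hA' hF hB in
/-- The distinguished vertices of the components of a subgraph can be chosen arbitrarily, except on
the class of the distinguished vertex unless the polynomial is invariant under translations. -/
theorem term_eq_term (q : MvPolynomial (Γ.V × Fin d) R)
    (h : (∀ i, ∑ v, pderiv (v, i) q = 0) ∨
      ρ (Γ.toDecoratedGraph.cls F r) = ρ' (Γ.toDecoratedGraph.cls F r)) :
    Γ.term F A B lab ρ hρ r q = Γ.term F A B lab ρ' hρ' r q := by
  have key : ∀ x ∈ Ideal.span {x | ∃ c i, ρ c ≠ ρ' c ∧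
      x = (Γ.toDecoratedGraph.classSum F c i : MvPolynomial (Γ.V × Fin d) R)},
      ∀ p, Γ.pairing F B lab r (p * x) q = 0 := by
    intro x hx
    induction hx using Submodule.span_induction with
    | mem x hx =>
      obtain ⟨c, i, hc, rfl⟩ := hx
      intro p
      rw [mul_comm]
      rcases h with h | h
      · exact Γ.pairing_classSum_mul_of_invariant F hB lab r c i p q h
      · refine Γ.pairing_classSum_mul F hB lab r c ?_ i p q
        rintro rfl
        exact hc h
    | zero => intro p; rw [mul_zero, pairing_zero_left]
    | add x y _ _ hx hy => intro p; rw [mul_add, pairing_add_left, hx, hy, add_zero]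
    | smul a x _ hx => intro p; rw [smul_eq_mul, ← mul_assoc]; exact hx _
  have h1 := key _ (Γ.toDecoratedGraph.extractSymbol_sub_mem F hA hA' hF lab ρ ρ' hρ hρ') 1
  rw [one_mul, pairing_sub_left, sub_eq_zero] at h1
  exact h1

include hA hA' hF hB in
open Classical in
/-- Integration by parts for the term of a subgraph. Derivatives of contracted edges are taken by the
symbol of the subgraph, and the variable that remains is a derivative acting on the other edges and
on the node decoration. -/
theorem term_ibp (hr : ρ (Γ.toDecoratedGraph.cls F r) = r) (v : Γ.V) (hv : v ≠ r) (i : Fin d)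
    (q : MvPolynomial (Γ.V × Fin d) R) :
    ∑ e, ((if Γ.tgt e = v then Γ.term F A B (bump lab e i) ρ hρ r q else 0) -
        (if Γ.src e = v then Γ.term F A B (bump lab e i) ρ hρ r q else 0)) +
      Γ.term F A B lab ρ hρ r (pderiv (v, i) q) = 0 := by
  have h1 := congrArg (fun p => Γ.pairing F B lab r p q)
    (Γ.toDecoratedGraph.sum_extractSymbol_bump F hA hA' hF lab ρ hρ v i)
  simp only [pairing_add_left, pairing_X_mul] at h1
  -- `v` can be the distinguished vertex of its component only if that component does not contain `r`
  have h2 : Γ.pairing F B lab r (if v = ρ (Γ.toDecoratedGraph.cls F v) then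
      Γ.toDecoratedGraph.classSum F (Γ.toDecoratedGraph.cls F v) i *
        Γ.toDecoratedGraph.extractSymbol F A lab ρ hρ else 0) q = 0 := by
    split_ifs with h
    · refine Γ.pairing_classSum_mul F hB lab r _ (fun hc => hv ?_) i _ q
      rw [h, hc, hr]
    · exact Γ.pairing_zero_left F B lab r q
  rw [h2, ← add_assoc] at h1
  refine Eq.trans ?_ h1
  unfold term
  congr 1
  rw [← Finset.sum_filter_add_sum_filter_not Finset.univ (· ∈ F)]
  congr 1
  · rw [Finset.filter_mem_eq_inter, Finset.univ_inter, pairing_sum_left]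
    refine Finset.sum_congr rfl fun e he => ?_
    rw [pairing_sub_left, apply_ite (fun p => Γ.pairing F B lab r p q),
      apply_ite (fun p => Γ.pairing F B lab r p q), pairing_zero_left]
    unfold pairing
    rw [quotVal_bump_of_mem _ _ _ _ _ he]
  · refine Finset.sum_congr rfl fun e he => ?_
    rw [Γ.toDecoratedGraph.extractSymbol_bump_of_notMem F A lab ρ hρ (Finset.mem_filter.1 he).2]

omit [Algebra ℝ R] in
/-- Recentring commutes with contraction. -/
theorem recenter_rename_quotVar (q : MvPolynomial (Γ.V × Fin d) R) :
    rename (Γ.quotVar F) (recenter r q) =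
      recenter (Γ.toDecoratedGraph.cls F r) (rename (Γ.quotVar F) q) := by
  unfold recenter
  rw [aeval_rename, ← AlgHom.comp_apply, comp_aeval]
  congr 2
  funext x
  simp only [map_sub, rename_X]
  rfl

include hB in
/-- Change of the distinguished vertex for the contractions of `F`. -/
theorem monoFun_quotVal_recenter (v : Γ.V) (l : Γ.toDecoratedGraph.HalfEdge × Fin d →₀ ℕ)
    (q : MvPolynomial (Γ.V × Fin d) R) :
    monoFun (Γ.quotVal F B lab r l) q = monoFun (Γ.quotVal F B lab v l) (recenter r q) := by
  rw [monoFun_quotVal, monoFun_quotVal]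
  congr 2
  by_cases h : Nonempty (Γ.QuotE F)
  · rw [quotFun_of_nonempty _ _ _ _ _ _ h, quotFun_of_nonempty _ _ _ _ _ _ h,
      recenter_rename_quotVar]
    exact (hB _).nodeFun_move (Γ.quotDiagram F h) (Nat.lt_succ_self _) _ _ _ _
  · rw [quotFun_of_not_nonempty _ _ _ _ _ _ h, quotFun_of_not_nonempty _ _ _ _ _ _ h, recenter,
      coeff_zero_aeval]
    intro x
    simp [coeff_zero_X]

include hA hA' hF hB in
/-- Change of the distinguished vertex for the term of a subgraph. With `r` distinguished in its
component, the symbol does not involve derivatives at `r`, and all others commute with recentring. -/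
theorem term_move (hr : ρ (Γ.toDecoratedGraph.cls F r) = r) (v : Γ.V)
    (q : MvPolynomial (Γ.V × Fin d) R) :
    Γ.term F A B lab ρ hρ r q = Γ.term F A B lab ρ' hρ' v (recenter r q) := by
  classical
  -- the recentred polynomial is translation invariant, so that `ρ'` can be replaced by `ρ`
  rw [← Γ.term_eq_term F hA hA' hF hB lab ρ ρ' hρ hρ' v (recenter r q)
    (Or.inl fun i => sum_pderiv_recenter r i q)]
  unfold term pairing pullSymbol
  have h1 := Γ.toDecoratedGraph.extractSymbol_eq_aeval F hA hA' hF lab ρ hρ r hr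
  have := opPair_eq_opPair_of_commute Γ.halfVar (Γ.quotVal F B lab r) (Γ.quotVal F B lab v)
    {x : Γ.V × Fin d | x.1 = r} (recenter r) (fun w hw q => pderiv_recenter r hw q)
    (Γ.monoFun_quotVal_recenter F hB lab r v) (Γ.toDecoratedGraph.extractSymbol F A lab ρ hρ) q
  rw [h1] at this
  exact this

end

end VacuumDiagram

end Terms

/-! ### Invariance under isomorphisms -/

section Invariance

open MvPolynomial

variable {d : ℕ} {𝔏 : LabelSystem d} {R : Type*} [CommRing R] [Algebra ℝ R]

omit [Algebra ℝ R] in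
theorem opPair_rename {H H' W W' : Type*} [Fintype W] [Fintype W'] (eH : H ≃ H') (eW : W ≃ W')
    (β : (H →₀ ℕ) → (W →₀ ℕ) → R) (β' : (H' →₀ ℕ) → (W' →₀ ℕ) → R)
    (h : ∀ l n, β' (l.mapDomain eH) (n.mapDomain eW) = β l n)
    (p : MvPolynomial (H ⊕ W) R) (q : MvPolynomial W R) :
    opPair β' (rename (Sum.map eH eW) p) (rename eW q) = opPair β p q := by
  have : (opPair β').compl₁₂ (rename (Sum.map eH eW)).toLinearMap (rename eW).toLinearMap =
      opPair β :=
    linearMap₂_ext_monomial fun s n => by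
      have h1 : ∀ x, s.mapDomain (Sum.map eH eW) (Sum.map eH eW x) = s x :=
        fun x => Finsupp.mapDomain_apply (eH.injective.sumMap eW.injective) _ _
      have h2 : ∀ x, n.mapDomain eW (eW x) = n x :=
        fun x => Finsupp.mapDomain_apply eW.injective _ _
      simp only [LinearMap.compl₁₂_apply, AlgHom.toLinearMap_apply, rename_monomial,
        opPair_monomial]
      rw [← h, ← eW.prod_comp]
      have h3 : ∀ w, s.mapDomain (Sum.map eH eW) (Sum.inr (eW w)) = s (Sum.inr w) :=
        fun w => h1 (Sum.inr w)
      simp only [h2, h3]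
      congr 3
      · ext x
        obtain ⟨x, rfl⟩ := eH.surjective x
        rw [Finsupp.mapDomain_apply eH.injective]
        exact h1 (Sum.inl x)
      · ext x
        obtain ⟨x, rfl⟩ := eW.surjective x
        rw [Finsupp.mapDomain_apply eW.injective]
        simp only [Finsupp.coe_tsub, Pi.sub_apply, h2, Finsupp.comapDomain_apply, h3]
  exact congrArg (fun f : MvPolynomial (H ⊕ W) R →ₗ[R] MvPolynomial W R →ₗ[R] R => f p q) this

omit [Algebra ℝ R] in
theorem pull_rename {S S' W W' : Type*} [Fintype S] [Fintype S'] (eS : S ≃ S') (eW : W ≃ W')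
    (f : S → W) (f' : S' → W') (h : ∀ s, f' (eS s) = eW (f s)) (p : MvPolynomial W R) :
    pull f' (rename eW p) = rename eS (pull f p) := by
  classical
  unfold pull
  rw [aeval_rename, ← AlgHom.comp_apply, comp_aeval]
  congr 2
  funext w
  rw [Function.comp_apply, ← eS.sum_comp, map_sum]
  refine Finset.sum_congr rfl fun s _ => ?_
  rw [h, eW.injective.eq_iff]
  split_ifs <;> simp

theorem nodeFun_rename {N : ℕ} {A : THat 𝔏 →ₐ[ℝ] R} (hA : RespectsBelow N A)
    (Γ Γ' : VacuumDiagram 𝔏) (hΓ : Nat.card Γ.E < N) (a : Γ.V ≃ Γ'.V) (b : Γ.E ≃ Γ'.E)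
    (hs : ∀ e, Γ'.src (b e) = a (Γ.src e)) (ht : ∀ e, Γ'.tgt (b e) = a (Γ.tgt e))
    (lab : Γ.E → 𝔏.Label) (lab' : Γ'.E → 𝔏.Label) (hl : ∀ e, lab' (b e) = lab e) (r : Γ.V)
    (q : MvPolynomial (Γ.V × Fin d) R) :
    nodeFun A Γ' lab' (a r) (rename (Prod.map a id) q) = nodeFun A Γ lab r q := by
  unfold nodeFun
  rw [monoFun_rename]
  congr 2
  funext s
  refine (hA.iso (Γ.vary lab r (deco s)) (Γ'.vary lab' (a r) _) hΓ ⟨a, b, hs, ht, hl, rfl, fun v => ?_⟩).symm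
  funext i
  exact Finsupp.mapDomain_apply (a.injective.prodMap Function.injective_id) s (v, i)

theorem symbol_rename {N : ℕ} {A : THat 𝔏 →ₐ[ℝ] R} (hA : RespectsBelow N A)
    (hA' : KillsPositive A) (Γ Γ' : VacuumDiagram 𝔏) (hΓ : Nat.card Γ.E < N) (a : Γ.V ≃ Γ'.V)
    (b : Γ.E ≃ Γ'.E)
    (hs : ∀ e, Γ'.src (b e) = a (Γ.src e)) (ht : ∀ e, Γ'.tgt (b e) = a (Γ.tgt e))
    (lab : Γ.E → 𝔏.Label) (lab' : Γ'.E → 𝔏.Label) (hl : ∀ e, lab' (b e) = lab e) (r : Γ.V) :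
    symbol A Γ' lab' (a r) = rename (Prod.map a id) (symbol A Γ lab r) := by
  have hinj : Function.Injective (Prod.map a id : Γ.V × Fin d → Γ'.V × Fin d) :=
    a.injective.prodMap Function.injective_id
  ext s'
  obtain ⟨s, rfl⟩ : ∃ s : Γ.V × Fin d →₀ ℕ, s.mapDomain (Prod.map a id) = s' := by
    refine ⟨s'.comapDomain (Prod.map a id) hinj.injOn, ?_⟩
    refine Finsupp.mapDomain_comapDomain _ hinj _ fun x _ => ?_
    exact ⟨(a.symm x.1, x.2), by simp⟩
  rw [coeff_rename_mapDomain _ hinj]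
  have h1 : expFact (s.mapDomain (Prod.map a id)) = expFact s := by
    rw [expFact, ← (a.prodCongr (Equiv.refl (Fin d))).prod_comp]
    exact Finset.prod_congr rfl fun x _ => by
      congr 1; exact Finsupp.mapDomain_apply hinj s x
  refine natCast_mul_cancel (expFact_ne_zero s) ?_
  rw [expFact_mul_coeff_symbol hA', ← h1, expFact_mul_coeff_symbol hA']
  refine (hA.iso (Γ.vary lab r (deco s)) (Γ'.vary lab' (a r) _) hΓ ⟨a, b, hs, ht, hl, rfl, fun v => ?_⟩).symm
  funext i
  exact Finsupp.mapDomain_apply hinj s (v, i)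

namespace DecoratedGraph

section

variable {G G' : DecoratedGraph 𝔏} (a : G.V ≃ G'.V) (b : G.E ≃ G'.E)
  (hs : ∀ e, G'.src (b e) = a (G.src e)) (ht : ∀ e, G'.tgt (b e) = a (G.tgt e))
  (F : Finset G.E) (F' : Finset G'.E) (hF : ∀ e, b e ∈ F' ↔ e ∈ F)

include hs ht hF in
/-- An isomorphism preserves the connected components of a subgraph. -/
theorem subSetoid_iff (u v : G.V) :
    G.subSetoid F u v ↔ G'.subSetoid F' (a u) (a v) := by
  constructor
  · intro h
    change Relation.EqvGen _ _ _ at h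
    change Relation.EqvGen _ _ _
    induction h with
    | rel u v h =>
      obtain ⟨e, he, rfl, rfl⟩ := h
      exact Relation.EqvGen.rel _ _ ⟨b e, (hF e).2 he, hs e, ht e⟩
    | refl u => exact Relation.EqvGen.refl _
    | symm u v _ ih => exact Relation.EqvGen.symm _ _ ih
    | trans u v w _ _ h1 h2 => exact Relation.EqvGen.trans _ _ _ h1 h2
  · have key : ∀ x y, Relation.EqvGen (fun c d => ∃ e ∈ F', G'.src e = c ∧ G'.tgt e = d) x y →
        G.subSetoid F (a.symm x) (a.symm y) := by
      intro x y h
      induction h with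
      | rel u v h =>
        obtain ⟨e, he, rfl, rfl⟩ := h
        obtain ⟨e, rfl⟩ := b.surjective e
        refine Relation.EqvGen.rel _ _ ⟨e, (hF e).1 he, ?_, ?_⟩
        · rw [hs, a.symm_apply_apply]
        · rw [ht, a.symm_apply_apply]
      | refl u => exact Relation.EqvGen.refl _
      | symm u v _ ih => exact Relation.EqvGen.symm _ _ ih
      | trans u v w _ _ h1 h2 => exact Relation.EqvGen.trans _ _ _ h1 h2
    intro h
    simpa using key _ _ h

/-- The bijection of classes induced by an isomorphism. -/
def clsEquiv : G.Classes F ≃ G'.Classes F' :=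
  Quotient.congr a (subSetoid_iff a b hs ht F F' hF)

theorem clsEquiv_cls (v : G.V) :
    clsEquiv a b hs ht F F' hF (G.cls F v) = G'.cls F' (a v) := rfl

/-- The bijection of the vertices of a component induced by an isomorphism. -/
def compVEquiv (c : G.Classes F) :
    G.CompV F c ≃ G'.CompV F' (clsEquiv a b hs ht F F' hF c) :=
  a.subtypeEquiv fun v => by
    rw [← clsEquiv_cls a b hs ht F F' hF, (clsEquiv a b hs ht F F' hF).injective.eq_iff]

/-- The bijection of the edges of a component induced by an isomorphism. -/
def compEEquiv (c : G.Classes F) :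
    G.CompE F c ≃ G'.CompE F' (clsEquiv a b hs ht F F' hF c) :=
  b.subtypeEquiv fun e => by
    rw [hF, hs, ← clsEquiv_cls a b hs ht F F' hF, (clsEquiv a b hs ht F F' hF).injective.eq_iff]

theorem extractSymbol_rename {N : ℕ} {A : THat 𝔏 →ₐ[ℝ] R} (hA : RespectsBelow N A)
    (hA' : KillsPositive A) (hN : F.card < N) (lab : G.E → 𝔏.Label) (lab' : G'.E → 𝔏.Label)
    (hl : ∀ e, lab' (b e) = lab e) (ρ : G.Classes F → G.V) (hρ : ∀ c, G.cls F (ρ c) = c)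
    (ρ' : G'.Classes F' → G'.V) (hρ' : ∀ c, G'.cls F' (ρ' c) = c)
    (h : ∀ c, ρ' (clsEquiv a b hs ht F F' hF c) = a (ρ c)) :
    G'.extractSymbol F' A lab' ρ' hρ' = rename (Prod.map a id) (G.extractSymbol F A lab ρ hρ) := by
  unfold extractSymbol
  rw [map_prod, ← (clsEquiv a b hs ht F F' hF).prod_comp]
  refine Finset.prod_congr rfl fun c _ => ?_
  have h1 : ∀ p : MvPolynomial (G.CompV F c × Fin d) R,
      rename (Prod.map a id) (rename (G.compVar F c) p) =
      rename (G'.compVar F' _) (rename (Prod.map (compVEquiv a b hs ht F F' hF c) id) p) := by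
    intro p
    rw [rename_rename, rename_rename]
    rfl
  rw [h1]
  congr 1
  by_cases hc : Nonempty (G.CompE F c)
  · rw [compSymbol_of_nonempty _ _ _ _ _ _ hc, compSymbol_of_nonempty _ _ _ _ _ _
      (hc.map (compEEquiv a b hs ht F F' hF c)),
      ← symbol_rename hA hA' (G.compDiagram F c hc) (G'.compDiagram F' _ _)
        ((G.card_component_le F c).trans_lt hN) (compVEquiv a b hs ht F F' hF c)
        (compEEquiv a b hs ht F F' hF c) (fun e => Subtype.ext (hs e.1))
        (fun e => Subtype.ext (ht e.1)) (fun e => lab e.1) (fun e => lab' e.1) (fun e => hl e.1)]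
    · congr 1
      exact Subtype.ext (h c)
    · exact hc.map (compEEquiv a b hs ht F F' hF c)
  · rw [compSymbol_of_not_nonempty _ _ _ _ _ _ hc, compSymbol_of_not_nonempty, map_one]
    exact fun h => hc (h.map (compEEquiv a b hs ht F F' hF c).symm)

end

end DecoratedGraph

namespace VacuumDiagram

variable {Γ Γ' : VacuumDiagram 𝔏} (a : Γ.V ≃ Γ'.V) (b : Γ.E ≃ Γ'.E)
  (hs : ∀ e, Γ'.src (b e) = a (Γ.src e)) (ht : ∀ e, Γ'.tgt (b e) = a (Γ.tgt e))
  (F : Finset Γ.E) (F' : Finset Γ'.E) (hF : ∀ e, b e ∈ F' ↔ e ∈ F)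

/-- The bijection of half-edges, with directions of derivatives, induced by an isomorphism. -/
def halfEquiv : Γ.toDecoratedGraph.HalfEdge × Fin d ≃ Γ'.toDecoratedGraph.HalfEdge × Fin d :=
  (b.prodCongr (Equiv.refl Bool)).prodCongr (Equiv.refl (Fin d))

theorem deco_mapDomain_halfEquiv (l : Γ.toDecoratedGraph.HalfEdge × Fin d →₀ ℕ) (e : Γ.E)
    (c : Bool) : deco (l.mapDomain (halfEquiv b)) (b e, c) = deco l (e, c) := by
  funext i
  exact Finsupp.mapDomain_apply (halfEquiv b).injective l ((e, c), i)

include hs ht hF in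
theorem quotFun_rename {B : THat 𝔏 →ₐ[ℝ] R} (hB : ∀ N, RespectsBelow N B)
    (lab : Γ.E → 𝔏.Label) (lab' : Γ'.E → 𝔏.Label) (hl : ∀ e, lab' (b e) = lab e) (r : Γ.V)
    (l : Γ.toDecoratedGraph.HalfEdge × Fin d →₀ ℕ) (q : MvPolynomial (Γ.V × Fin d) R) :
    Γ'.quotFun F' B lab' (a r) (l.mapDomain (halfEquiv b)) (rename (Prod.map a id) q) =
      Γ.quotFun F B lab r l q := by
  let bE : Γ.QuotE F ≃ Γ'.QuotE F' := b.subtypeEquiv fun e => by rw [hF]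
  by_cases h : Nonempty (Γ.QuotE F)
  · rw [quotFun_of_nonempty _ _ _ _ _ _ h, quotFun_of_nonempty _ _ _ _ _ _ (h.map bE),
      ← nodeFun_rename (hB _) (Γ.quotDiagram F h) (Γ'.quotDiagram F' (h.map bE))
        (Nat.lt_succ_self _) (DecoratedGraph.clsEquiv a b hs ht F F' hF) bE
        (fun e => congrArg (Γ'.toDecoratedGraph.cls F') (hs e.1))
        (fun e => congrArg (Γ'.toDecoratedGraph.cls F') (ht e.1)) (Γ.quotLabel F lab l)
        (Γ'.quotLabel F' lab' (l.mapDomain (halfEquiv b))), rename_rename, rename_rename]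
    · rfl
    · intro e
      change 𝔏.shift (deco (l.mapDomain (halfEquiv b)) (b e.1, false) +
        deco (l.mapDomain (halfEquiv b)) (b e.1, true)) (lab' (b e.1)) = _
      rw [deco_mapDomain_halfEquiv, deco_mapDomain_halfEquiv, hl]
      rfl
  · rw [quotFun_of_not_nonempty _ _ _ _ _ _ h, quotFun_of_not_nonempty _ _ _ _ _ _
      (fun h' => h (h'.map bE.symm)),
      ← coeff_rename_mapDomain _ (a.injective.prodMap Function.injective_id) q 0]
    congr 1

include hs ht hF in
theorem quotVal_rename {B : THat 𝔏 →ₐ[ℝ] R} (hB : ∀ N, RespectsBelow N B)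
    (lab : Γ.E → 𝔏.Label) (lab' : Γ'.E → 𝔏.Label) (hl : ∀ e, lab' (b e) = lab e) (r : Γ.V)
    (l : Γ.toDecoratedGraph.HalfEdge × Fin d →₀ ℕ) (n : Γ.V × Fin d →₀ ℕ) :
    Γ'.quotVal F' B lab' (a r) (l.mapDomain (halfEquiv b)) (n.mapDomain (Prod.map a id)) =
      Γ.quotVal F B lab r l n := by
  unfold quotVal
  have h1 : (∀ h : Γ'.toDecoratedGraph.HalfEdge, h.1 ∈ F' →
      deco (l.mapDomain (halfEquiv b)) h = 0) ↔
      ∀ h : Γ.toDecoratedGraph.HalfEdge, h.1 ∈ F → deco l h = 0 := by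
    constructor
    · rintro h ⟨e, c⟩ he
      rw [← deco_mapDomain_halfEquiv b]
      exact h _ ((hF e).2 he)
    · rintro h ⟨e, c⟩ he
      obtain ⟨e, rfl⟩ := b.surjective e
      rw [deco_mapDomain_halfEquiv b]
      exact h _ ((hF e).1 he)
  have h2 : Γ'.toDecoratedGraph.outSize (deco (l.mapDomain (halfEquiv b))) =
      Γ.toDecoratedGraph.outSize (deco l) := by
    unfold DecoratedGraph.outSize
    rw [← b.sum_comp]
    simp only [deco_mapDomain_halfEquiv b]
  rw [h2, ← quotFun_rename a b hs ht F F' hF hB lab lab' hl, rename_monomial]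
  classical exact if_congr h1 rfl rfl

theorem term_rename {N : ℕ} {A B : THat 𝔏 →ₐ[ℝ] R} (hA : RespectsBelow N A)
    (hA' : KillsPositive A) (hN : F.card < N) (hB : ∀ N, RespectsBelow N B)
    (lab : Γ.E → 𝔏.Label) (lab' : Γ'.E → 𝔏.Label) (hl : ∀ e, lab' (b e) = lab e)
    (ρ : Γ.toDecoratedGraph.Classes F → Γ.V) (hρ : ∀ c, Γ.toDecoratedGraph.cls F (ρ c) = c)
    (ρ' : Γ'.toDecoratedGraph.Classes F' → Γ'.V)
    (hρ' : ∀ c, Γ'.toDecoratedGraph.cls F' (ρ' c) = c)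
    (h : ∀ c, ρ' (DecoratedGraph.clsEquiv a b hs ht F F' hF c) = a (ρ c)) (r : Γ.V)
    (q : MvPolynomial (Γ.V × Fin d) R) :
    Γ'.term F' A B lab' ρ' hρ' (a r) (rename (Prod.map a id) q) =
      Γ.term F A B lab ρ hρ r q := by
  unfold term pairing pullSymbol
  rw [DecoratedGraph.extractSymbol_rename a b hs ht F F' hF hA hA' hN lab lab' hl ρ hρ ρ' hρ' h]
  have h1 := pull_rename ((halfEquiv b).sumCongr (a.prodCongr (Equiv.refl (Fin d))))
    (a.prodCongr (Equiv.refl (Fin d)))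
    (Sum.elim Γ.halfVar id) (Sum.elim Γ'.halfVar id) (by
      rintro (⟨⟨e, c⟩, i⟩ | x)
      · refine Prod.ext ?_ rfl
        cases c
        · exact hs e
        · exact ht e
      · rfl) (Γ.toDecoratedGraph.extractSymbol F A lab ρ hρ)
  have h2 := opPair_rename (halfEquiv b) (a.prodCongr (Equiv.refl (Fin d)))
    (Γ.quotVal F B lab r) (Γ'.quotVal F' B lab' (a r))
    (quotVal_rename a b hs ht F F' hF hB lab lab' hl r)
    (pull (Sum.elim Γ.halfVar id) (Γ.toDecoratedGraph.extractSymbol F A lab ρ hρ)) q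
  refine Eq.trans ?_ h2
  congr 1
  exact congrArg _ h1

end VacuumDiagram

end Invariance

/-! ### The coproduct in terms of symbols -/

section Coproduct

open MvPolynomial

variable {d : ℕ} {𝔏 : LabelSystem d} {R : Type*} [CommRing R] [Algebra ℝ R]

/-- Exponents in two families of variables as pairs of decorations. -/
def pairEquiv {H L : Type*} [Fintype H] [Fintype L] :
    (H × Fin d ⊕ L × Fin d →₀ ℕ) ≃ (H → MultiIndex d) × (L → MultiIndex d) where
  toFun s := (deco (s.comapDomain Sum.inl Sum.inl_injective.injOn),
    deco (s.comapDomain Sum.inr Sum.inr_injective.injOn))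
  invFun p := Finsupp.equivFunOnFinite.symm
    (Sum.elim (fun x => p.1 x.1 x.2) fun x => p.2 x.1 x.2)
  left_inv s := by ext x; rcases x with x | x <;> rfl
  right_inv p := rfl

theorem expFact_pairEquiv {H L : Type*} [Fintype H] [Fintype L]
    (s : H × Fin d ⊕ L × Fin d →₀ ℕ) :
    expFact s = (∏ h, ((pairEquiv s).1 h).fact) * ∏ j, ((pairEquiv s).2 j).fact := by
  rw [expFact, Fintype.prod_sum_type, Fintype.prod_prod_type, Fintype.prod_prod_type]
  rfl

namespace DecoratedGraph

variable (G : DecoratedGraph 𝔏) (F : Finset G.E) {L : Type*} [Fintype L] (g : L → G.V)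

open Classical in
/-- The node decoration given by decorations of the half-edges and of further legs. -/
def legSum (p : (G.HalfEdge → MultiIndex d) × (L → MultiIndex d)) (v : G.V) : MultiIndex d :=
  G.nodeSum p.1 v + ∑ j, if g j = v then p.2 j else 0

/-- Decorations of the half-edges and legs adjacent to a subgraph. -/
def legSupport : Set ((G.HalfEdge → MultiIndex d) × (L → MultiIndex d)) :=
  {p | (∀ h, h ∉ G.boundary F → p.1 h = 0) ∧ ∀ j, g j ∉ G.verts F → p.2 j = 0}

/-- The vertices at which half-edges and legs sit, with directions of derivatives. -/
def legVar : G.HalfEdge × Fin d ⊕ L × Fin d → G.V × Fin d :=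
  Sum.elim (Prod.map G.endpoint id) (Prod.map g id)

theorem deco_mapDomain_legVar (s : G.HalfEdge × Fin d ⊕ L × Fin d →₀ ℕ) :
    deco (s.mapDomain (G.legVar g)) = G.legSum g (pairEquiv s) := by
  classical
  funext v i
  simp only [deco, Finsupp.mapDomain, Finsupp.sum_apply, Finsupp.single_apply, legSum, nodeSum,
    Pi.add_apply, Finset.sum_apply]
  rw [Finsupp.sum_fintype _ _ (by simp), Fintype.sum_sum_type, Fintype.sum_prod_type]
  rw [Fintype.sum_prod_type (f := fun x : L × Fin d => _)]
  congr 1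
  · refine Finset.sum_congr rfl fun h _ => ?_
    by_cases hv : G.endpoint h = v
    · simp [legVar, hv]; rfl
    · simp [legVar, hv]
  · refine Finset.sum_congr rfl fun h _ => ?_
    by_cases hv : g h = v
    · simp [legVar, hv]; rfl
    · simp [legVar, hv]

/-- Decorations must live on half-edges of the boundary; equivalently, they avoid the edges of `F`
and induce no node decoration outside of the vertices of `F`. -/
theorem mem_legSupport_iff (p : (G.HalfEdge → MultiIndex d) × (L → MultiIndex d)) :
    p ∈ G.legSupport F g ↔
      (∀ h : G.HalfEdge, h.1 ∈ F → p.1 h = 0) ∧ ∀ v, v ∉ G.verts F → G.legSum g p v = 0 := by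
  classical
  constructor
  · rintro ⟨h1, h2⟩
    refine ⟨fun h hh => h1 h fun hb => hb.1 hh, fun v hv => ?_⟩
    unfold legSum nodeSum
    rw [Finset.sum_eq_zero, Finset.sum_eq_zero, add_zero]
    · intro j _
      split_ifs with hj
      · exact h2 j (by rwa [hj])
      · rfl
    · intro h _
      split_ifs with hj
      · refine h1 h fun hb => hv (by rw [← hj]; exact hb.2)
      · rfl
  · rintro ⟨h1, h2⟩
    have h3 : ∀ v, v ∉ G.verts F → (∀ h, G.endpoint h = v → p.1 h = 0) ∧
        ∀ j, g j = v → p.2 j = 0 := by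
      intro v hv
      have h4 := h2 v hv
      unfold legSum nodeSum at h4
      have h5 : ∀ i, (∑ h, (if G.endpoint h = v then p.1 h else 0) : MultiIndex d) i +
          (∑ j, (if g j = v then p.2 j else 0) : MultiIndex d) i = 0 := fun i => congrFun h4 i
      constructor
      · intro h hh
        funext i
        have h6 := (Nat.add_eq_zero_iff.1 (h5 i)).1
        rw [Finset.sum_apply, Finset.sum_eq_zero_iff] at h6
        simpa [hh] using h6 h (Finset.mem_univ _)
      · intro j hj
        funext i
        have h6 := (Nat.add_eq_zero_iff.1 (h5 i)).2
        rw [Finset.sum_apply, Finset.sum_eq_zero_iff] at h6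
        simpa [hj] using h6 j (Finset.mem_univ _)
    refine ⟨fun h hb => ?_, fun j hj => (h3 _ hj).2 j rfl⟩
    by_cases hh : h.1 ∈ F
    · exact h1 h hh
    · exact (h3 (G.endpoint h) fun hv => hb ⟨hh, hv⟩).1 h rfl

section

variable {A : THat 𝔏 →ₐ[ℝ] R} (hA : KillsPositive A) (ρ : G.Classes F → G.V)
  (hρ : ∀ c, G.cls F (ρ c) = c)

include hA in
open Classical in
/-- The coefficients of the pulled back symbol are the first factors in the coproduct. -/
theorem expFact_mul_coeff_pull_extractSymbol (s : G.HalfEdge × Fin d ⊕ L × Fin d →₀ ℕ) :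
    (expFact s : R) * coeff s (pull (G.legVar g) (G.extractSymbol F A G.label ρ hρ)) =
      if ∀ v, v ∉ G.verts F → G.legSum g (pairEquiv s) v = 0 then
        A (G.extract F ρ hρ (G.legSum g (pairEquiv s))) else 0 := by
  rw [expFact_mul_coeff_pull, G.expFact_mul_coeff_extractSymbol F hA, deco_mapDomain_legVar]

include hA in
/-- Only finitely many decorations of the boundary of a subgraph contribute, so that the `finsum`s in
the coproduct are honest sums. -/
theorem finite_extract_ne_zero :
    (G.legSupport F g ∩ {p | A (G.extract F ρ hρ (G.legSum g p)) ≠ 0}).Finite := by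
  refine ((pull (G.legVar g) (G.extractSymbol F A G.label ρ hρ)).support.finite_toSet.image
    pairEquiv).subset ?_
  rintro p ⟨hp, hp'⟩
  refine ⟨pairEquiv.symm p, ?_, Equiv.apply_symm_apply _ _⟩
  rw [Finset.mem_coe, mem_support_iff]
  intro h0
  have := G.expFact_mul_coeff_pull_extractSymbol F g hA ρ hρ (pairEquiv.symm p)
  rw [h0, mul_zero, Equiv.apply_symm_apply, if_pos ((G.mem_legSupport_iff F g p).1 hp).2] at this
  exact hp' this.symm

include hA in
open Classical in
/-- The sum over all decorations of the boundary of a subgraph as a functional of its symbol. -/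
theorem finsum_extract_mul (f : (G.HalfEdge → MultiIndex d) × (L → MultiIndex d) → R) :
    ∑ᶠ p ∈ G.legSupport F g,
      ((∏ h, ((p.1 h).fact : ℝ)) * ∏ j, ((p.2 j).fact : ℝ))⁻¹ •
        (A (G.extract F ρ hρ (G.legSum g p)) * f p) =
    monoFun (fun s => if ∀ h : G.HalfEdge, h.1 ∈ F → (pairEquiv s).1 h = 0 then f (pairEquiv s)
      else 0) (pull (G.legVar g) (G.extractSymbol F A G.label ρ hρ)) := by
  have key : ∀ s : G.HalfEdge × Fin d ⊕ L × Fin d →₀ ℕ, (G.legSupport F g).indicator (fun p =>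
      ((∏ h, ((p.1 h).fact : ℝ)) * ∏ j, ((p.2 j).fact : ℝ))⁻¹ •
        (A (G.extract F ρ hρ (G.legSum g p)) * f p)) (pairEquiv s) =
      coeff s (pull (G.legVar g) (G.extractSymbol F A G.label ρ hρ)) *
        if ∀ h : G.HalfEdge, h.1 ∈ F → (pairEquiv s).1 h = 0 then f (pairEquiv s) else 0 := by
    intro s
    have h1 := G.expFact_mul_coeff_pull_extractSymbol F g hA ρ hρ s
    have h2 : (∏ h, (((pairEquiv s).1 h).fact : ℝ)) * ∏ j, (((pairEquiv s).2 j).fact : ℝ) =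
        (expFact s : ℝ) := by
      rw [expFact_pairEquiv]; push_cast; rfl
    rw [Set.indicator_apply, mem_legSupport_iff]
    split_ifs with h3 h4 h4
    · rw [if_pos h3.2] at h1
      rw [← h1, h2, ← nsmul_eq_mul, ← Nat.cast_smul_eq_nsmul ℝ, smul_mul_assoc, smul_smul,
        inv_mul_cancel₀ (Nat.cast_ne_zero.2 (expFact_ne_zero s)), one_smul]
    · exact absurd h3.1 h4
    · rw [if_neg fun h5 => h3 ⟨h4, h5⟩] at h1
      rw [natCast_mul_cancel (expFact_ne_zero s) (h1.trans (mul_zero _).symm), zero_mul]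
    · rw [mul_zero]
  rw [finsum_mem_def, ← finsum_comp_equiv pairEquiv, finsum_congr key, monoFun_eq_sum,
    finsum_eq_sum_of_support_subset]
  intro s hs
  rw [Finset.mem_coe, mem_support_iff]
  intro h
  exact hs (by simp only [h, zero_mul])

end

end DecoratedGraph

namespace VacuumDiagram

variable (Γ : VacuumDiagram 𝔏) (F : Finset Γ.E)

/-- The convolution of two characters as a sum of terms over all subgraphs. The binomial coefficients
and the factorials of node decorations in the coproduct combine to the falling factorials that come
from differentiating the monomial of the node decoration. -/
theorem map_coproduct (α : HMinus 𝔏 →ₐ[ℝ] R) (β : HHat 𝔏 →ₐ[ℝ] R) :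
    LinearMap.mul' ℝ R (TensorProduct.map α.toLinearMap β.toLinearMap Γ.coproduct) =
      ∑ F, Γ.term F (α.comp toHMinus) (β.comp toHHat) Γ.label (Γ.rootChoice F)
        (Γ.cls_rootChoice F) Γ.root (monomial (expo Γ.node) 1) := by
  classical
  unfold coproduct
  rw [map_sum, map_sum]
  refine Finset.sum_congr rfl fun F _ => ?_
  set φ : HMinus 𝔏 ⊗[ℝ] HHat 𝔏 →ₗ[ℝ] R :=
    (LinearMap.mul' ℝ R).comp (TensorProduct.map α.toLinearMap β.toLinearMap) with hφ
  have hsum : ∀ p : (Γ.toDecoratedGraph.HalfEdge → MultiIndex d) × (Γ.V → MultiIndex d),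
      p.2 + Γ.toDecoratedGraph.nodeSum p.1 = Γ.toDecoratedGraph.legSum id p := by
    intro p
    funext v
    rw [DecoratedGraph.legSum, Pi.add_apply, add_comm]
    simp
  have hK : KillsPositive (α.comp (toHMinus (𝔏 := 𝔏))) := killsPositive_toHMinus.comp α
  have h1 := Γ.toDecoratedGraph.finsum_extract_mul F id hK (Γ.rootChoice F) (Γ.cls_rootChoice F)
    (fun p => ((∏ v, ∏ i, (Γ.node v i).descFactorial (p.2 v i) : ℕ) : R) *
      ((-1) ^ Γ.toDecoratedGraph.outSize p.1 *
        β (toHHat (Γ.quotientBy F p.1 (Γ.node - p.2)))))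
  have h2 : Γ.toDecoratedGraph.legVar id = Sum.elim Γ.halfVar (id : Γ.V × Fin d → Γ.V × Fin d) :=
    rfl
  have h3 : ∀ P, monoFun (fun s => if ∀ h : Γ.toDecoratedGraph.HalfEdge, h.1 ∈ F →
        (pairEquiv s).1 h = 0 then
        ((∏ v, ∏ i, (Γ.node v i).descFactorial ((pairEquiv s).2 v i) : ℕ) : R) *
      ((-1) ^ Γ.toDecoratedGraph.outSize (pairEquiv s).1 *
        β (toHHat (Γ.quotientBy F (pairEquiv s).1 (Γ.node - (pairEquiv s).2)))) else 0) P =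
      opPair (Γ.quotVal F (β.comp toHHat) Γ.label Γ.root) P (monomial (expo Γ.node) 1) := by
    intro P
    refine congrArg (fun f : MvPolynomial _ R →ₗ[R] R => f P) (linearMap_ext_monomial
      (g := (opPair (Γ.quotVal F (β.comp toHHat) Γ.label Γ.root)).flip
        (monomial (expo Γ.node) 1)) fun s => ?_)
    rw [monoFun_monomial, LinearMap.flip_apply, opPair_monomial, one_mul, one_mul, one_mul,
      Fintype.prod_prod_type, quotVal]
    have h4 := Γ.map_quotientBy F (β.comp toHHat)
      (s.comapDomain Sum.inl Sum.inl_injective.injOn) (Γ.node - (pairEquiv s).2)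
    have h5 : expo (Γ.node - (pairEquiv s).2) =
        expo Γ.node - s.comapDomain Sum.inr Sum.inr_injective.injOn := by
      ext x; simp; rfl
    rw [h5] at h4
    rw [← h4, mul_ite, mul_zero]
    rfl
  rw [h2, h3] at h1
  refine Eq.trans ?_ h1
  change φ _ = _
  rw [show φ (∑ᶠ p ∈ _, _) = _ from AddMonoidHom.map_finsum_mem' φ.toAddMonoidHom ?_]
  · refine finsum_congr fun p => finsum_congr_Prop ?_ fun hp => ?_
    · rfl
    · rw [show ∀ x, φ.toAddMonoidHom x = φ x from fun _ => rfl, map_smul, hsum]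
      change _ • (α _ * β _) = _
      have h6 : ∏ v, ((Γ.node v).binom (p.2 v) : ℝ) = (∏ v, ((p.2 v).fact : ℝ))⁻¹ *
          ((∏ v, ∏ i, (Γ.node v i).descFactorial (p.2 v i) : ℕ) : ℝ) := by
        rw [eq_inv_mul_iff_mul_eq₀, ← Finset.prod_mul_distrib, Nat.cast_prod]
        · refine Finset.prod_congr rfl fun v _ => ?_
          rw [← Nat.cast_mul]
          congr 1
          unfold MultiIndex.fact MultiIndex.binom
          rw [← Finset.prod_mul_distrib]
          exact Finset.prod_congr rfl fun i _ => (Nat.descFactorial_eq_factorial_mul_choose _ _).symm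
        · refine Finset.prod_ne_zero_iff.2 fun v _ => Nat.cast_ne_zero.2 ?_
          exact Finset.prod_ne_zero_iff.2 fun i _ => Nat.factorial_ne_zero _
      have h7 : ((-1 : ℝ) ^ Γ.toDecoratedGraph.outSize p.1 / (∏ h, ((p.1 h).fact : ℝ)) *
          ∏ v, ((Γ.node v).binom (p.2 v) : ℝ)) =
          ((∏ h, ((p.1 h).fact : ℝ)) * ∏ j, ((p.2 j).fact : ℝ))⁻¹ *
          (((∏ v, ∏ i, (Γ.node v i).descFactorial (p.2 v i) : ℕ) : ℝ) *
            (-1 : ℝ) ^ Γ.toDecoratedGraph.outSize p.1) := by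
        rw [h6, mul_inv]; ring
      rw [h7, mul_smul]
      congr 1
      rw [Algebra.smul_def]
      simp only [map_mul, map_pow, map_neg, map_one, map_natCast, AlgHom.comp_apply]
      ring
  · refine (Γ.toDecoratedGraph.finite_extract_ne_zero F id killsPositive_toHMinus (Γ.rootChoice F)
      (Γ.cls_rootChoice F)).subset ?_
    rintro p ⟨hp, hp'⟩
    refine ⟨hp, fun h => hp' ?_⟩
    simp only [hsum, h, TensorProduct.zero_tmul, smul_zero]

/-- If all edges are contracted, then derivatives can only act on the node decoration. -/
theorem pairing_univ (B : THat 𝔏 →ₐ[ℝ] R) (lab : Γ.E → 𝔏.Label) (r : Γ.V)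
    (p q : MvPolynomial (Γ.V × Fin d) R) :
    Γ.pairing Finset.univ B lab r p q = apolar p q := by
  classical
  induction p using MvPolynomial.induction_on generalizing lab q with
  | C a =>
    have h : ¬ Nonempty (Γ.QuotE Finset.univ) := fun ⟨e⟩ => e.2 (Finset.mem_univ _)
    rw [pairing, pullSymbol, pull_C, opPair_C, monoFun_quotVal,
      if_pos (show ∀ h : Γ.toDecoratedGraph.HalfEdge, h.1 ∈ Finset.univ →
        deco (0 : Γ.toDecoratedGraph.HalfEdge × Fin d →₀ ℕ) h = 0 from fun _ _ => rfl), quotFun_of_not_nonempty _ _ _ _ _ _ h,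
      apolar_comm, apolar_C]
    have : Γ.toDecoratedGraph.outSize (deco (0 : Γ.toDecoratedGraph.HalfEdge × Fin d →₀ ℕ)) = 0 := by
      simp [DecoratedGraph.outSize, MultiIndex.size, deco]
    rw [this, pow_zero, one_mul]
  | add p p' h h' => rw [pairing_add_left, apolar_add, h, h']
  | mul_X p x h =>
    rw [mul_comm, pairing_X_mul, apolar_X_mul_left, h]
    simp

theorem verts_univ : Γ.toDecoratedGraph.verts Finset.univ = Set.univ := by
  refine Set.eq_univ_of_forall fun v => ?_
  obtain ⟨e⟩ := Γ.nonempty_edge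
  by_cases h : v = Γ.src e
  · exact ⟨e, Finset.mem_univ _, Or.inl h.symm⟩
  · refine Γ.toDecoratedGraph.mem_verts_of_cls_eq (v := Γ.src e) ?_ h
    refine Quotient.sound (s := Γ.toDecoratedGraph.subSetoid Finset.univ) ?_
    refine Relation.EqvGen.mono (fun a b hab => ?_) _ _ (Γ.connected.2 v (Γ.src e))
    obtain ⟨e, he⟩ := hab
    exact ⟨e, Finset.mem_univ _, he⟩

theorem cls_univ_eq (u v : Γ.V) : Γ.toDecoratedGraph.cls Finset.univ u =
    Γ.toDecoratedGraph.cls Finset.univ v := by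
  refine Quotient.sound (s := Γ.toDecoratedGraph.subSetoid Finset.univ) ?_
  refine Relation.EqvGen.mono (fun a b hab => ?_) _ _ (Γ.connected.2 u v)
  obtain ⟨e, he⟩ := hab
  exact ⟨e, Finset.mem_univ _, he⟩

/-- The term of the full subgraph is the diagram itself. -/
theorem term_univ {A : THat 𝔏 →ₐ[ℝ] R} (hA : ∀ N, RespectsBelow N A) (hA' : KillsPositive A)
    (B : THat 𝔏 →ₐ[ℝ] R) : Γ.term Finset.univ A B Γ.label (Γ.rootChoice Finset.univ)
      (Γ.cls_rootChoice Finset.univ) Γ.root (monomial (expo Γ.node) 1) = A (gen Γ) := by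
  classical
  set c := Γ.toDecoratedGraph.cls Finset.univ Γ.root with hc
  rw [term, pairing_univ, apolar_monomial, one_mul,
    Γ.toDecoratedGraph.expFact_mul_coeff_extractSymbol Finset.univ hA', deco_expo, if_pos]
  · rw [Γ.toDecoratedGraph.map_extract, Finset.prod_eq_single c, dif_pos]
    · refine ((hA _).iso Γ _ (Nat.lt_succ_self _) ⟨?_, ?_, ?_⟩).symm
      · exact (Equiv.subtypeUnivEquiv fun v => Γ.cls_univ_eq v Γ.root).symm
      · exact (Equiv.subtypeUnivEquiv fun e => ⟨Finset.mem_univ _, Γ.cls_univ_eq _ Γ.root⟩).symm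
      · refine ⟨fun e => rfl, fun e => rfl, fun e => rfl, ?_, fun v => rfl⟩
        exact Subtype.ext (if_pos rfl)
    · obtain ⟨e⟩ := Γ.nonempty_edge
      exact ⟨⟨e, Finset.mem_univ _, Γ.cls_univ_eq _ Γ.root⟩⟩
    · intro c' _ hc'
      obtain ⟨v, rfl⟩ := Quotient.exists_rep c'
      exact absurd (Γ.cls_univ_eq v Γ.root) hc'
    · simp
  · intro v hv
    rw [verts_univ] at hv
    exact absurd (Set.mem_univ v) hv

end VacuumDiagram

/-! ### Dependence on the functional -/

/-- The two functionals agree on diagrams with less than `N` edges. -/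
def AgreeBelow (N : ℕ) (A A' : THat 𝔏 →ₐ[ℝ] R) : Prop :=
  ∀ Γ : VacuumDiagram 𝔏, Nat.card Γ.E < N → A (gen Γ) = A' (gen Γ)

theorem AgreeBelow.nodeFun_eq {N : ℕ} {A A' : THat 𝔏 →ₐ[ℝ] R} (h : AgreeBelow N A A')
    (Γ : VacuumDiagram 𝔏) (hΓ : Nat.card Γ.E < N) (lab : Γ.E → 𝔏.Label) (r : Γ.V) :
    nodeFun A Γ lab r = nodeFun A' Γ lab r := by
  unfold nodeFun
  congr 1
  funext s
  exact h (Γ.vary lab r (deco s)) hΓ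

theorem AgreeBelow.respectsBelow {N : ℕ} {A A' : THat 𝔏 →ₐ[ℝ] R} (h : AgreeBelow N A A')
    (hA : RespectsBelow N A) : RespectsBelow N A' where
  iso Γ Γ' hΓ hi := by
    have hΓ' : Nat.card Γ'.E < N := by
      obtain ⟨a, b, -⟩ := hi
      rwa [← Nat.card_congr b]
    rw [← h Γ hΓ, ← h Γ' hΓ', hA.iso Γ Γ' hΓ hi]
  ibp Γ v i hΓ hv := by
    have := hA.ibp Γ v i hΓ hv
    rw [map_ibpRelation] at this ⊢
    simpa only [h.nodeFun_eq Γ hΓ] using this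
  move Γ v hΓ := by
    have := hA.move Γ v hΓ
    rw [map_moveRelation] at this ⊢
    simpa only [h.nodeFun_eq Γ hΓ] using this

theorem AgreeBelow.symbol_eq {N : ℕ} {A A' : THat 𝔏 →ₐ[ℝ] R} (h : AgreeBelow N A A')
    (Γ : VacuumDiagram 𝔏) (hΓ : Nat.card Γ.E < N) (lab : Γ.E → 𝔏.Label) (r : Γ.V) :
    symbol A Γ lab r = symbol A' Γ lab r := by
  unfold symbol
  congr 1
  funext s
  exact h (Γ.vary lab r (deco s)) hΓ

theorem AgreeBelow.term_eq {N : ℕ} {A A' : THat 𝔏 →ₐ[ℝ] R} (h : AgreeBelow N A A')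
    (Γ : VacuumDiagram 𝔏) (F : Finset Γ.E) (hF : F.card < N) (B : THat 𝔏 →ₐ[ℝ] R) :
    Γ.term F A B = Γ.term F A' B := by
  funext lab ρ hρ r q
  unfold VacuumDiagram.term DecoratedGraph.extractSymbol
  congr 1
  refine Finset.prod_congr rfl fun c _ => ?_
  congr 1
  by_cases hc : Nonempty (Γ.toDecoratedGraph.CompE F c)
  · rw [DecoratedGraph.compSymbol_of_nonempty _ _ _ _ _ _ hc,
      DecoratedGraph.compSymbol_of_nonempty _ _ _ _ _ _ hc]
    exact h.symbol_eq (Γ.toDecoratedGraph.compDiagram F c hc)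
      ((Γ.toDecoratedGraph.card_component_le F c).trans_lt hF) _ _
  · rw [DecoratedGraph.compSymbol_of_not_nonempty _ _ _ _ _ _ hc,
      DecoratedGraph.compSymbol_of_not_nonempty _ _ _ _ _ _ hc]

end Coproduct

/-! ### The twisted antipode -/

section Antipode

open MvPolynomial

variable {d : ℕ} {𝔏 : LabelSystem d} {R : Type*} [CommRing R] [Algebra ℝ R]

namespace VacuumDiagram

/-- The degree depends on the node decoration only through the size of its exponent. -/
theorem degree_vary (Γ : VacuumDiagram 𝔏) (lab : Γ.E → 𝔏.Label) (r : Γ.V)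
    (s : Γ.V × Fin d →₀ ℕ) : (Γ.vary lab r (deco s)).degree =
      ∑ e, 𝔏.deg (lab e) + (d : ℝ) * ((Fintype.card Γ.V : ℝ) - 1) + ((Finsupp.degree s : ℕ) : ℝ) := by
  have h : (Γ.vary lab r (deco s)).degree = ∑ e, 𝔏.deg (lab e) +
      (d : ℝ) * ((Fintype.card Γ.V : ℝ) - 1) + ∑ v : Γ.V, ((deco s v).size : ℝ) := rfl
  rw [h, Finsupp.degree_eq_sum, Fintype.sum_prod_type]
  push_cast [MultiIndex.size]
  rfl

/-- Differentiating a kernel lowers the degree by one. -/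
theorem sum_deg_bump (Γ : VacuumDiagram 𝔏) (lab : Γ.E → 𝔏.Label) (e : Γ.E) (i : Fin d) :
    ∑ e', 𝔏.deg (bump lab e i e') = ∑ e', 𝔏.deg (lab e') - 1 := by
  classical
  rw [← Finset.add_sum_erase _ _ (Finset.mem_univ e),
    ← Finset.add_sum_erase Finset.univ (fun e' => 𝔏.deg (lab e')) (Finset.mem_univ e), bump_self,
    𝔏.deg_shift, Finset.sum_congr rfl fun e' he' => by
      rw [bump_of_ne lab (Finset.ne_of_mem_erase he')]]
  have : (MultiIndex.unit i).size = 1 := by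
    simp [MultiIndex.size, MultiIndex.unit]
  rw [this]
  push_cast
  ring

theorem degree_iso {Γ Γ' : VacuumDiagram 𝔏} (h : Γ.Iso Γ') : Γ.degree = Γ'.degree := by
  obtain ⟨a, b, -, -, hl, -, hn⟩ := h
  unfold degree DecoratedGraph.deg
  rw [← b.sum_comp, ← a.sum_comp, Fintype.card_congr a]
  simp only [hl, hn]

variable (Γ : VacuumDiagram 𝔏)

open Classical in
/-- Distinguished vertices of the components of a subgraph, the one on the class of `r` being `r`. -/
def rootAt (r : Γ.V) (F : Finset Γ.E) (c : Γ.toDecoratedGraph.Classes F) : Γ.V :=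
  if Γ.toDecoratedGraph.cls F r = c then r else c.out

theorem cls_rootAt (r : Γ.V) (F : Finset Γ.E) (c : Γ.toDecoratedGraph.Classes F) :
    Γ.toDecoratedGraph.cls F (Γ.rootAt r F c) = c := by
  unfold rootAt
  split_ifs with h
  · exact h
  · exact Quotient.out_eq c

theorem rootAt_cls (r : Γ.V) (F : Finset Γ.E) :
    Γ.rootAt r F (Γ.toDecoratedGraph.cls F r) = r := if_pos rfl

open Classical in
/-- Minus the sum of the terms of all proper subgraphs. -/
def properSum (A B : THat 𝔏 →ₐ[ℝ] R) (lab : Γ.E → 𝔏.Label) (r : Γ.V) :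
    MvPolynomial (Γ.V × Fin d) R →ₗ[R] R :=
  -∑ F ∈ Finset.univ.erase Finset.univ, opPair (Γ.quotVal F B lab r)
    (Γ.pullSymbol (Γ.toDecoratedGraph.extractSymbol F A lab (Γ.rootAt r F) (Γ.cls_rootAt r F)))

open Classical in
theorem properSum_apply (A B : THat 𝔏 →ₐ[ℝ] R) (lab : Γ.E → 𝔏.Label) (r : Γ.V)
    (q : MvPolynomial (Γ.V × Fin d) R) : Γ.properSum A B lab r q =
      -∑ F ∈ Finset.univ.erase Finset.univ,
        Γ.term F A B lab (Γ.rootAt r F) (Γ.cls_rootAt r F) r q := by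
  rw [properSum, LinearMap.neg_apply, LinearMap.sum_apply]
  rfl

theorem card_lt_of_ne_univ {N : ℕ} (hN : Nat.card Γ.E < N + 1) {F : Finset Γ.E}
    (hF : F ≠ Finset.univ) : F.card < N := by
  have := (Finset.card_lt_iff_ne_univ F).2 hF
  rw [Nat.card_eq_fintype_card] at hN
  omega

section

variable {N : ℕ} {A B : THat 𝔏 →ₐ[ℝ] R} (hA : RespectsBelow N A) (hA' : KillsPositive A)
  (hB : ∀ N, RespectsBelow N B) (hN : Nat.card Γ.E < N + 1)

include hA hA' hB hN in
open Classical in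
theorem properSum_ibp (lab : Γ.E → 𝔏.Label) (r v : Γ.V) (hv : v ≠ r) (i : Fin d)
    (q : MvPolynomial (Γ.V × Fin d) R) :
    ∑ e, ((if Γ.tgt e = v then Γ.properSum A B (bump lab e i) r q else 0) -
        (if Γ.src e = v then Γ.properSum A B (bump lab e i) r q else 0)) +
      Γ.properSum A B lab r (pderiv (v, i) q) = 0 := by
  have h1 : ∑ F ∈ Finset.univ.erase Finset.univ, (∑ e,
      ((if Γ.tgt e = v then Γ.term F A B (bump lab e i) (Γ.rootAt r F) (Γ.cls_rootAt r F) r q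
          else 0) -
        (if Γ.src e = v then Γ.term F A B (bump lab e i) (Γ.rootAt r F) (Γ.cls_rootAt r F) r q
          else 0)) +
      Γ.term F A B lab (Γ.rootAt r F) (Γ.cls_rootAt r F) r (pderiv (v, i) q)) = 0 :=
    Finset.sum_eq_zero fun F hF => Γ.term_ibp F hA hA'
      (Γ.card_lt_of_ne_univ hN (Finset.ne_of_mem_erase hF)) hB lab _ _ r (Γ.rootAt_cls r F) v hv i q
  rw [Finset.sum_add_distrib, Finset.sum_comm] at h1
  refine neg_eq_zero.1 (Eq.trans ?_ h1)
  rw [neg_add, properSum_apply, neg_neg, ← Finset.sum_neg_distrib]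
  congr 1
  refine Finset.sum_congr rfl fun e _ => ?_
  rw [properSum_apply, Finset.sum_sub_distrib]
  split_ifs <;> simp only [Finset.sum_const_zero, sub_zero, sub_self, zero_sub, neg_neg, neg_zero]

include hA hA' hB hN in
theorem properSum_move (lab : Γ.E → 𝔏.Label) (r v : Γ.V) (q : MvPolynomial (Γ.V × Fin d) R) :
    Γ.properSum A B lab r q = Γ.properSum A B lab v (recenter r q) := by
  classical
  rw [properSum_apply, properSum_apply]
  refine congrArg Neg.neg (Finset.sum_congr rfl fun F hF => ?_)
  exact Γ.term_move F hA hA' (Γ.card_lt_of_ne_univ hN (Finset.ne_of_mem_erase hF)) hB lab _ _ _ _ r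
    (Γ.rootAt_cls r F) v q

include hA hA' hB in
theorem term_rootAt_rename (Γ' : VacuumDiagram 𝔏) (a : Γ.V ≃ Γ'.V) (b : Γ.E ≃ Γ'.E)
    (hs : ∀ e, Γ'.src (b e) = a (Γ.src e)) (ht : ∀ e, Γ'.tgt (b e) = a (Γ.tgt e))
    (F : Finset Γ.E) (F' : Finset Γ'.E) (hF : ∀ e, b e ∈ F' ↔ e ∈ F) (hN : F.card < N)
    (hN' : F'.card < N)
    (lab : Γ.E → 𝔏.Label) (lab' : Γ'.E → 𝔏.Label) (hl : ∀ e, lab' (b e) = lab e) (r : Γ.V)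
    (q : MvPolynomial (Γ.V × Fin d) R) :
    Γ'.term F' A B lab' (Γ'.rootAt (a r) F') (Γ'.cls_rootAt (a r) F') (a r)
      (rename (Prod.map a id) q) =
    Γ.term F A B lab (Γ.rootAt r F) (Γ.cls_rootAt r F) r q := by
  obtain ⟨κ, hκ⟩ : ∃ κ, κ = DecoratedGraph.clsEquiv a b hs ht F F' hF := ⟨_, rfl⟩
  have hκ' : ∀ v, κ (Γ.toDecoratedGraph.cls F v) = Γ'.toDecoratedGraph.cls F' (a v) := by
    rw [hκ]; exact fun v => rfl
  have hρ' : ∀ c, Γ'.toDecoratedGraph.cls F' (a (Γ.rootAt r F (κ.symm c))) = c := by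
    intro c
    rw [← hκ', Γ.cls_rootAt, κ.apply_symm_apply]
  rw [← term_rename a b hs ht F F' hF hA hA' hN hB lab lab' hl (Γ.rootAt r F) (Γ.cls_rootAt r F)
    (fun c => a (Γ.rootAt r F (κ.symm c))) hρ' (fun c => by
      rw [← hκ, κ.symm_apply_apply]) r q]
  refine Γ'.term_eq_term _ hA hA' hN' hB lab' _ _ _ _ _ _ (Or.inr ?_)
  rw [← hκ', κ.symm_apply_apply, hκ', rootAt_cls, rootAt_cls]

include hA hA' hB hN in
theorem properSum_rename (Γ' : VacuumDiagram 𝔏) (a : Γ.V ≃ Γ'.V) (b : Γ.E ≃ Γ'.E)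
    (hs : ∀ e, Γ'.src (b e) = a (Γ.src e)) (ht : ∀ e, Γ'.tgt (b e) = a (Γ.tgt e))
    (lab : Γ.E → 𝔏.Label) (lab' : Γ'.E → 𝔏.Label) (hl : ∀ e, lab' (b e) = lab e) (r : Γ.V)
    (q : MvPolynomial (Γ.V × Fin d) R) :
    Γ'.properSum A B lab' (a r) (rename (Prod.map a id) q) = Γ.properSum A B lab r q := by
  classical
  rw [properSum_apply, properSum_apply]
  refine congrArg Neg.neg (Eq.symm ?_)
  refine Finset.sum_equiv (Equiv.finsetCongr b) (fun F => ?_) fun F hF => ?_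
  · rw [Finset.mem_erase, Finset.mem_erase, Equiv.finsetCongr_apply, ← Finset.map_univ_equiv b]
    simp only [Finset.mem_univ, and_true, ne_eq, Finset.map_inj]
  · have hN' : F.card < N := Γ.card_lt_of_ne_univ hN (Finset.ne_of_mem_erase hF)
    exact (Γ.term_rootAt_rename hA hA' hB Γ' a b hs ht F _ (fun e => by simp) hN'
      (by simpa using hN') lab lab' hl r q).symm

end

end VacuumDiagram

open Classical in
/-- One step of the recursion that defines the twisted antipode: the values of the subgraphs are given
by `A`, those of the contractions by `B`. Diagrams of positive degree are sent to zero. -/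
def antipodeStep (B A : THat 𝔏 →ₐ[ℝ] R) : THat 𝔏 →ₐ[ℝ] R :=
  aeval fun Γ : VacuumDiagram 𝔏 => if 0 < Γ.degree then 0 else
    Γ.properSum A B Γ.label Γ.root (monomial (expo Γ.node) 1)

open Classical in
theorem antipodeStep_gen (B A : THat 𝔏 →ₐ[ℝ] R) (Γ : VacuumDiagram 𝔏) :
    antipodeStep B A (gen Γ) = if 0 < Γ.degree then 0 else
      Γ.properSum A B Γ.label Γ.root (monomial (expo Γ.node) 1) := aeval_X _ _

theorem killsPositive_antipodeStep (B A : THat 𝔏 →ₐ[ℝ] R) : KillsPositive (antipodeStep B A) :=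
  fun Γ h => by rw [antipodeStep_gen, if_pos h]

/-- A step of the recursion only uses diagrams with fewer edges, since it involves proper subgraphs
only. -/
theorem agreeBelow_antipodeStep {N : ℕ} {A A' : THat 𝔏 →ₐ[ℝ] R} (B : THat 𝔏 →ₐ[ℝ] R)
    (h : AgreeBelow N A A') : AgreeBelow (N + 1) (antipodeStep B A) (antipodeStep B A') := by
  classical
  intro Γ hΓ
  rw [antipodeStep_gen, antipodeStep_gen, VacuumDiagram.properSum_apply,
    VacuumDiagram.properSum_apply]
  congr 2
  refine Finset.sum_congr rfl fun F hF => ?_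
  rw [h.term_eq Γ F (Γ.card_lt_of_ne_univ hΓ (Finset.ne_of_mem_erase hF))]

open Classical in
/-- All monomials of a homogeneous polynomial lead to diagrams of the same degree, so that setting
diagrams of positive degree to zero is compatible with relations between homogeneous polynomials. -/
theorem nodeFun_antipodeStep (B A : THat 𝔏 →ₐ[ℝ] R) (Γ : VacuumDiagram 𝔏)
    (lab : Γ.E → 𝔏.Label) (r : Γ.V) (q : MvPolynomial (Γ.V × Fin d) R) (D : ℕ)
    (hq : q.IsHomogeneous D) : nodeFun (antipodeStep B A) Γ lab r q =
      if 0 < ∑ e, 𝔏.deg (lab e) + (d : ℝ) * ((Fintype.card Γ.V : ℝ) - 1) + D then 0 else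
        Γ.properSum A B lab r q := by
  have h1 : ∀ s ∈ q.support, antipodeStep B A (gen (Γ.vary lab r (deco s))) =
      if 0 < ∑ e, 𝔏.deg (lab e) + (d : ℝ) * ((Fintype.card Γ.V : ℝ) - 1) + D then 0 else
        Γ.properSum A B lab r (monomial s 1) := by
    intro s hs
    rw [antipodeStep_gen, Γ.degree_vary lab r s]
    have h2 : Finsupp.degree s = D := by
      rw [Finsupp.degree_eq_weight_one]; exact hq (mem_support_iff.1 hs)
    rw [h2]
    have h3 : expo (deco s) = s := expo_deco s
    conv_rhs => rw [← h3]
    rfl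
  rw [nodeFun, monoFun_eq_sum, Finset.sum_congr rfl fun s hs => by rw [h1 s hs]]
  split_ifs
  · simp
  · conv_rhs => rw [← monoFun_eq (Γ.properSum A B lab r), monoFun_eq_sum]

/-- A step of the recursion extends the relations to diagrams with one more edge. All terms of a relation
are of the same degree, so either all of them vanish or the relation holds for the sum over proper
subgraphs. -/
theorem respectsBelow_antipodeStep {N : ℕ} {A B : THat 𝔏 →ₐ[ℝ] R} (hA : RespectsBelow N A)
    (hA' : KillsPositive A) (hB : ∀ N, RespectsBelow N B) :
    RespectsBelow (N + 1) (antipodeStep B A) where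
  iso Γ Γ' hΓ h := by
    rw [antipodeStep_gen, antipodeStep_gen, VacuumDiagram.degree_iso h]
    congr 1
    obtain ⟨a, b, hs, ht, hl, hr, hn⟩ := h
    have := Γ.properSum_rename hA hA' hB hΓ Γ' a b hs ht Γ.label Γ'.label hl Γ.root
      (monomial (expo Γ.node) 1)
    have h1 : (expo Γ.node).mapDomain (Prod.map a id) = expo Γ'.node := by
      ext x
      obtain ⟨v, i⟩ := x
      obtain ⟨v, rfl⟩ := a.surjective v
      refine (Finsupp.mapDomain_apply (a.injective.prodMap Function.injective_id)
        (expo Γ.node) (v, i)).trans ?_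
      rw [expo_apply, expo_apply, hn]
    rw [← this, hr, rename_monomial, h1]
  ibp Γ v i hΓ hv := by
    classical
    have hhom : (monomial (expo Γ.node) (1 : R)).IsHomogeneous (Finsupp.degree (expo Γ.node)) :=
      isHomogeneous_monomial _ rfl
    rw [map_ibpRelation]
    have h1 := Γ.properSum_ibp hA hA' hB hΓ Γ.label Γ.root v hv i (monomial (expo Γ.node) 1)
    have h2 : nodeFun (antipodeStep B A) Γ Γ.label Γ.root (pderiv (v, i) (monomial (expo Γ.node) 1)) =
        if 0 < ∑ e, 𝔏.deg (Γ.label e) + (d : ℝ) * ((Fintype.card Γ.V : ℝ) - 1) +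
          ((Finsupp.degree (expo Γ.node) : ℕ) : ℝ) - 1 then 0 else
        Γ.properSum A B Γ.label Γ.root (pderiv (v, i) (monomial (expo Γ.node) 1)) := by
      by_cases h0 : Γ.node v i = 0
      · have : pderiv (v, i) (monomial (expo Γ.node) (1 : R)) = 0 := by
          rw [pderiv_monomial, expo_apply]; simp [h0]
        simp [this]
      · rw [nodeFun_antipodeStep B A Γ Γ.label Γ.root _ (Finsupp.degree (expo Γ.node) - 1)
          hhom.pderiv, Nat.cast_sub, Nat.cast_one]
        · congr 2; ring
        · refine Nat.one_le_iff_ne_zero.2 fun h3 => h0 ?_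
          rw [Finsupp.degree_eq_zero_iff] at h3
          exact DFunLike.congr_fun h3 (v, i)
    rw [h2]
    have h3 : ∀ e, nodeFun (antipodeStep B A) Γ (bump Γ.label e i) Γ.root
        (monomial (expo Γ.node) 1) =
        if 0 < ∑ e, 𝔏.deg (Γ.label e) + (d : ℝ) * ((Fintype.card Γ.V : ℝ) - 1) +
          ((Finsupp.degree (expo Γ.node) : ℕ) : ℝ) - 1 then 0 else
        Γ.properSum A B (bump Γ.label e i) Γ.root (monomial (expo Γ.node) 1) := by
      intro e
      rw [nodeFun_antipodeStep B A Γ _ Γ.root _ _ hhom, Γ.sum_deg_bump]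
      congr 2; ring
    simp only [h3]
    by_cases hd : 0 < ∑ e, 𝔏.deg (Γ.label e) + (d : ℝ) * ((Fintype.card Γ.V : ℝ) - 1) +
          ((Finsupp.degree (expo Γ.node) : ℕ) : ℝ) - 1
    · simp [hd]
    · simp only [hd, if_false]
      exact h1
  move Γ v hΓ := by
    classical
    have hhom : (monomial (expo Γ.node) (1 : R)).IsHomogeneous (Finsupp.degree (expo Γ.node)) :=
      isHomogeneous_monomial _ rfl
    have hhom' : (recenter Γ.root (monomial (expo Γ.node) (1 : R))).IsHomogeneous
        (Finsupp.degree (expo Γ.node)) := by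
      have := hhom.aeval (fun x : Γ.V × Fin d => (X x - X (Γ.root, x.2) : MvPolynomial _ R))
        (n := 1) fun x => (isHomogeneous_X R x).sub (isHomogeneous_X R _)
      rwa [one_mul] at this
    rw [map_moveRelation, nodeFun_antipodeStep B A Γ _ _ _ _ hhom,
      nodeFun_antipodeStep B A Γ _ _ _ _ hhom',
      Γ.properSum_move hA hA' hB hΓ Γ.label Γ.root v, sub_self]

/-- The iteration of the recursion step. After `n` steps the values are final for all diagrams with
less than `n` edges, whatever the initial map. -/
def antipodeIter (B : THat 𝔏 →ₐ[ℝ] R) (n : ℕ) : THat 𝔏 →ₐ[ℝ] R :=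
  (antipodeStep B)^[n] (aeval 0)

theorem antipodeIter_succ (B : THat 𝔏 →ₐ[ℝ] R) (n : ℕ) :
    antipodeIter B (n + 1) = antipodeStep B (antipodeIter B n) :=
  Function.iterate_succ_apply' _ _ _

theorem killsPositive_antipodeIter (B : THat 𝔏 →ₐ[ℝ] R) (n : ℕ) :
    KillsPositive (antipodeIter B n) := by
  cases n with
  | zero => exact fun Γ _ => aeval_X _ _
  | succ n => rw [antipodeIter_succ]; exact killsPositive_antipodeStep _ _

theorem respectsBelow_antipodeIter {B : THat 𝔏 →ₐ[ℝ] R} (hB : ∀ N, RespectsBelow N B) (n : ℕ) :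
    RespectsBelow n (antipodeIter B n) := by
  induction n with
  | zero => exact ⟨fun _ _ h => absurd h (Nat.not_lt_zero _),
      fun _ _ _ h => absurd h (Nat.not_lt_zero _), fun _ _ h => absurd h (Nat.not_lt_zero _)⟩
  | succ n ih =>
    rw [antipodeIter_succ]
    exact respectsBelow_antipodeStep ih (killsPositive_antipodeIter B n) hB

theorem agreeBelow_antipodeIter (B : THat 𝔏 →ₐ[ℝ] R) (n k : ℕ) :
    AgreeBelow n (antipodeIter B n) (antipodeIter B (n + k)) := by
  induction n with
  | zero => exact fun _ h => absurd h (Nat.not_lt_zero _)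
  | succ n ih =>
    rw [Nat.succ_add, antipodeIter_succ, antipodeIter_succ]
    exact agreeBelow_antipodeStep B ih

/-- The fixed point of the recursion. -/
def antipodeFix (B : THat 𝔏 →ₐ[ℝ] R) : THat 𝔏 →ₐ[ℝ] R :=
  aeval fun Γ : VacuumDiagram 𝔏 => antipodeIter B (Nat.card Γ.E + 1) (gen Γ)

theorem agreeBelow_antipodeFix (B : THat 𝔏 →ₐ[ℝ] R) (n : ℕ) :
    AgreeBelow n (antipodeIter B n) (antipodeFix B) := by
  intro Γ hΓ
  have h1 : antipodeFix B (gen Γ) = antipodeIter B (Nat.card Γ.E + 1) (gen Γ) := aeval_X _ _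
  obtain ⟨k, rfl⟩ := Nat.exists_eq_add_of_lt hΓ
  rw [h1, agreeBelow_antipodeIter B (Nat.card Γ.E + 1) k Γ (Nat.lt_succ_self _)]
  congr 2
  ring

theorem killsPositive_antipodeFix (B : THat 𝔏 →ₐ[ℝ] R) : KillsPositive (antipodeFix B) :=
  fun Γ h => by
    rw [← agreeBelow_antipodeFix B _ Γ (Nat.lt_succ_self _)]
    exact killsPositive_antipodeIter B _ Γ h

theorem respectsBelow_antipodeFix {B : THat 𝔏 →ₐ[ℝ] R} (hB : ∀ N, RespectsBelow N B) (n : ℕ) :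
    RespectsBelow n (antipodeFix B) :=
  (agreeBelow_antipodeFix B n).respectsBelow (respectsBelow_antipodeIter hB n)

/-- On diagrams of nonpositive degree the fixed point solves the equation of a twisted antipode. -/
theorem antipodeFix_gen (B : THat 𝔏 →ₐ[ℝ] R) (Γ : VacuumDiagram 𝔏) (hΓ : Γ.degree ≤ 0) :
    antipodeFix B (gen Γ) =
      Γ.properSum (antipodeFix B) B Γ.label Γ.root (monomial (expo Γ.node) 1) := by
  rw [← agreeBelow_antipodeFix B (Nat.card Γ.E + 1) Γ (Nat.lt_succ_self _), antipodeIter_succ,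
    agreeBelow_antipodeStep B (agreeBelow_antipodeFix B _) Γ (Nat.lt_succ_self _),
    antipodeStep_gen, if_neg (not_lt.2 hΓ)]

/-- The ideal defining `HMinus` is annihilated by the maps that respect all relations and vanish on
diagrams of positive degree. -/
theorem eq_zero_of_mem_sup {A : THat 𝔏 →ₐ[ℝ] R} (hA : ∀ N, RespectsBelow N A)
    (hA' : KillsPositive A) (x : THat 𝔏) (hx : x ∈ relIdeal 𝔏 ⊔ posIdeal 𝔏) : A x = 0 := by
  have h1 : relIdeal 𝔏 ⊔ posIdeal 𝔏 ≤ RingHom.ker A := by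
    refine sup_le (fun y hy => relIdeal_le_ker hA y hy) ?_
    rw [posIdeal, Ideal.span_le]
    rintro _ ⟨Γ, hΓ, rfl⟩
    exact hA' Γ hΓ
  exact h1 hx

/-- The equation of a twisted antipode expresses the value of a diagram by those of its proper
subgraphs. -/
theorem map_coproduct_eq_add (α : HMinus 𝔏 →ₐ[ℝ] R) (β : HHat 𝔏 →ₐ[ℝ] R) (Γ : VacuumDiagram 𝔏) :
    LinearMap.mul' ℝ R (TensorProduct.map α.toLinearMap β.toLinearMap Γ.coproduct) =
      α (toHMinus (gen Γ)) - Γ.properSum (α.comp toHMinus) (β.comp toHHat) Γ.label Γ.root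
        (monomial (expo Γ.node) 1) := by
  classical
  rw [Γ.map_coproduct, ← Finset.add_sum_erase _ _ (Finset.mem_univ Finset.univ),
    Γ.term_univ (respectsBelow_comp_toHMinus α) (killsPositive_toHMinus.comp α),
    Γ.properSum_apply, sub_neg_eq_add]
  rfl

/-- A character is determined by the vanishing of its convolution with a fixed character; it suffices
to consider diagrams without decoration at the distinguished vertex. -/
theorem eq_of_map_coproduct_eq_zero {α α' : HMinus 𝔏 →ₐ[ℝ] R} (β : HHat 𝔏 →ₐ[ℝ] R)
    (h : ∀ Γ : VacuumDiagram 𝔏, Γ.degree ≤ 0 → Γ.node Γ.root = 0 →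
      LinearMap.mul' ℝ R (TensorProduct.map α.toLinearMap β.toLinearMap Γ.coproduct) = 0)
    (h' : ∀ Γ : VacuumDiagram 𝔏, Γ.degree ≤ 0 → Γ.node Γ.root = 0 →
      LinearMap.mul' ℝ R (TensorProduct.map α'.toLinearMap β.toLinearMap Γ.coproduct) = 0) :
    α = α' := by
  classical
  -- a decoration at the distinguished vertex is removed by recentring there, so the value vanishes
  have hroot : ∀ (α : HMinus 𝔏 →ₐ[ℝ] R) (Γ : VacuumDiagram 𝔏), Γ.node Γ.root ≠ 0 →
      α (toHMinus (gen Γ)) = 0 := by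
    intro α Γ hΓ
    obtain ⟨i, hi⟩ : ∃ i, Γ.node Γ.root i ≠ 0 := by
      by_contra! h0; exact hΓ (funext h0)
    have h1 := (respectsBelow_comp_toHMinus α _).nodeFun_move Γ (Nat.lt_succ_self _) Γ.label Γ.root
      Γ.root (monomial (expo Γ.node) 1)
    have h2 : (monomial (expo Γ.node) (1 : R)) =
        monomial (expo Γ.node - Finsupp.single (Γ.root, i) 1) 1 * X (Γ.root, i) := by
      rw [X, monomial_mul, one_mul, tsub_add_cancel_of_le]
      rw [Finsupp.single_le_iff]
      exact Nat.one_le_iff_ne_zero.2 hi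
    have h3 : recenter (R := R) Γ.root (X (Γ.root, i)) = 0 := by simp [recenter]
    rw [nodeFun_monomial, h2, map_mul, h3, mul_zero, map_zero] at h1
    exact h1
  have key : ∀ n, AgreeBelow n (α.comp toHMinus) (α'.comp toHMinus) := by
    intro n
    induction n with
    | zero => exact fun _ h => absurd h (Nat.not_lt_zero _)
    | succ n ih =>
      intro Γ hΓ
      by_cases hd : 0 < Γ.degree
      · rw [killsPositive_toHMinus.comp α Γ hd, killsPositive_toHMinus.comp α' Γ hd]
      by_cases hr : Γ.node Γ.root = 0
      · have h1 := h Γ (not_lt.1 hd) hr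
        have h2 := h' Γ (not_lt.1 hd) hr
        rw [map_coproduct_eq_add, sub_eq_zero] at h1 h2
        rw [AlgHom.comp_apply, AlgHom.comp_apply, h1, h2, VacuumDiagram.properSum_apply,
          VacuumDiagram.properSum_apply]
        congr 1
        refine Finset.sum_congr rfl fun F hF => ?_
        rw [ih.term_eq Γ F (Γ.card_lt_of_ne_univ hΓ (Finset.ne_of_mem_erase hF))]
      · rw [AlgHom.comp_apply, AlgHom.comp_apply, hroot α Γ hr, hroot α' Γ hr]
  refine Ideal.Quotient.algHom_ext _ (MvPolynomial.algHom_ext fun Γ => ?_)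
  exact key _ Γ (Nat.lt_succ_self _)

/-- The twisted antipode. -/
def antipode (𝔏 : LabelSystem d) : HMinus 𝔏 →ₐ[ℝ] HHat 𝔏 :=
  Ideal.Quotient.liftₐ _ (antipodeFix toHHat)
    (eq_zero_of_mem_sup (respectsBelow_antipodeFix respectsBelow_toHHat)
      (killsPositive_antipodeFix _))

theorem isTwistedAntipode_antipode : IsTwistedAntipode (antipode 𝔏) := by
  intro Γ hΓ
  have h1 := map_coproduct_eq_add (antipode 𝔏) (AlgHom.id ℝ (HHat 𝔏)) Γ
  have h2 : (antipode 𝔏).comp toHMinus = antipodeFix toHHat := rfl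
  refine h1.trans ?_
  rw [← AlgHom.comp_apply, h2, AlgHom.id_comp, antipodeFix_gen _ Γ hΓ, sub_self]

theorem isTwistedAntipode_unique {A A' : HMinus 𝔏 →ₐ[ℝ] HHat 𝔏} (h : IsTwistedAntipode A)
    (h' : IsTwistedAntipode A') : A = A' :=
  eq_of_map_coproduct_eq_zero (AlgHom.id ℝ (HHat 𝔏)) (fun Γ hΓ _ => h Γ hΓ)
    fun Γ hΓ _ => h' Γ hΓ

end Antipode

/-! ### Translation invariant integrals -/

section Translation

open MeasureTheory
open scoped Classical

variable {d : ℕ} {V : Type*} [Fintype V]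

/-- The configuration that vanishes at `r` and is given by `y` at all other points. -/
def extendZero (r : V) (y : {v : V // v ≠ r} → Space d) : V → Space d :=
  fun v => if h : v ≠ r then y ⟨v, h⟩ else 0

omit [Fintype V] in
theorem extendZero_self (r : V) (y : {v : V // v ≠ r} → Space d) : extendZero r y r = 0 :=
  dif_neg (not_not.2 rfl)

omit [Fintype V] in
theorem extendZero_of_ne {r v : V} (h : v ≠ r) (y : {v : V // v ≠ r} → Space d) :
    extendZero r y v = y ⟨v, h⟩ := dif_pos h

omit [Fintype V] in
theorem continuous_extendZero (r : V) : Continuous (extendZero (d := d) r) := by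
  refine continuous_pi fun v => ?_
  by_cases h : v ≠ r
  · simp only [extendZero_of_ne h]; exact continuous_apply _
  · obtain rfl := not_not.1 h
    simp only [extendZero_self]; exact continuous_const

omit [Fintype V] in
/-- Moving the point `v` in relative coordinates moves it in the configuration. -/
theorem extendZero_add_single (r v : V) (hv : v ≠ r) (y : {v : V // v ≠ r} → Space d) (t : ℝ)
    (u : Space d) :
      extendZero r (y + t • (Pi.single ⟨v, hv⟩ u : {v : V // v ≠ r} → Space d)) =
        extendZero r y + t • (Pi.single v u : V → Space d) := by
  funext w
  by_cases h : w ≠ r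
  · simp only [extendZero_of_ne h, Pi.add_apply, Pi.smul_apply]
    by_cases hw : w = v
    · subst hw; simp
    · rw [Pi.single_eq_of_ne hw, Pi.single_eq_of_ne (by simpa using hw)]
  · obtain rfl := not_not.1 h
    rw [Pi.add_apply, Pi.smul_apply, extendZero_self, extendZero_self,
      Pi.single_eq_of_ne (Ne.symm hv)]
    simp

/-- Parametrising configurations by the position of `r` and the positions relative to it preserves
volumes. -/
theorem measurePreserving_extendZero_add (r : V) :
    MeasurePreserving (fun p : Space d × ({v : V // v ≠ r} → Space d) =>
      fun v => extendZero r p.2 v + p.1) (volume.prod volume) volume := by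
  have h1 : MeasurePreserving (fun p : Space d × ({v : V // v ≠ r} → Space d) =>
      (p.1, p.2 + fun _ => p.1)) (volume.prod volume) (volume.prod volume) := by
    refine (MeasurePreserving.id volume).skew_product (g := fun z y => y + fun _ => z) ?_ ?_
    · refine (Continuous.measurable ?_)
      fun_prop
    · exact Filter.Eventually.of_forall fun z => map_add_right_eq_self volume _
  have h2 := (volume_preserving_funUnique {v : V // v = r} (Space d)).symm
  have h3 := h2.prod (MeasurePreserving.id (volume : Measure ({v : V // v ≠ r} → Space d)))
  have h4 : MeasurePreserving (MeasurableEquiv.piEquivPiSubtypeProd (fun _ : V => Space d)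
      (fun v => v = r)).symm (volume.prod volume) volume := by
    have h := (volume_preserving_piEquivPiSubtypeProd (fun _ : V => Space d) (fun v => v = r)).symm
    rw [Measure.volume_eq_prod] at h
    convert h
    rfl
  convert (h4.comp h3).comp h1 using 1
  funext p v
  by_cases h : v = r
  · subst h
    simp only [extendZero_self, zero_add, Function.comp_apply]
    simp [MeasurableEquiv.piEquivPiSubtypeProd, Equiv.piEquivPiSubtypeProd]
  · simp only [extendZero_of_ne h, Function.comp_apply]
    simp [MeasurableEquiv.piEquivPiSubtypeProd, Equiv.piEquivPiSubtypeProd, h]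

/-- The integral of a translation invariant function against a test function only involves the average
of the test function over translations. -/
theorem integral_mul_eq_integral_extendZero (r : V) {f χ : (V → Space d) → ℝ}
    (hf : Continuous f) (hχ : Continuous χ) (hinv : ∀ x z, f (fun v => x v + z) = f x) (D : ℝ)
    (hD : ∀ y, f (extendZero r y) ≠ 0 → ∀ v, ‖extendZero r y v‖ ≤ D) (u : V) (M : ℝ)
    (hM : ∀ x, χ x ≠ 0 → ‖x u‖ ≤ M) :
    ∫ x, f x * χ x = ∫ y, f (extendZero r y) * ∫ z, χ (fun v => extendZero r y v + z) := by
  have hT := measurePreserving_extendZero_add (d := d) r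
  have hc : Continuous fun p : Space d × ({v : V // v ≠ r} → Space d) =>
      fun v => extendZero r p.2 v + p.1 :=
    continuous_pi fun v => (((continuous_pi_iff.1 (continuous_extendZero r) v).comp
      continuous_snd).add continuous_fst)
  rw [← hT.map_eq, integral_map (f := fun x => f x * χ x) hT.measurable.aemeasurable
    (hf.mul hχ).aestronglyMeasurable]
  simp only [hinv]
  rw [integral_prod_symm]
  · simp only [integral_const_mul]
  · refine Continuous.integrable_of_hasCompactSupport
      ((hf.comp ((continuous_extendZero r).comp continuous_snd)).mul (hχ.comp hc)) ?_
    refine HasCompactSupport.intro (isCompact_closedBall 0 (max D (M + D))) fun p hp => ?_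
    by_contra h0
    refine hp ?_
    have h1 : f (extendZero r p.2) ≠ 0 := fun h => h0 (by simp [h])
    have h2 : χ (fun v => extendZero r p.2 v + p.1) ≠ 0 := fun h => h0 (by simp [h])
    have h3 := hD _ h1
    have h4 := hM _ h2
    have hD0 : 0 ≤ D := (norm_nonneg _).trans (h3 r)
    rw [mem_closedBall_zero_iff, Prod.norm_def]
    refine max_le ?_ ?_
    · have : p.1 = (extendZero r p.2 u + p.1) - extendZero r p.2 u := by abel
      rw [this]
      exact (norm_sub_le _ _).trans ((add_le_add h4 (h3 u)).trans (le_max_right _ _))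
    · refine (pi_norm_le_iff_of_nonneg (hD0.trans (le_max_left _ _))).2 fun v => ?_
      have := h3 v.1
      rw [extendZero_of_ne v.2] at this
      exact this.trans (le_max_left _ _)

end Translation

/-! ### The vacuum functional -/

section Vacuum

open MeasureTheory MvPolynomial
open scoped Classical

variable {d : ℕ} {𝔏 : LabelSystem d} (K : KernelAssignment 𝔏)

section

variable {V E : Type*} [Fintype V] [Fintype E] (src tgt : E → V) (lab : E → 𝔏.Label)

/-- The product of all kernels. -/
def kerProd (x : V → Space d) : ℝ := ∏ e, K.ker (lab e) (x (tgt e) - x (src e))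

/-- A polynomial in the coordinates of a configuration. -/
def evalAt (q : MvPolynomial (V × Fin d) ℝ) (x : V → Space d) : ℝ :=
  eval (fun p => x p.1 p.2) q

/-- Configurations with distances at most `1` along all edges have diameter at most `D`. -/
def DiamBound (D : ℝ) : Prop :=
  ∀ x : V → Space d, (∀ e, ‖x (tgt e) - x (src e)‖ ≤ 1) → ∀ u v, ‖x u - x v‖ ≤ D

omit [Fintype V] [Fintype E] in
theorem continuous_evalAt (q : MvPolynomial (V × Fin d) ℝ) : Continuous (evalAt q) := by
  unfold evalAt
  induction q using MvPolynomial.induction_on with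
  | C a => simp only [eval_C]; exact continuous_const
  | add p q hp hq => simp only [map_add]; exact hp.add hq
  | mul_X p x hp =>
    simp only [map_mul, eval_X]
    refine hp.mul ?_
    exact (EuclideanSpace.proj (𝕜 := ℝ) x.2).continuous.comp (continuous_apply x.1)

omit [Fintype V] in
theorem evalAt_recenter (r : V) (q : MvPolynomial (V × Fin d) ℝ) (x : V → Space d) :
    evalAt (recenter r q) x = evalAt q (fun v => x v - x r) := by
  unfold evalAt recenter
  rw [← coe_aeval_eq_eval, ← coe_aeval_eq_eval, RingHom.coe_coe, RingHom.coe_coe,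
    ← AlgHom.comp_apply, comp_aeval]
  congr 2
  funext p
  simp

omit [Fintype V] in
theorem continuous_kerProd : Continuous (kerProd K src tgt lab) := by
  unfold kerProd
  refine continuous_finsetProd _ fun e _ => (K.smooth (lab e)).continuous.comp ?_
  fun_prop

omit [Fintype V] in
theorem kerProd_translate (x : V → Space d) (z : Space d) :
    kerProd K src tgt lab (fun v => x v + z) = kerProd K src tgt lab x := by
  unfold kerProd
  simp only [add_sub_add_right_eq_sub]

omit [Fintype V] in
theorem norm_le_of_kerProd_ne_zero {x : V → Space d} (h : kerProd K src tgt lab x ≠ 0) (e : E) :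
    ‖x (tgt e) - x (src e)‖ ≤ 1 := by
  by_contra h1
  exact Finset.prod_ne_zero_iff.1 h e (Finset.mem_univ e) (K.support _ _ (not_le.1 h1))

omit [Fintype V] in
/-- The kernels have supports in the unit ball, so that their product vanishes unless all vertices are
close to the distinguished one. -/
theorem norm_extendZero_le {D : ℝ} (hD : DiamBound (d := d) src tgt D) (r : V)
    (y : {v : V // v ≠ r} → Space d) (h : kerProd K src tgt lab (extendZero r y) ≠ 0) (v : V) :
    ‖extendZero r y v‖ ≤ D := by
  have := hD _ (norm_le_of_kerProd_ne_zero K src tgt lab h) v r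
  rwa [extendZero_self, sub_zero] at this

theorem integrable_kerProd_mul {D : ℝ} (hD : DiamBound (d := d) src tgt D) (r : V)
    (q : MvPolynomial (V × Fin d) ℝ) : Integrable fun y : {v : V // v ≠ r} → Space d =>
      kerProd K src tgt lab (extendZero r y) * evalAt q (extendZero r y) := by
  refine Continuous.integrable_of_hasCompactSupport
    (((continuous_kerProd K src tgt lab).comp (continuous_extendZero r)).mul
      ((continuous_evalAt q).comp (continuous_extendZero r))) ?_
  refine HasCompactSupport.intro (isCompact_closedBall 0 (max D 0)) fun y hy => ?_
  by_contra h0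
  refine hy ?_
  have h1 := norm_extendZero_le K src tgt lab hD r y fun h => h0 (by simp [h])
  rw [mem_closedBall_zero_iff]
  refine (pi_norm_le_iff_of_nonneg (le_max_right _ _)).2 fun v => ?_
  have := h1 v.1
  rw [extendZero_of_ne v.2] at this
  exact this.trans (le_max_left _ _)

/-- The integral of the product of all kernels against a polynomial in the positions relative
to `r`. -/
def vacInt (r : V) (q : MvPolynomial (V × Fin d) ℝ) : ℝ :=
  ∫ y : {v : V // v ≠ r} → Space d,
    kerProd K src tgt lab (extendZero r y) * evalAt q (extendZero r y)

theorem vacInt_add {D : ℝ} (hD : DiamBound (d := d) src tgt D) (r : V)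
    (p q : MvPolynomial (V × Fin d) ℝ) : vacInt K src tgt lab r (p + q) =
      vacInt K src tgt lab r p + vacInt K src tgt lab r q := by
  unfold vacInt
  rw [← integral_add (integrable_kerProd_mul K src tgt lab hD r p)
    (integrable_kerProd_mul K src tgt lab hD r q)]
  simp only [evalAt, map_add, mul_add]

theorem vacInt_smul (r : V) (a : ℝ) (q : MvPolynomial (V × Fin d) ℝ) :
    vacInt K src tgt lab r (a • q) = a * vacInt K src tgt lab r q := by
  unfold vacInt
  rw [← integral_const_mul]
  simp only [evalAt, smul_eval]
  congr 1
  funext y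
  ring

/-- Change of the reference point. -/
theorem vacInt_move {D : ℝ} (hD : DiamBound (d := d) src tgt D) (r v : V)
    (q : MvPolynomial (V × Fin d) ℝ) :
    vacInt K src tgt lab r q = vacInt K src tgt lab v (recenter r q) := by
  have hrec : ∀ x : V → Space d, evalAt (recenter r q) x = evalAt q (fun v => x v + -x r) := by
    simp only [evalAt_recenter, sub_eq_add_neg, implies_true]
  -- fixing the position of `r` by a normalised function gives an integral over all configurations,
  -- which can be computed in the coordinates relative to any vertex
  let ψ : ContDiffBump (0 : Space d) := ⟨1, 2, one_pos, one_lt_two⟩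
  have hψ : ∫ z, ψ.normed volume z = 1 := ψ.integral_normed
  have hψc : Continuous (ψ.normed volume) := ψ.continuous_normed
  have hψ0 : ∀ z, ψ.normed volume z ≠ 0 → ‖z‖ ≤ 2 := by
    intro z hz
    have : z ∈ Function.support (ψ.normed volume) := hz
    rw [ψ.support_normed_eq] at this
    exact (mem_ball_zero_iff.1 this).le
  let f : (V → Space d) → ℝ := fun x => kerProd K src tgt lab x * evalAt (recenter r q) x
  have hfc : Continuous f := (continuous_kerProd K src tgt lab).mul (continuous_evalAt _)
  have hinv : ∀ x z, f (fun v => x v + z) = f x := by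
    intro x z
    simp only [f, kerProd_translate, hrec]
    congr 2
    funext w
    abel
  have hbd : ∀ s : V, ∀ y, f (extendZero s y) ≠ 0 → ∀ v, ‖extendZero s y v‖ ≤ D := fun s y hy =>
    norm_extendZero_le K src tgt lab hD s y fun h => hy (by simp [f, h])
  have key : ∀ s : V, ∫ x, f x * ψ.normed volume (x r) = ∫ y, f (extendZero s y) := by
    intro s
    rw [integral_mul_eq_integral_extendZero (χ := fun x => ψ.normed volume (x r)) s hfc
      (hψc.comp (continuous_apply r)) hinv D (hbd s) r 2 (fun x hx => hψ0 _ hx)]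
    congr 1
    funext y
    rw [integral_add_left_eq_self (fun z => ψ.normed volume z), hψ, mul_one]
  unfold vacInt
  refine Eq.trans ?_ ((key r).symm.trans (key v))
  congr 1
  funext y
  simp only [f, hrec, extendZero_self, neg_zero, add_zero]

/-- Relabelling of vertices and edges. -/
theorem vacInt_rename {V' E' : Type*} [Fintype V'] [Fintype E'] (src' tgt' : E' → V')
    (lab' : E' → 𝔏.Label) (a : V ≃ V') (b : E ≃ E') (hs : ∀ e, src' (b e) = a (src e))
    (ht : ∀ e, tgt' (b e) = a (tgt e)) (hl : ∀ e, lab' (b e) = lab e) (r : V)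
    (q : MvPolynomial (V × Fin d) ℝ) :
    vacInt K src' tgt' lab' (a r) (rename (Prod.map a id) q) = vacInt K src tgt lab r q := by
  unfold vacInt
  let c : {v : V // v ≠ r} ≃ {v : V' // v ≠ a r} :=
    a.subtypeEquiv fun v => by rw [ne_eq, ne_eq, a.injective.eq_iff]
  have hc := volume_measurePreserving_piCongrLeft (fun _ : {v : V' // v ≠ a r} => Space d) c
  rw [← hc.integral_comp']
  congr 1
  funext y
  have h1 : ∀ v, extendZero (a r) (MeasurableEquiv.piCongrLeft
      (fun _ : {v : V' // v ≠ a r} => Space d) c y) (a v) = extendZero r y v := by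
    intro v
    by_cases h : v = r
    · subst h; rw [extendZero_self, extendZero_self]
    · rw [extendZero_of_ne h, extendZero_of_ne (fun h' => h (a.injective h'))]
      exact Equiv.piCongrLeft_apply_apply (fun _ : {v : V' // v ≠ a r} => Space d) c y ⟨v, h⟩
  congr 1
  · unfold kerProd
    rw [← b.prod_comp]
    simp only [hs, ht, hl, h1]
  · unfold evalAt
    rw [eval_rename]
    congr 2
    funext p
    simp only [Function.comp_apply, Prod.map, id, h1]

theorem multiDeriv_unit {X : Type*} [NormedAddCommGroup X] [NormedSpace ℝ X] {n : ℕ} (b : Fin n → X)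
    (i : Fin n) (f : X → ℝ) : multiDeriv b (MultiIndex.unit i) f = partialDeriv (b i) f := by
  have key : ∀ l : List (Fin n), l.Nodup →
      l.foldr (fun j g => (partialDeriv (b j))^[MultiIndex.unit i j] g) f =
        if i ∈ l then partialDeriv (b i) f else f := by
    intro l
    induction l with
    | nil => intro _; simp
    | cons a l ih =>
      intro h
      rw [List.nodup_cons] at h
      rw [List.foldr_cons, ih h.2]
      by_cases ha : a = i
      · subst ha
        simp [MultiIndex.unit, h.1]
      · have : i ≠ a := fun h => ha h.symm
        simp [MultiIndex.unit, this]
  rw [multiDeriv, key _ (List.nodup_finRange n), if_pos (List.mem_finRange i)]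

theorem fderiv_ker (t : 𝔏.Label) (i : Fin d) (x : Space d) :
    fderiv ℝ (K.ker t) x (EuclideanSpace.single i 1) =
      K.ker (𝔏.shift (MultiIndex.unit i) t) x := by
  rw [K.ker_shift, spaceDeriv, multiDeriv_unit]; rfl

end

section

variable {V E : Type} [Fintype V] [Fintype E] (src tgt : E → V) (lab : E → 𝔏.Label)

omit [Fintype V] in
theorem hasDerivAt_kerProd (v : V) (i : Fin d) (x : V → Space d) :
    HasDerivAt (fun t : ℝ => kerProd K src tgt lab
        (x + t • (Pi.single v (EuclideanSpace.single i 1) : V → Space d)))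
      (∑ e, ((if tgt e = v then kerProd K src tgt (bump lab e i) x else 0) -
        (if src e = v then kerProd K src tgt (bump lab e i) x else 0))) 0 := by
  let w : E → Space d := fun e =>
    (Pi.single v (EuclideanSpace.single i 1) : V → Space d) (tgt e) -
      (Pi.single v (EuclideanSpace.single i 1) : V → Space d) (src e)
  have h1 : ∀ e, HasDerivAt (fun t : ℝ => K.ker (lab e) ((x (tgt e) - x (src e)) + t • w e))
      (fderiv ℝ (K.ker (lab e)) (x (tgt e) - x (src e)) (w e)) 0 := fun e =>
    ((((K.smooth (lab e)).differentiable (by simp)) _).hasFDerivAt.hasLineDerivAt (w e))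
  have h2 := HasDerivAt.fun_finsetProd (u := Finset.univ) fun e _ => h1 e
  have h3 : (fun t : ℝ => kerProd K src tgt lab
      (x + t • (Pi.single v (EuclideanSpace.single i 1) : V → Space d))) =
      fun t => ∏ e, K.ker (lab e) ((x (tgt e) - x (src e)) + t • w e) := by
    funext t
    refine Finset.prod_congr rfl fun e _ => congrArg _ ?_
    simp only [w, Pi.add_apply, Pi.smul_apply, smul_sub]
    abel
  rw [h3]
  refine h2.congr_deriv (Eq.symm (Finset.sum_congr rfl fun e _ => ?_))
  have h4 : kerProd K src tgt (bump lab e i) x =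
      (∏ e' ∈ Finset.univ.erase e, K.ker (lab e') (x (tgt e') - x (src e'))) *
        fderiv ℝ (K.ker (lab e)) (x (tgt e) - x (src e)) (EuclideanSpace.single i 1) := by
    rw [kerProd, ← Finset.prod_erase_mul _ _ (Finset.mem_univ e), fderiv_ker, bump_self]
    refine congrArg (· * _) (Finset.prod_congr rfl fun e' he' => ?_)
    rw [bump_of_ne lab (Finset.ne_of_mem_erase he')]
  have h5 : w e = (if tgt e = v then EuclideanSpace.single i (1 : ℝ) else 0) -
      if src e = v then EuclideanSpace.single i (1 : ℝ) else 0 := by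
    simp only [w, Pi.single_apply]
  simp only [h4, h5, zero_smul, add_zero, map_sub, smul_eq_mul, mul_sub,
    apply_ite (fderiv ℝ (K.ker (lab e)) (x (tgt e) - x (src e))), map_zero, mul_ite, mul_zero]

omit [Fintype V] in
theorem hasDerivAt_evalAt (q : MvPolynomial (V × Fin d) ℝ) (v : V) (i : Fin d) (x : V → Space d) :
    HasDerivAt (fun t : ℝ => evalAt q
        (x + t • (Pi.single v (EuclideanSpace.single i 1) : V → Space d)))
      (evalAt (pderiv (v, i) q) x) 0 := by
  unfold evalAt
  induction q using MvPolynomial.induction_on with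
  | C a => simpa using hasDerivAt_const (0 : ℝ) a
  | add p q hp hq => simpa using hp.fun_add hq
  | mul_X p y hp =>
    have h : HasDerivAt (fun t : ℝ =>
        (x + t • (Pi.single v (EuclideanSpace.single i 1) : V → Space d)) y.1 y.2)
        (if (v, i) = y then 1 else 0) 0 := by
      have h1 : HasDerivAt (fun t : ℝ => x y.1 y.2 + t * if (v, i) = y then (1 : ℝ) else 0)
          (if (v, i) = y then 1 else 0) 0 := by
        simpa using ((hasDerivAt_id (0 : ℝ)).mul_const (if (v, i) = y then (1 : ℝ) else 0)).const_add
          (x y.1 y.2)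
      convert h1 using 2
      rename_i t
      obtain ⟨y1, y2⟩ := y
      simp only [Pi.add_apply, Pi.smul_apply, PiLp.add_apply, PiLp.smul_apply, smul_eq_mul,
        Prod.mk.injEq]
      congr 2
      by_cases h1 : v = y1
      · subst h1
        rw [Pi.single_eq_same, PiLp.single_apply]
        simp [eq_comm]
      · rw [Pi.single_eq_of_ne (Ne.symm h1)]
        simp [h1]
    simp only [map_mul, eval_X]
    refine (hp.fun_mul h).congr_deriv ?_
    rw [Derivation.leibniz, pderiv_X, Pi.single_apply]
    simp only [smul_eq_mul, map_add, map_mul, eval_X, zero_smul, add_zero]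
    simp only [eq_comm (a := y)]
    split_ifs <;> (simp; ring)

/-- Integration by parts at a vertex over whose position one integrates. -/
theorem vacInt_ibp {D : ℝ} (hD : DiamBound (d := d) src tgt D) (r v : V) (hv : v ≠ r) (i : Fin d)
    (q : MvPolynomial (V × Fin d) ℝ) :
    ∑ e, ((if tgt e = v then vacInt K src tgt (bump lab e i) r q else 0) -
        (if src e = v then vacInt K src tgt (bump lab e i) r q else 0)) +
      vacInt K src tgt lab r (pderiv (v, i) q) = 0 := by
  let u : {v : V // v ≠ r} → Space d := Pi.single ⟨v, hv⟩ (EuclideanSpace.single i 1)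
  let f' : (V → Space d) → ℝ := fun x =>
    ∑ e, ((if tgt e = v then kerProd K src tgt (bump lab e i) x else 0) -
        (if src e = v then kerProd K src tgt (bump lab e i) x else 0))
  have hint : ∀ e (P : Prop) [Decidable P], Integrable fun y : {v : V // v ≠ r} → Space d =>
      (if P then kerProd K src tgt (bump lab e i) (extendZero r y) *
        evalAt q (extendZero r y) else 0) := by
    intro e P _
    split_ifs
    · exact integrable_kerProd_mul K src tgt _ hD r q
    · exact integrable_zero _ _ _
  have hf' : ∀ y : {v : V // v ≠ r} → Space d, f' (extendZero r y) * evalAt q (extendZero r y) =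
      ∑ e, ((if tgt e = v then kerProd K src tgt (bump lab e i) (extendZero r y) *
          evalAt q (extendZero r y) else 0) -
        (if src e = v then kerProd K src tgt (bump lab e i) (extendZero r y) *
          evalAt q (extendZero r y) else 0)) := by
    intro y
    simp only [f', Finset.sum_mul, sub_mul, ite_mul, zero_mul]
  have key := integral_bilinear_hasLineDerivAt_right_eq_neg_left_of_integrable (μ := volume)
    (f := fun y : {v : V // v ≠ r} → Space d => kerProd K src tgt lab (extendZero r y))
    (g := fun y => evalAt q (extendZero r y)) (f' := fun y => f' (extendZero r y))
    (g' := fun y => evalAt (pderiv (v, i) q) (extendZero r y)) (v := u)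
    (B := ContinuousLinearMap.mul ℝ ℝ)
    (by
      simp only [ContinuousLinearMap.mul_apply', hf']
      exact integrable_finsetSum _ fun e _ => (hint e _).sub (hint e _))
    (integrable_kerProd_mul K src tgt lab hD r _) (integrable_kerProd_mul K src tgt lab hD r _)
    (fun y _ => by
      have := hasDerivAt_kerProd K src tgt lab v i (extendZero r y)
      simpa only [HasLineDerivAt, u, extendZero_add_single] using this)
    (fun y _ => by
      have := hasDerivAt_evalAt q v i (extendZero r y)
      simpa only [HasLineDerivAt, u, extendZero_add_single] using this)
  simp only [ContinuousLinearMap.mul_apply', hf'] at key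
  rw [vacInt, key, add_neg_eq_zero]
  refine Eq.trans ?_ (integral_finsetSum _ fun e _ => (hint e _).sub (hint e _)).symm
  refine Finset.sum_congr rfl fun e _ => ?_
  refine Eq.trans ?_ (integral_sub (hint e _) (hint e _)).symm
  congr 1 <;> split_ifs <;> simp [vacInt]

end

end Vacuum

/-! ### The character of vacuum integrals -/

section VacuumCharacter

open MeasureTheory MvPolynomial
open scoped Classical

variable {d : ℕ} {𝔏 : LabelSystem d} (K : KernelAssignment 𝔏)

/-- In a connected graph the distances along the edges bound all distances. -/
theorem exists_diamBound {V E : Type*} [Fintype V] (src tgt : E → V)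
    (h : ∀ u v, Relation.EqvGen (fun a b => ∃ e, src e = a ∧ tgt e = b) u v) :
    ∃ D : ℝ, DiamBound (d := d) src tgt D := by
  have key : ∀ u v, ∃ D : ℝ, ∀ x : V → Space d, (∀ e, ‖x (tgt e) - x (src e)‖ ≤ 1) →
      ‖x u - x v‖ ≤ D := by
    intro u v
    induction h u v with
    | rel a b h =>
      obtain ⟨e, rfl, rfl⟩ := h
      exact ⟨1, fun x hx => by rw [norm_sub_rev]; exact hx e⟩
    | refl a => exact ⟨0, fun x _ => by simp⟩
    | symm a b _ ih =>
      obtain ⟨D, hD⟩ := ih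
      exact ⟨D, fun x hx => by rw [norm_sub_rev]; exact hD x hx⟩
    | trans a b c _ _ ih1 ih2 =>
      obtain ⟨D, hD⟩ := ih1
      obtain ⟨D', hD'⟩ := ih2
      exact ⟨D + D', fun x hx =>
        (norm_sub_le_norm_sub_add_norm_sub _ (x b) _).trans (add_le_add (hD x hx) (hD' x hx))⟩
  choose D hD using key
  refine ⟨∑ u, ∑ v, |D u v|, fun x hx u v => (hD u v x hx).trans ((le_abs_self _).trans ?_)⟩
  exact (Finset.single_le_sum (f := fun v => |D u v|) (fun _ _ => abs_nonneg _)
    (Finset.mem_univ v)).trans (Finset.single_le_sum (f := fun u => ∑ v, |D u v|)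
      (fun _ _ => Finset.sum_nonneg fun _ _ => abs_nonneg _) (Finset.mem_univ u))

theorem VacuumDiagram.exists_diamBound (Γ : VacuumDiagram 𝔏) :
    ∃ D : ℝ, DiamBound (d := d) Γ.src Γ.tgt D :=
  Feynman.exists_diamBound Γ.src Γ.tgt Γ.connected.2

theorem vacuumValue_vary (Γ : VacuumDiagram 𝔏) (lab : Γ.E → 𝔏.Label) (r : Γ.V)
    (n : Γ.V → MultiIndex d) : (Γ.vary lab r n).vacuumValue K =
      vacInt K Γ.src Γ.tgt lab r (monomial (expo n) 1) := by
  have h : (Γ.vary lab r n).vacuumValue K = ∫ y : {v : Γ.V // v ≠ r} → Space d,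
      kerProd K Γ.src Γ.tgt lab (extendZero r y) *
        ∏ w : Γ.V, ∏ i : Fin d, ((extendZero r y w - extendZero r y r) i) ^ (n w i) := rfl
  rw [h, vacInt]
  congr 1
  funext y
  rw [extendZero_self, evalAt, eval_monomial, one_mul,
    Finsupp.prod_fintype _ _ fun _ => pow_zero _, Fintype.prod_prod_type]
  simp only [sub_zero, expo_apply]

/-- The multiplicative extension of `Π₋^K`. -/
def vacAlg : THat 𝔏 →ₐ[ℝ] ℝ := aeval fun Γ => Γ.vacuumValue K

/-- The functional of a diagram under `Π₋^K` is integration of polynomials against the kernels. -/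
theorem nodeFun_vacAlg (Γ : VacuumDiagram 𝔏) (lab : Γ.E → 𝔏.Label) (r : Γ.V)
    (q : MvPolynomial (Γ.V × Fin d) ℝ) :
    nodeFun (vacAlg K) Γ lab r q = vacInt K Γ.src Γ.tgt lab r q := by
  obtain ⟨D, hD⟩ := Γ.exists_diamBound
  let f : MvPolynomial (Γ.V × Fin d) ℝ →ₗ[ℝ] ℝ :=
    { toFun := vacInt K Γ.src Γ.tgt lab r
      map_add' := vacInt_add K Γ.src Γ.tgt lab hD r
      map_smul' := vacInt_smul K Γ.src Γ.tgt lab r }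
  change _ = f q
  congr 1
  refine linearMap_ext_monomial fun s => ?_
  have h := nodeFun_monomial (vacAlg K) Γ lab r (deco s)
  rw [expo_deco] at h
  rw [h]
  change _ = vacInt K Γ.src Γ.tgt lab r (monomial s 1)
  rw [vacAlg, gen, aeval_X, vacuumValue_vary, expo_deco]

/-- Integrals respect all relations: relabelling, integration by parts and change of the reference
point. -/
theorem respectsBelow_vacAlg (N : ℕ) : RespectsBelow N (vacAlg (𝔏 := 𝔏) K) where
  iso Γ Γ' _ h := by
    obtain ⟨a, b, hs, ht, hl, hr, hn⟩ := h
    have h1 := nodeFun_monomial (vacAlg K) Γ Γ.label Γ.root Γ.node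
    have h2 := nodeFun_monomial (vacAlg K) Γ' Γ'.label Γ'.root Γ'.node
    refine h1.symm.trans (Eq.trans ?_ h2)
    rw [nodeFun_vacAlg, nodeFun_vacAlg, hr,
      ← vacInt_rename K Γ.src Γ.tgt Γ.label Γ'.src Γ'.tgt Γ'.label a b hs ht hl, rename_monomial]
    congr 1
    have hinj : Function.Injective (Prod.map a id : Γ.V × Fin d → Γ'.V × Fin d) :=
      a.injective.prodMap Function.injective_id
    refine congrArg (fun s => monomial s (1 : ℝ)) (Finsupp.ext fun x => ?_)
    obtain ⟨w, i⟩ := x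
    obtain ⟨v, rfl⟩ := a.surjective w
    rw [show ((a v, i) : Γ'.V × Fin d) = Prod.map a id (v, i) from rfl,
      Finsupp.mapDomain_apply hinj, expo_apply, expo_apply]
    exact (congrFun (hn v) i).symm
  ibp Γ v i _ hv := by
    obtain ⟨D, hD⟩ := Γ.exists_diamBound
    rw [map_ibpRelation]
    simp only [nodeFun_vacAlg]
    convert vacInt_ibp K Γ.src Γ.tgt Γ.label hD Γ.root v hv i (monomial (expo Γ.node) 1)
  move Γ v _ := by
    obtain ⟨D, hD⟩ := Γ.exists_diamBound
    rw [map_moveRelation, nodeFun_vacAlg, nodeFun_vacAlg, ← vacInt_move K _ _ _ hD, sub_self]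

/-- The character `Π₋^K` of `HHat`. -/
def vacCharacter : HHat 𝔏 →ₐ[ℝ] ℝ :=
  Ideal.Quotient.liftₐ _ (vacAlg K) (relIdeal_le_ker (respectsBelow_vacAlg K))

theorem vacCharacter_comp_toHHat : (vacCharacter K).comp toHHat = vacAlg (𝔏 := 𝔏) K := by
  ext Γ
  rfl

theorem isVacuumCharacter_vacCharacter : IsVacuumCharacter (𝔏 := 𝔏) K (vacCharacter K) := by
  intro Γ
  change (vacCharacter K).comp toHHat (gen Γ) = _
  rw [vacCharacter_comp_toHHat, vacAlg, gen, aeval_X]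

theorem IsVacuumCharacter.eq_vacCharacter {P : HHat 𝔏 →ₐ[ℝ] ℝ} (h : IsVacuumCharacter K P) :
    P = vacCharacter K := by
  refine Ideal.Quotient.algHom_ext _ (MvPolynomial.algHom_ext fun Γ => ?_)
  exact (h Γ).trans (isVacuumCharacter_vacCharacter K Γ).symm

/-- There is exactly one BPHZ character, namely `Π₋^K` composed with the twisted antipode. -/
theorem isBPHZ_iff {g : Character 𝔏} : IsBPHZ K g ↔ g = (vacCharacter K).comp (antipode 𝔏) := by
  constructor
  · rintro ⟨A, P, hA, hP, rfl⟩
    rw [hP.eq_vacCharacter, isTwistedAntipode_unique hA isTwistedAntipode_antipode]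
  · rintro rfl
    exact ⟨_, _, isTwistedAntipode_antipode, isVacuumCharacter_vacCharacter K, rfl⟩

end VacuumCharacter

/-! ### Iterated derivatives of polynomials -/

section IterPderiv

open MvPolynomial

variable {W R : Type*} [CommRing R]

theorem pderiv_comm (v w : W) (q : MvPolynomial W R) :
    pderiv v (pderiv w q) = pderiv w (pderiv v q) := by
  classical
  have h : ⁅(pderiv v : Derivation R (MvPolynomial W R) (MvPolynomial W R)),
      (pderiv w : Derivation R (MvPolynomial W R) (MvPolynomial W R))⁆ = 0 := by
    refine MvPolynomial.derivation_ext fun x => ?_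
    rw [Derivation.commutator_apply, pderiv_X, pderiv_X, Pi.single_apply, Pi.single_apply]
    split_ifs <;> simp
  have h1 := congrArg (fun D : Derivation R (MvPolynomial W R) (MvPolynomial W R) => D q) h
  simpa only [Derivation.commutator_apply, Derivation.zero_apply, sub_eq_zero] using h1

instance : LeftCommutative fun (w : W) (q : MvPolynomial W R) => pderiv w q :=
  ⟨fun v w q => pderiv_comm v w q⟩

/-- The iterated derivative with exponent `s`, whose order of differentiation is irrelevant. -/
def iterPderiv (s : W →₀ ℕ) (q : MvPolynomial W R) : MvPolynomial W R :=
  (Finsupp.toMultiset s).foldr (fun w q => pderiv w q) q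

theorem iterPderiv_zero (q : MvPolynomial W R) : iterPderiv 0 q = q := by
  simp [iterPderiv]

theorem iterPderiv_add_single (s : W →₀ ℕ) (w : W) (q : MvPolynomial W R) :
    iterPderiv (s + Finsupp.single w 1) q = pderiv w (iterPderiv s q) := by
  rw [iterPderiv, map_add, Finsupp.toMultiset_single, one_smul, add_comm, Multiset.singleton_add,
    Multiset.foldr_cons, iterPderiv]

/-- Properties stable under partial derivatives are stable under iterated derivatives. -/
theorem iterPderiv_induction {P : MvPolynomial W R → Prop} (h : ∀ w q, P q → P (pderiv w q))
    (s : W →₀ ℕ) {q : MvPolynomial W R} (hq : P q) : P (iterPderiv s q) := by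
  unfold iterPderiv
  induction Finsupp.toMultiset s using Multiset.induction with
  | empty => exact hq
  | cons a m ih => rw [Multiset.foldr_cons]; exact h _ _ ih

theorem sum_pderiv_iterPderiv {V : Type*} [Fintype V] {d : ℕ} {q : MvPolynomial (V × Fin d) R}
    (h : ∀ i, ∑ v, pderiv (v, i) q = 0) (s : V × Fin d →₀ ℕ) (i : Fin d) :
    ∑ v, pderiv (v, i) (iterPderiv s q) = 0 := by
  refine iterPderiv_induction (P := fun q => ∀ i, ∑ v, pderiv (v, i) q = 0) (fun w q hq i => ?_) s h i
  simp only [pderiv_comm _ w, ← map_sum, hq, map_zero]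

theorem totalDegree_pderiv_le (w : W) (q : MvPolynomial W R) :
    (pderiv w q).totalDegree ≤ q.totalDegree := by
  classical
  conv_lhs => rw [q.as_sum, map_sum]
  refine totalDegree_finsetSum_le fun s hs => ?_
  rw [pderiv_monomial]
  refine (totalDegree_monomial_le _ _).trans ?_
  refine le_trans ?_ (le_totalDegree hs)
  exact Finsupp.sum_le_sum_index tsub_le_self (fun _ _ => monotone_id) fun _ _ => rfl

theorem totalDegree_iterPderiv_le (s : W →₀ ℕ) (q : MvPolynomial W R) :
    (iterPderiv s q).totalDegree ≤ q.totalDegree :=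
  iterPderiv_induction (P := fun p => p.totalDegree ≤ q.totalDegree)
    (fun _ _ h => (totalDegree_pderiv_le _ _).trans h) s le_rfl

theorem totalDegree_aeval_le {S : Type*} (g : W → MvPolynomial S R)
    (hg : ∀ w, (g w).totalDegree ≤ 1) (q : MvPolynomial W R) :
    (aeval g q).totalDegree ≤ q.totalDegree := by
  classical
  conv_lhs => rw [q.as_sum, map_sum]
  refine totalDegree_finsetSum_le fun s hs => ?_
  rw [aeval_monomial]
  refine (totalDegree_mul _ _).trans ?_
  rw [algebraMap_eq, totalDegree_C, zero_add]
  refine (totalDegree_finsetProd _ _).trans (le_trans ?_ (le_totalDegree hs))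
  refine Finset.sum_le_sum fun w _ => (totalDegree_pow _ _).trans ?_
  exact (Nat.mul_le_mul_left _ (hg w)).trans (mul_one _).le

theorem totalDegree_recenter_le [Nontrivial R] {V : Type*} {d : ℕ} (r : V) (q : MvPolynomial (V × Fin d) R) :
    (recenter r q).totalDegree ≤ q.totalDegree := by
  refine totalDegree_aeval_le _ (fun x => ?_) q
  refine (totalDegree_sub _ _).trans ?_
  rw [totalDegree_X, totalDegree_X, max_self]

open Classical in
theorem pderiv_rename_eq_sum {S : Type*} [Fintype S] (f : S → W) (w : W) (q : MvPolynomial S R) :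
    pderiv w (rename f q) = ∑ s, if f s = w then rename f (pderiv s q) else 0 := by
  induction q using MvPolynomial.induction_on with
  | C a => simp
  | add p q hp hq =>
    simp only [map_add, hp, hq, ← Finset.sum_add_distrib]
    exact Finset.sum_congr rfl fun s _ => by split_ifs <;> simp
  | mul_X p y hp =>
    have h : ∀ s, (if f s = w then rename f (pderiv s (p * X y)) else 0) =
        (if f s = w then rename f (pderiv s p) else 0) * X (f y) +
          if s = y then (if f y = w then rename f p else 0) else 0 := by
      intro s
      rw [Derivation.leibniz, pderiv_X, Pi.single_apply]
      by_cases hs : s = y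
      · subst hs
        by_cases hw : f s = w
        · simp only [hw, if_true, smul_eq_mul, map_add, map_mul, rename_X, mul_one]; ring
        · simp only [hw, if_false, if_true]; ring
      · rw [if_neg hs, if_neg (Ne.symm hs)]
        split_ifs <;> simp; ring
    rw [Finset.sum_congr rfl fun s _ => h s, Finset.sum_add_distrib, ← Finset.sum_mul, ← hp,
      Finset.sum_ite_eq', if_pos (Finset.mem_univ y), map_mul, rename_X, Derivation.leibniz,
      pderiv_X, Pi.single_apply]
    by_cases hw : f y = w
    · subst hw; simp; ring
    · rw [if_neg hw, if_neg hw]; simp; ring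

end IterPderiv

/-! ### Averages of test functions over translations -/

section Average

open MeasureTheory MvPolynomial

variable {d k : ℕ}

theorem continuous_diagonal {V : Type*} (u : V → Space d) :
    Continuous fun z : Space d => fun j => u j + z := by fun_prop

theorem hasCompactSupport_diagonal {V : Type*} [Fintype V] [Nonempty V] {f : (V → Space d) → ℝ}
    (hf : HasCompactSupport f) (u : V → Space d) :
    HasCompactSupport fun z : Space d => f (fun j => u j + z) := by
  obtain ⟨R, hR⟩ := hf.isBounded.subset_closedBall 0
  obtain ⟨j⟩ := ‹Nonempty V›
  refine HasCompactSupport.intro (isCompact_closedBall 0 (R + ‖u j‖)) fun z hz => ?_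
  by_contra h
  refine hz (mem_closedBall_zero_iff.2 ?_)
  have h1 := (norm_le_pi_norm (fun j => u j + z) j).trans
    (mem_closedBall_zero_iff.1 (hR (subset_tsupport _ h)))
  have h2 : z = (u j + z) - u j := by abel
  rw [h2]
  exact (norm_sub_le _ _).trans (add_le_add h1 le_rfl)

/-- Differentiation of averages over translations. -/
theorem hasDerivAt_integral_diagonal {V : Type*} [Fintype V] [Nonempty V] {f : (V → Space d) → ℝ}
    (hf : ContDiff ℝ ∞ f) (hc : HasCompactSupport f) (u w : V → Space d) :
    HasDerivAt (fun t : ℝ => ∫ z, f (fun j => (u + t • w) j + z))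
      (∫ z, partialDeriv w f (fun j => u j + z)) 0 := by
  have hf' : Continuous (partialDeriv w f) :=
    (hf.continuous_fderiv (by simp)).clm_apply continuous_const
  have hc' : HasCompactSupport (partialDeriv w f) := hc.fderiv_apply ℝ w
  obtain ⟨M, hM⟩ := hc'.exists_bound_of_continuous hf'
  obtain ⟨R, hR⟩ := hc'.isBounded.subset_closedBall 0
  obtain ⟨j⟩ := ‹Nonempty V›
  have : Nonempty V := ⟨j⟩
  have key := (hasDerivAt_integral_of_dominated_loc_of_deriv_le (μ := volume) (𝕜 := ℝ) (x₀ := 0)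
    (F := fun (t : ℝ) (z : Space d) => f (fun j => (u + t • w) j + z))
    (F' := fun t z => partialDeriv w f (fun j => (u + t • w) j + z)) (s := Metric.ball 0 1)
    (bound := (Metric.closedBall (0 : Space d) (R + (‖u j‖ + ‖w j‖))).indicator fun _ => M)
    (Metric.ball_mem_nhds _ one_pos)
    (Filter.Eventually.of_forall fun t =>
      (hf.continuous.comp (continuous_diagonal _)).aestronglyMeasurable)
    ((hf.continuous.comp (continuous_diagonal _)).integrable_of_hasCompactSupport
      (hasCompactSupport_diagonal hc _))
    (hf'.comp (continuous_diagonal _)).aestronglyMeasurable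
    (Filter.Eventually.of_forall fun z t ht => ?_)
    ((integrable_indicator_iff measurableSet_closedBall).2
      (integrableOn_const (measure_closedBall_lt_top).ne))
    (Filter.Eventually.of_forall fun z t _ => ?_)).2
  · simpa using key
  · by_cases hz : z ∈ Metric.closedBall (0 : Space d) (R + (‖u j‖ + ‖w j‖))
    · rw [Set.indicator_of_mem hz]; exact hM _
    · rw [Set.indicator_of_notMem hz]
      refine (norm_eq_zero.2 ?_).le
      by_contra h
      refine hz (mem_closedBall_zero_iff.2 ?_)
      have h1 := (norm_le_pi_norm (fun j => (u + t • w) j + z) j).trans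
        (mem_closedBall_zero_iff.1 (hR (subset_tsupport _ h)))
      have h2 : z = ((u + t • w) j + z) - (u + t • w) j := by abel
      rw [h2]
      refine (norm_sub_le _ _).trans (add_le_add h1 ?_)
      refine (norm_add_le _ _).trans (add_le_add le_rfl ?_)
      rw [Pi.smul_apply, norm_smul]
      exact mul_le_of_le_one_left (norm_nonneg _) (mem_ball_zero_iff.1 ht).le
  · have h1 : HasDerivAt (fun t : ℝ => (fun j => (u + t • w) j + z : V → Space d)) w t := by
      refine hasDerivAt_pi.2 fun j => ?_
      have : HasDerivAt (fun t : ℝ => u j + t • w j + z) (w j) t := by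
        simpa using (((hasDerivAt_id t).smul_const (w j)).const_add (u j)).add_const z
      exact this
    exact ((hf.differentiable (by simp)) _).hasFDerivAt.comp_hasDerivAt t h1

/-- The average of `f` over all translations is given by the polynomial `q` on the ball of
radius `C`. -/
structure HasPolyAverage (C : ℝ) (f : (Fin (k + 1) → Space d) → ℝ)
    (q : MvPolynomial (Fin (k + 1) × Fin d) ℝ) : Prop where
  smooth : ContDiff ℝ ∞ f
  compact : HasCompactSupport f
  average : ∀ u, ‖u‖ < C → ∫ z, f (fun j => u j + z) = evalAt q u

theorem HasPolyAverage.partialDeriv {C : ℝ} {f : (Fin (k + 1) → Space d) → ℝ}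
    {q : MvPolynomial (Fin (k + 1) × Fin d) ℝ} (h : HasPolyAverage C f q) (j : Fin (k + 1))
    (i : Fin d) : HasPolyAverage C
      (partialDeriv (Pi.single j (EuclideanSpace.single i 1)) f) (pderiv (j, i) q) where
  smooth := (h.smooth.fderiv_right (m := ∞) (by simp)).clm_apply contDiff_const
  compact := h.compact.fderiv_apply ℝ _
  average u hu := by
    refine (hasDerivAt_integral_diagonal h.smooth h.compact u
      (Pi.single j (EuclideanSpace.single i 1))).unique ?_
    have h1 := hasDerivAt_evalAt q j i u
    refine HasDerivAt.congr_of_eventuallyEq (by convert h1) ?_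
    have h2 : Filter.Tendsto (fun t : ℝ => ‖u + t • (Pi.single j (EuclideanSpace.single i 1) :
        Fin (k + 1) → Space d)‖) (nhds 0) (nhds ‖u‖) := by
      have : Continuous fun t : ℝ => ‖u + t • (Pi.single j (EuclideanSpace.single i 1) :
        Fin (k + 1) → Space d)‖ := by fun_prop
      simpa using this.tendsto 0
    filter_upwards [h2.eventually_lt_const hu] with t ht
    convert h.average _ ht

theorem HasPolyAverage.iterate {C : ℝ} {f : (Fin (k + 1) → Space d) → ℝ}
    {q : MvPolynomial (Fin (k + 1) × Fin d) ℝ} {s : Fin (k + 1) × Fin d →₀ ℕ}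
    (h : HasPolyAverage C f (iterPderiv s q)) (j : Fin (k + 1)) (i : Fin d) (n : ℕ) :
    HasPolyAverage C ((Feynman.partialDeriv (Pi.single j (EuclideanSpace.single i 1)))^[n] f)
      (iterPderiv (s + Finsupp.single (j, i) n) q) := by
  induction n with
  | zero => simpa using h
  | succ n ih =>
    rw [Function.iterate_succ_apply', Finsupp.single_add, ← add_assoc, iterPderiv_add_single]
    exact ih.partialDeriv j i

theorem HasPolyAverage.multiDeriv {C : ℝ} {f : (Fin (k + 1) → Space d) → ℝ}
    {q : MvPolynomial (Fin (k + 1) × Fin d) ℝ} {s : Fin (k + 1) × Fin d →₀ ℕ}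
    (h : HasPolyAverage C f (iterPderiv s q)) (j : Fin (k + 1)) (n : MultiIndex d) :
    HasPolyAverage C (Feynman.multiDeriv
        (fun i => Pi.single j (EuclideanSpace.single i 1)) n f)
      (iterPderiv (s + ∑ i, Finsupp.single (j, i) (n i)) q) := by
  unfold Feynman.multiDeriv
  rw [Fin.sum_univ_def]
  induction List.finRange d with
  | nil => simpa using h
  | cons a l ih =>
    rw [List.foldr_cons, List.map_cons, List.sum_cons, add_comm (Finsupp.single _ _), ← add_assoc]
    exact ih.iterate j a _

/-- Derivatives of test functions become derivatives of polynomials. -/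
theorem HasPolyAverage.legDeriv {C : ℝ} {f : (Fin (k + 1) → Space d) → ℝ}
    {q : MvPolynomial (Fin (k + 1) × Fin d) ℝ} (h : HasPolyAverage C f q)
    (l : Fin (k + 1) → MultiIndex d) :
    HasPolyAverage C (Feynman.legDeriv l f) (iterPderiv (expo l) q) := by
  have h1 : expo l = 0 + ∑ j, ∑ i, Finsupp.single (j, i) (l j i) := by
    rw [zero_add]
    ext ⟨j, i⟩
    simp only [expo_apply, Finsupp.finsetSum_apply]
    rw [Finset.sum_eq_single j, Finset.sum_eq_single i]
    · simp
    · intro i' _ hi'; simp [hi']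
    · simp
    · intro j' _ hj'; simp [hj']
    · simp
  rw [h1]
  have h0 : HasPolyAverage C f (iterPderiv 0 q) := by rwa [iterPderiv_zero]
  unfold Feynman.legDeriv
  rw [Fin.sum_univ_def]
  induction List.finRange (k + 1) with
  | nil => simpa using h0
  | cons a l' ih =>
    rw [List.foldr_cons, List.map_cons, List.sum_cons, add_comm (∑ i, _), ← add_assoc]
    exact ih.multiDeriv a _

/-- The polynomial in the differences of the positions of the legs. -/
def legPoly (P : MvPolynomial (Fin k × Fin d) ℝ) : MvPolynomial (Fin (k + 1) × Fin d) ℝ :=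
  recenter 0 (rename (Prod.map Fin.succ id) P)

theorem evalAt_legPoly (P : MvPolynomial (Fin k × Fin d) ℝ) (x : Fin (k + 1) → Space d) :
    evalAt (legPoly P) x =
      eval (fun p : Fin k × Fin d => (x p.1.succ - x 0) p.2) P := by
  rw [legPoly, evalAt_recenter, evalAt, eval_rename]
  rfl

/-- The average of `φ = φ₀ φ₁` over translations is the one of `φ₁`, multiplied by `φ₀`. -/
theorem hasPolyAverage_of_mul {C : ℝ} {φ φ₀ φ₁ : (Fin (k + 1) → Space d) → ℝ}
    {P : MvPolynomial (Fin k × Fin d) ℝ} (hs : ContDiff ℝ ∞ φ) (hc : HasCompactSupport φ)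
    (hφ : ∀ x, φ x = φ₀ x * φ₁ x) (h₁ : ∀ x y, ∑ i, x i = ∑ i, y i → φ₁ x = φ₁ y)
    (h₀ : ∀ x y, (∀ i j, x i - x j = y i - y j) → φ₀ x = φ₀ y)
    (hC : ∀ x, ‖x‖ ≤ C →
      φ₀ x = eval (fun p : Fin k × Fin d => (x p.1.succ - x 0) p.2) P) :
    HasPolyAverage C φ ((∫ z, φ₁ fun _ => z) • legPoly P) := by
  refine ⟨hs, hc, fun u hu => ?_⟩
  -- only the mean of the positions matters for `φ₁`; it is removed by translating `z`
  have h2 : ∀ z, φ (fun j => u j + z) = evalAt (legPoly P) u * φ₁ fun _ =>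
      (z + ((k + 1 : ℕ) : ℝ)⁻¹ • ∑ i, u i) := by
    intro z
    rw [hφ, h₀ _ u (by simp), hC u hu.le, evalAt_legPoly]
    congr 1
    refine h₁ _ _ ?_
    rw [Finset.sum_add_distrib, Finset.sum_const, Finset.sum_const, Finset.card_univ,
      Fintype.card_fin, nsmul_add, ← Nat.cast_smul_eq_nsmul ℝ (k + 1) (_ • _), smul_smul,
      mul_inv_cancel₀ (Nat.cast_ne_zero.2 k.succ_ne_zero), one_smul, add_comm]
  simp only [h2]
  rw [integral_const_mul, integral_add_right_eq_self (fun z : Space d => φ₁ fun _ => z)]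
  simp only [evalAt, smul_eval, mul_comm]

theorem contDiff_eval_sub (P : MvPolynomial (Fin k × Fin d) ℝ) :
    ContDiff ℝ ∞ fun x : Fin (k + 1) → Space d =>
      eval (fun p : Fin k × Fin d => (x p.1.succ - x 0) p.2) P := by
  induction P using MvPolynomial.induction_on with
  | C a => simp only [eval_C]; exact contDiff_const
  | add p q hp hq => simp only [map_add]; exact hp.add hq
  | mul_X p y hp =>
    simp only [map_mul, eval_X]
    have h : ContDiff ℝ ∞ fun x : Fin (k + 1) → Space d => x y.1.succ - x 0 := by fun_prop
    exact hp.mul ((EuclideanSpace.proj (𝕜 := ℝ) y.2).contDiff.comp h)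

theorem exists_contDiffBump_of_le (R : ℝ) :
    ∃ b : ContDiffBump (0 : Space d), ∀ x, ‖x‖ ≤ R → b x = 1 := by
  refine ⟨⟨max R 1, max R 1 + 1, by positivity, by linarith⟩, fun x hx => ?_⟩
  exact ContDiffBump.one_of_mem_closedBall _ (mem_closedBall_zero_iff.2 (hx.trans (le_max_left _ _)))

/-- For every polynomial there is an admissible test function with nonvanishing average. -/
theorem exists_isPolyTest (a C : ℝ) (P : MvPolynomial (Fin k × Fin d) ℝ)
    (hP : (P.totalDegree : ℝ) + a ≤ 0) : ∃ (φ : (Fin (k + 1) → Space d) → ℝ) (c : ℝ), c ≠ 0 ∧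
      IsPolyTest k a C φ ∧ HasPolyAverage C φ (c • legPoly P) := by
  -- `b` localises the differences, which are at most `2 C` in the relevant ball, and `b'` the sum
  obtain ⟨b, hb⟩ := exists_contDiffBump_of_le (d := d) (C + C)
  obtain ⟨b', -⟩ := exists_contDiffBump_of_le (d := d) 1
  let φ₀ : (Fin (k + 1) → Space d) → ℝ := fun x =>
    eval (fun p : Fin k × Fin d => (x p.1.succ - x 0) p.2) P * ∏ j : Fin k, b (x j.succ - x 0)
  let φ₁ : (Fin (k + 1) → Space d) → ℝ := fun x => b' (∑ i, x i)
  have hs : ContDiff ℝ ∞ fun x => φ₀ x * φ₁ x := by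
    refine ContDiff.mul (ContDiff.mul (contDiff_eval_sub P) ?_) ?_
    · refine contDiff_prod fun j _ => b.contDiff.comp ?_
      fun_prop
    · refine b'.contDiff.comp ?_
      fun_prop
  have hc : HasCompactSupport fun x => φ₀ x * φ₁ x := by
    refine HasCompactSupport.intro (isCompact_closedBall 0
      (b'.rOut + ∑ _j : Fin k, b.rOut + b.rOut)) fun x hx => ?_
    by_contra h
    refine hx (mem_closedBall_zero_iff.2 ?_)
    have hsupp : ∀ (b : ContDiffBump (0 : Space d)) (y : Space d), b y ≠ 0 → ‖y‖ ≤ b.rOut := by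
      intro b y hy
      have : y ∈ Function.support b := hy
      rw [b.support_eq] at this
      exact (mem_ball_zero_iff.1 this).le
    have h1 : ∀ j : Fin k, ‖x j.succ - x 0‖ ≤ b.rOut := fun j => hsupp b _ fun h0 => h (by
      have h00 : ∏ j : Fin k, b (x j.succ - x 0) = 0 := Finset.prod_eq_zero (Finset.mem_univ j) h0
      simp only [φ₀, h00, mul_zero, zero_mul])
    have h2 : ‖∑ i, x i‖ ≤ b'.rOut := hsupp b' _ fun h0 => h (by simp only [φ₁, h0, mul_zero])
    have h3 : ((k + 1 : ℕ) : ℝ) • x 0 = ∑ i, x i - ∑ j : Fin k, (x j.succ - x 0) := by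
      rw [Fin.sum_univ_succ, Finset.sum_sub_distrib, Finset.sum_const, Finset.card_univ,
        Fintype.card_fin, Nat.cast_smul_eq_nsmul, add_smul, one_smul]
      abel
    have h4 : ‖x 0‖ ≤ b'.rOut + ∑ _j : Fin k, b.rOut := by
      refine le_trans ?_ ((congrArg norm h3).le.trans ((norm_sub_le _ _).trans
        (add_le_add h2 ((norm_sum_le _ _).trans (Finset.sum_le_sum fun j _ => h1 j)))))
      rw [norm_smul, Real.norm_natCast]
      refine le_mul_of_one_le_left (norm_nonneg _) ?_
      exact_mod_cast Nat.succ_pos k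
    have hb0 := b.rOut_pos
    have hb0' := b'.rOut_pos
    refine (pi_norm_le_iff_of_nonneg (by positivity)).2 fun i => ?_
    refine Fin.cases (by linarith) (fun j => ?_) i
    have h5 : x j.succ = x 0 + (x j.succ - x 0) := by abel
    rw [h5]
    exact (norm_add_le _ _).trans (add_le_add h4 (h1 j))
  have h₁ : ∀ x y : Fin (k + 1) → Space d, ∑ i, x i = ∑ i, y i → φ₁ x = φ₁ y :=
    fun x y h => by simp only [φ₁, h]
  have h₀ : ∀ x y : Fin (k + 1) → Space d, (∀ i j, x i - x j = y i - y j) → φ₀ x = φ₀ y :=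
    fun x y h => by simp only [φ₀, h]
  have hC : ∀ x : Fin (k + 1) → Space d, ‖x‖ ≤ C →
      φ₀ x = eval (fun p : Fin k × Fin d => (x p.1.succ - x 0) p.2) P := by
    intro x hx
    simp only [φ₀]
    rw [Finset.prod_eq_one, mul_one]
    exact fun j _ => hb _ ((norm_sub_le _ _).trans (add_le_add
      ((norm_le_pi_norm x _).trans hx) ((norm_le_pi_norm x _).trans hx)))
  refine ⟨fun x => φ₀ x * φ₁ x, ∫ z, φ₁ fun _ => z, ?_, ⟨hs, hc, φ₀, φ₁, P, fun _ => rfl, h₁, h₀, hP,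
    hC⟩, hasPolyAverage_of_mul hs hc (fun _ => rfl) h₁ h₀ hC⟩
  have h6 : ∀ z : Space d, (φ₁ fun _ => z) = b' (((k + 1 : ℕ) : ℝ) • z) := by
    intro z
    simp only [φ₁, Finset.sum_const, Finset.card_univ, Fintype.card_fin, Nat.cast_smul_eq_nsmul]
  simp only [h6]
  rw [Measure.integral_comp_smul]
  refine smul_ne_zero ?_ b'.integral_pos.ne'
  exact abs_ne_zero.2 (inv_ne_zero (pow_ne_zero _ (Nat.cast_ne_zero.2 k.succ_ne_zero)))

/-- The condition on the test functions becomes stronger as the radius grows. -/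
theorem IsPolyTest.mono {a C C' : ℝ} (hC : C ≤ C') {φ : (Fin (k + 1) → Space d) → ℝ}
    (h : IsPolyTest k a C' φ) : IsPolyTest k a C φ := by
  obtain ⟨hs, hc, φ₀, φ₁, P, hφ, h₁, h₀, hP, h⟩ := h
  exact ⟨hs, hc, φ₀, φ₁, P, hφ, h₁, h₀, hP, fun x hx => h x (hx.trans hC)⟩

end Average

/-! ### Renormalised valuations on polynomial test functions -/

section Valuation

open MeasureTheory MvPolynomial

variable {d k : ℕ} {𝔏 : LabelSystem d} (K : KernelAssignment 𝔏)

/-- Integrals of the kernels against a test function that averages to a polynomial. -/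
theorem integral_kerProd_mul {V E : Type*} [Fintype V] [Fintype E] (src tgt : E → V)
    (lab : E → 𝔏.Label) (leg : Fin (k + 1) → V) {C D : ℝ} (hD : DiamBound (d := d) src tgt D)
    (hD0 : 0 ≤ D) (hC : D < C) {f : (Fin (k + 1) → Space d) → ℝ}
    {q : MvPolynomial (Fin (k + 1) × Fin d) ℝ} (h : HasPolyAverage C f q) :
    ∫ x, kerProd K src tgt lab x * f (fun j => x (leg j)) =
      vacInt K src tgt lab (leg 0) (rename (Prod.map leg id) q) := by
  obtain ⟨M, hM⟩ := h.compact.isBounded.subset_closedBall 0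
  rw [integral_mul_eq_integral_extendZero (χ := fun x => f fun j => x (leg j)) (leg 0)
    (continuous_kerProd K src tgt lab) (h.smooth.continuous.comp (by fun_prop))
    (kerProd_translate K src tgt lab) D
    (fun y hy => norm_extendZero_le K src tgt lab hD (leg 0) y hy) (leg 0) M
    (fun x hx => (norm_le_pi_norm (fun j => x (leg j)) 0).trans
      (mem_closedBall_zero_iff.1 (hM (subset_tsupport _ hx))))]
  unfold vacInt
  congr 1
  funext y
  by_cases hy : kerProd K src tgt lab (extendZero (leg 0) y) = 0
  · rw [hy, zero_mul, zero_mul]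
  · refine congrArg (_ * ·) ?_
    have h1 : ‖fun j => extendZero (leg 0) y (leg j)‖ < C :=
      ((pi_norm_le_iff_of_nonneg hD0).2 fun j =>
        norm_extendZero_le K src tgt lab hD (leg 0) y hy (leg j)).trans_lt hC
    refine (h.average _ h1).trans ?_
    rw [evalAt, evalAt, eval_rename]
    rfl

theorem coeff_zero_rename {S W : Type*} (f : S → W) (q : MvPolynomial S ℝ) :
    coeff 0 (rename f q) = coeff 0 q := by
  rw [← constantCoeff_eq, ← constantCoeff_eq, constantCoeff_rename]

open Classical in
/-- For a single vertex without edges there is nothing to integrate, and the polynomial is evaluated at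
the origin. -/
theorem vacInt_of_isEmpty {V E : Type*} [Fintype V] [Fintype E] [IsEmpty E]
    (hV : ∀ u v : V, u = v) (src tgt : E → V) (lab : E → 𝔏.Label) (r : V) (q : MvPolynomial (V × Fin d) ℝ) :
    vacInt K src tgt lab r q = coeff 0 q := by
  have : IsEmpty {v : V // v ≠ r} := ⟨fun v => v.2 (hV _ _)⟩
  unfold vacInt
  rw [Measure.volume_pi_eq_dirac 0, integral_dirac]
  have h : (fun p : V × Fin d => extendZero (d := d) r 0 p.1 p.2) = 0 := by
    funext p
    rw [hV p.1 r, extendZero_self]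
    rfl
  rw [kerProd, Finset.univ_eq_empty, Finset.prod_empty, one_mul, evalAt, h, ← constantCoeff_eq]
  exact DFunLike.congr_fun eval_zero' q

/-- Contraction does not increase the diameter, so one radius serves for all contractions. -/
theorem DecoratedGraph.diamBound_contract (G : DecoratedGraph 𝔏) {D : ℝ}
    (hD : DiamBound (d := d) G.src G.tgt D) (F : Finset G.E) (l : G.HalfEdge → MultiIndex d) :
    DiamBound (d := d) (G.contract F l).src (G.contract F l).tgt D := by
  intro x hx u v
  obtain ⟨u, rfl⟩ := Quotient.exists_rep u
  obtain ⟨v, rfl⟩ := Quotient.exists_rep v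
  refine hD (fun w => x (G.cls F w)) (fun e => ?_) u v
  by_cases he : e ∈ F
  · simp only [G.cls_tgt he, sub_self, norm_zero, zero_le_one]
  · exact hx ⟨e, he⟩

namespace FeynmanDiagram

variable (Γ : FeynmanDiagram 𝔏 (k + 1)) (hΓ : Γ.toDecoratedGraph.Connected) (hE : Nonempty Γ.E)

/-- The vacuum diagram obtained from a Feynman diagram by forgetting the legs; its distinguished
vertex is the one of the first leg. -/
@[reducible] def toVacuum : VacuumDiagram 𝔏 :=
  { Γ.toDecoratedGraph with
    root := Γ.leg 0
    node := 0
    connected := hΓ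
    nonempty_edge := hE }

/-- The variables of the vertices to which the legs are attached. -/
def legMap : Fin (k + 1) × Fin d → Γ.V × Fin d := Prod.map Γ.leg id

/-- On test functions with polynomial averages, the valuation of a contraction is the value under
`Π₋^K` of the contraction of the underlying vacuum diagram; derivatives on the legs act on the
polynomial. -/
theorem valuation_quotientBy {C D : ℝ} (hD : DiamBound (d := d) Γ.src Γ.tgt D) (hD0 : 0 ≤ D)
    (hC : D < C) {φ : (Fin (k + 1) → Space d) → ℝ} {q : MvPolynomial (Fin (k + 1) × Fin d) ℝ}
    (h : HasPolyAverage C φ q) (F : Finset Γ.E) (l : Γ.toDecoratedGraph.HalfEdge → MultiIndex d)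
    (n : Fin (k + 1) → MultiIndex d) : (Γ.quotientBy F l n).valuation K φ =
      (Γ.toVacuum hΓ hE).quotFun F (vacAlg K) Γ.label (Γ.leg 0) (expo l)
        (rename Γ.legMap (iterPderiv (expo (Γ.legIndex + n)) q)) := by
  have h1 := integral_kerProd_mul K (Γ.toDecoratedGraph.contract F l).src
    (Γ.toDecoratedGraph.contract F l).tgt (Γ.toDecoratedGraph.contract F l).label
    (fun j => Γ.toDecoratedGraph.cls F (Γ.leg j)) (Γ.toDecoratedGraph.diamBound_contract hD F l)
    hD0 hC (h.legDeriv (Γ.legIndex + n))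
  refine Eq.trans (by rfl) (h1.trans ?_)
  by_cases hF : Nonempty {e : Γ.E // e ∉ F}
  · rw [VacuumDiagram.quotFun_of_nonempty _ _ _ _ _ _ hF, nodeFun_vacAlg, rename_rename]
    rfl
  · rw [VacuumDiagram.quotFun_of_not_nonempty _ _ _ _ _ _ hF]
    have hE' : IsEmpty (Γ.toDecoratedGraph.contract F l).E := not_nonempty_iff.1 hF
    have hV : ∀ u v : (Γ.toDecoratedGraph.contract F l).V, u = v := by
      intro u v
      have := (Γ.toDecoratedGraph.connected_contract hΓ F l).2 u v
      induction this with
      | rel a b h => obtain ⟨e, -⟩ := h; exact isEmptyElim e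
      | refl a => rfl
      | symm a b _ ih => exact ih.symm
      | trans a b c _ _ ih1 ih2 => exact ih1.trans ih2
    exact (vacInt_of_isEmpty K hV _ _ _ _ _).trans
      ((coeff_zero_rename _ _).trans (coeff_zero_rename _ _).symm)

/-- On test functions with polynomial averages, the renormalised valuation is the sum over all
subgraphs that defines the coproduct of the underlying vacuum diagram. -/
theorem renormValuation_eq_sum_term {C D : ℝ} (hD : DiamBound (d := d) Γ.src Γ.tgt D) (hD0 : 0 ≤ D)
    (hC : D < C) {φ : (Fin (k + 1) → Space d) → ℝ} {q : MvPolynomial (Fin (k + 1) × Fin d) ℝ}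
    (h : HasPolyAverage C φ q) (g : Character 𝔏) : Γ.renormValuation K g φ =
      ∑ F, (Γ.toVacuum hΓ hE).term F (g.comp toHMinus) (vacAlg K) Γ.label Quotient.out
        (fun c => Quotient.out_eq c) (Γ.leg 0)
        (rename Γ.legMap (iterPderiv (expo Γ.legIndex) q)) := by
  classical
  set Λ : HMinus 𝔏 ⊗[ℝ] (FeynmanDiagram 𝔏 (k + 1) →₀ ℝ) →ₗ[ℝ] ℝ :=
    (Finsupp.linearCombination ℝ fun Γ' : FeynmanDiagram 𝔏 (k + 1) => Γ'.valuation K φ).comp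
      ((TensorProduct.lid ℝ _).toLinearMap.comp
        (TensorProduct.map g.toLinearMap LinearMap.id)) with hΛ
  have h0 : Γ.renormValuation K g φ = Λ Γ.coaction := rfl
  have hΛ' : ∀ x Γ', Λ (x ⊗ₜ Finsupp.single Γ' 1) = g x * Γ'.valuation K φ := by
    intro x Γ'
    simp [hΛ]
  rw [h0, coaction, map_sum]
  refine Finset.sum_congr rfl fun F _ => ?_
  have hK : KillsPositive (g.comp (toHMinus (𝔏 := 𝔏))) := killsPositive_toHMinus.comp g
  have h1 := Γ.toDecoratedGraph.finsum_extract_mul F Γ.leg hK Quotient.out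
    (fun c => Quotient.out_eq c) (fun p => (-1) ^ Γ.toDecoratedGraph.outSize p.1 *
      (Γ.quotientBy F p.1 p.2).valuation K φ)
  have h2 := monoFun_pull_eq_opPair (Γ.toVacuum hΓ hE).halfVar Γ.legMap
    ((Γ.toVacuum hΓ hE).quotVal F (vacAlg K) Γ.label (Γ.leg 0))
    (fun s => if ∀ h : Γ.toDecoratedGraph.HalfEdge, h.1 ∈ F → (pairEquiv s).1 h = 0 then
      (-1) ^ Γ.toDecoratedGraph.outSize (pairEquiv s).1 *
        (Γ.quotientBy F (pairEquiv s).1 (pairEquiv s).2).valuation K φ else 0)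
    (fun s => rename Γ.legMap (iterPderiv (expo Γ.legIndex + s) q))
    (fun s => by
      have e1 : expo (pairEquiv s).1 = s.comapDomain Sum.inl Sum.inl_injective.injOn :=
        expo_deco _
      have e2 : expo (Γ.legIndex + (pairEquiv s).2) =
          expo Γ.legIndex + s.comapDomain Sum.inr Sum.inr_injective.injOn := by ext x; rfl
      rw [VacuumDiagram.monoFun_quotVal, Γ.valuation_quotientBy K hΓ hE hD hD0 hC h, e1, e2]
      exact if_congr Iff.rfl rfl rfl)
    (fun s w => by
      rw [pderiv_rename_eq_sum]
      refine Finset.sum_congr rfl fun j _ => ?_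
      by_cases hj : Γ.legMap j = w
      · rw [if_pos hj, if_pos hj, ← iterPderiv_add_single, add_assoc]
      · rw [if_neg hj, if_neg hj])
    (Γ.toDecoratedGraph.extractSymbol F (g.comp toHMinus) Γ.label Quotient.out
      (fun c => Quotient.out_eq c))
  rw [add_zero] at h2
  refine Eq.trans ?_ (h1.trans h2)
  rw [show Λ (∑ᶠ p ∈ _, _) = _ from AddMonoidHom.map_finsum_mem' Λ.toAddMonoidHom ?_]
  · refine finsum_congr fun p => finsum_congr_Prop ?_ fun hp => ?_
    · rfl
    · rw [show ∀ x, Λ.toAddMonoidHom x = Λ x from fun _ => rfl, map_smul, hΛ', smul_eq_mul,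
        smul_eq_mul, div_eq_inv_mul, mul_assoc]
      refine congrArg ((((∏ h, ((p.1 h).fact : ℝ)) * ∏ j, ((p.2 j).fact : ℝ))⁻¹ : ℝ) * ·) ?_
      rw [mul_left_comm]
      rfl
  · refine (Γ.toDecoratedGraph.finite_extract_ne_zero F Γ.leg killsPositive_toHMinus Quotient.out
      (fun c => Quotient.out_eq c)).subset ?_
    rintro p ⟨hp, hp'⟩
    refine ⟨hp, fun h => hp' ?_⟩
    change _ • (toHMinus (Γ.toDecoratedGraph.extract F _ _
      (Γ.toDecoratedGraph.legSum Γ.leg p)) ⊗ₜ _) = _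
    rw [h, TensorProduct.zero_tmul, smul_zero]

end FeynmanDiagram

end Valuation

/-! ### The BPHZ character -/

section BPHZ

open MeasureTheory MvPolynomial

variable {d : ℕ} {𝔏 : LabelSystem d}

theorem respectsBelow_comp_toHHat {R : Type*} [CommRing R] [Algebra ℝ R] (β : HHat 𝔏 →ₐ[ℝ] R)
    (N : ℕ) : RespectsBelow N (β.comp toHHat) :=
  respectsBelow_of_relIdeal (fun x hx => by
    have : toHHat x = 0 := Ideal.Quotient.eq_zero_iff_mem.2 hx
    rw [AlgHom.comp_apply, this, map_zero]) N

namespace VacuumDiagram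

variable (Γ : VacuumDiagram 𝔏)

/-- The sum over all subgraphs at a monomial is the convolution at the corresponding diagram. -/
theorem sum_term_monomial {R : Type*} [CommRing R] [Algebra ℝ R] (α : HMinus 𝔏 →ₐ[ℝ] R)
    (β : HHat 𝔏 →ₐ[ℝ] R) (lab : Γ.E → 𝔏.Label) (r : Γ.V) (n : Γ.V → MultiIndex d) :
    ∑ F, Γ.term F (α.comp toHMinus) (β.comp toHHat) lab (Γ.rootAt r F) (Γ.cls_rootAt r F) r
        (monomial (expo n) 1) =
      LinearMap.mul' ℝ R (TensorProduct.map α.toLinearMap β.toLinearMap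
        (Γ.vary lab r n).coproduct) :=
  ((Γ.vary lab r n).map_coproduct α β).symm

/-- A convolution that vanishes on all diagrams of nonpositive degree vanishes on all polynomial
decorations of sufficiently low degree. -/
theorem sum_term_eq_zero (α : HMinus 𝔏 →ₐ[ℝ] ℝ) (β : HHat 𝔏 →ₐ[ℝ] ℝ)
    (h : ∀ Γ : VacuumDiagram 𝔏, Γ.degree ≤ 0 →
      LinearMap.mul' ℝ ℝ (TensorProduct.map α.toLinearMap β.toLinearMap Γ.coproduct) = 0)
    (r : Γ.V) (q : MvPolynomial (Γ.V × Fin d) ℝ)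
    (hq : (q.totalDegree : ℝ) + Γ.toDecoratedGraph.deg ≤ 0) :
    ∑ F, Γ.term F (α.comp toHMinus) (β.comp toHHat) Γ.label (Γ.rootAt r F) (Γ.cls_rootAt r F) r q
      = 0 := by
  let f : MvPolynomial (Γ.V × Fin d) ℝ →ₗ[ℝ] ℝ :=
    ∑ F, opPair (Γ.quotVal F (β.comp toHHat) Γ.label r) (Γ.pullSymbol
      (Γ.toDecoratedGraph.extractSymbol F (α.comp toHMinus) Γ.label (Γ.rootAt r F)
        (Γ.cls_rootAt r F)))
  have hf : ∀ q, f q = ∑ F, Γ.term F (α.comp toHMinus) (β.comp toHHat) Γ.label (Γ.rootAt r F)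
      (Γ.cls_rootAt r F) r q := fun q => LinearMap.sum_apply _ _ _
  rw [← hf, q.as_sum, map_sum]
  refine Finset.sum_eq_zero fun s hs => ?_
  rw [← mul_one (coeff s q), ← smul_eq_mul, ← smul_monomial, map_smul, hf]
  have h1 := Γ.sum_term_monomial α β Γ.label r (deco s)
  rw [expo_deco] at h1
  rw [h1, h, smul_zero]
  have h2 : (Finsupp.degree s : ℕ) ≤ q.totalDegree := by
    refine le_trans (le_of_eq ?_) (le_totalDegree hs)
    rw [Finsupp.degree_eq_sum, Finsupp.sum_fintype _ _ fun _ => rfl]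
  have h3 : ((Finsupp.degree s : ℕ) : ℝ) ≤ q.totalDegree := Nat.cast_le.2 h2
  rw [degree_vary]
  have h4 : Γ.toDecoratedGraph.deg = ∑ e, 𝔏.deg (Γ.label e) +
    (d : ℝ) * ((Fintype.card Γ.V : ℝ) - 1) := rfl
  linarith

/-- The sum over all subgraphs is linear in the polynomial and unchanged under recentring at the
distinguished vertex. -/
theorem sum_term_smul_recenter {R : Type*} [CommRing R] [Algebra ℝ R] (α : HMinus 𝔏 →ₐ[ℝ] R)
    (β : HHat 𝔏 →ₐ[ℝ] R) (lab : Γ.E → 𝔏.Label) (r : Γ.V) (c : R)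
    (q : MvPolynomial (Γ.V × Fin d) R) :
    ∑ F, Γ.term F (α.comp toHMinus) (β.comp toHHat) lab (Γ.rootAt r F) (Γ.cls_rootAt r F) r
        (c • recenter r q) =
      c * ∑ F, Γ.term F (α.comp toHMinus) (β.comp toHHat) lab (Γ.rootAt r F) (Γ.cls_rootAt r F) r
        q := by
  rw [Finset.mul_sum]
  refine Finset.sum_congr rfl fun F _ => ?_
  rw [Γ.term_move F (respectsBelow_comp_toHMinus α _) (killsPositive_toHMinus.comp α)
    (Nat.lt_succ_self _) (respectsBelow_comp_toHHat β) lab _ _ (Γ.cls_rootAt r F)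
    (Γ.cls_rootAt r F) r (Γ.rootAt_cls r F) r q]
  exact LinearMap.map_smul (opPair _ _) c _

end VacuumDiagram

variable (K : KernelAssignment 𝔏)

theorem mul'_map_bphz (x : HMinus 𝔏 ⊗[ℝ] HHat 𝔏) :
    LinearMap.mul' ℝ ℝ (TensorProduct.map ((vacCharacter K).comp (antipode 𝔏)).toLinearMap
      (vacCharacter K).toLinearMap x) =
    vacCharacter K (LinearMap.mul' ℝ (HHat 𝔏)
      (TensorProduct.map (antipode 𝔏).toLinearMap LinearMap.id x)) := by
  induction x using TensorProduct.induction_on with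
  | zero => simp
  | tmul a b => simp
  | add x y hx hy => simp only [map_add, hx, hy]

/-- The convolution of the BPHZ character with `Π₋^K` vanishes on diagrams of nonpositive degree, by the
defining property of the twisted antipode. -/
theorem mul'_map_bphz_coproduct (Γ : VacuumDiagram 𝔏) (hΓ : Γ.degree ≤ 0) :
    LinearMap.mul' ℝ ℝ (TensorProduct.map ((vacCharacter K).comp (antipode 𝔏)).toLinearMap
      (vacCharacter K).toLinearMap Γ.coproduct) = 0 := by
  rw [mul'_map_bphz, isTwistedAntipode_antipode Γ hΓ, map_zero]

namespace FeynmanDiagram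

variable {k : ℕ} (Γ : FeynmanDiagram 𝔏 (k + 1)) (hΓ : Γ.toDecoratedGraph.Connected)
  (hE : Nonempty Γ.E)

include hΓ in
theorem exists_diamBound : ∃ D : ℝ, 0 ≤ D ∧ DiamBound (d := d) Γ.src Γ.tgt D := by
  obtain ⟨D, hD⟩ := Feynman.exists_diamBound (d := d) Γ.src Γ.tgt hΓ.2
  refine ⟨D, ?_, hD⟩
  simpa using hD 0 (fun e => by simp) (Γ.leg 0) (Γ.leg 0)

/-- The polynomial by which a renormalised valuation acts is invariant under translations, so that
the distinguished vertices of the components of subgraphs can be chosen at will. -/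
theorem renormValuation_eq_sum_term_rootAt {C D : ℝ} (hD : DiamBound (d := d) Γ.src Γ.tgt D)
    (hD0 : 0 ≤ D) (hC : D < C) {φ : (Fin (k + 1) → Space d) → ℝ}
    {P : MvPolynomial (Fin k × Fin d) ℝ} {c : ℝ} (h : HasPolyAverage C φ (c • legPoly P))
    (g : Character 𝔏) : Γ.renormValuation K g φ =
      ∑ F, (Γ.toVacuum hΓ hE).term F (g.comp toHMinus) ((vacCharacter K).comp toHHat) Γ.label
        ((Γ.toVacuum hΓ hE).rootAt (Γ.leg 0) F) ((Γ.toVacuum hΓ hE).cls_rootAt (Γ.leg 0) F)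
        (Γ.leg 0) (rename Γ.legMap (iterPderiv (expo Γ.legIndex) (c • legPoly P))) := by
  classical
  have hinv : ∀ i, ∑ v, pderiv (v, i)
      (rename Γ.legMap (iterPderiv (expo Γ.legIndex) (c • legPoly P))) = 0 := by
    intro i
    have h1 : ∀ i, ∑ j, pderiv (j, i) (c • legPoly P) = 0 := by
      intro i
      rw [legPoly, ← map_smul, sum_pderiv_recenter]
    have h2 := congrArg (rename Γ.legMap) (sum_pderiv_iterPderiv h1 (expo Γ.legIndex) i)
    rw [map_sum, map_zero] at h2
    simp only [pderiv_rename_eq_sum]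
    rw [Finset.sum_comm, Fintype.sum_prod_type]
    refine Eq.trans ?_ h2
    refine Finset.sum_congr rfl fun j _ => ?_
    rw [Finset.sum_eq_single i, Finset.sum_eq_single (Γ.leg j)]
    · exact if_pos rfl
    · intro v _ hv
      rw [if_neg fun h => hv (congrArg Prod.fst h).symm]
    · simp
    · intro i' _ hi'
      exact Finset.sum_eq_zero fun v _ => if_neg fun h => hi' (congrArg Prod.snd h)
    · simp
  rw [Γ.renormValuation_eq_sum_term K hΓ hE hD hD0 hC h g, vacCharacter_comp_toHHat]
  refine Finset.sum_congr rfl fun F _ => ?_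
  exact (Γ.toVacuum hΓ hE).term_eq_term F (respectsBelow_comp_toHMinus g _)
    (killsPositive_toHMinus.comp g) (Nat.lt_succ_self _) (respectsBelow_vacAlg K) _ _ _ _ _ _ _
    (Or.inl hinv)

include hΓ hE in
/-- The BPHZ renormalised valuation vanishes on polynomial test functions of low degree. -/
theorem exists_renormValuation_bphz_eq_zero : ∃ C : ℝ, ∀ (K : KernelAssignment 𝔏),
    ∀ φ : (Fin (k + 1) → Space d) → ℝ, IsPolyTest k Γ.toDecoratedGraph.deg C φ →
      Γ.renormValuation K ((vacCharacter K).comp (antipode 𝔏)) φ = 0 := by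
  obtain ⟨D, hD0, hD⟩ := Γ.exists_diamBound hΓ
  refine ⟨D + 1, fun K φ hφ => ?_⟩
  obtain ⟨hs, hc, φ₀, φ₁, P, hφ, h₁, h₀, hP, hC⟩ := hφ
  rw [Γ.renormValuation_eq_sum_term_rootAt K hΓ hE hD hD0 (lt_add_one D)
    (hasPolyAverage_of_mul hs hc hφ h₁ h₀ hC)]
  refine (Γ.toVacuum hΓ hE).sum_term_eq_zero _ _ (mul'_map_bphz_coproduct K) _ _ ?_
  refine le_trans (add_le_add (Nat.cast_le.2 ?_) le_rfl) hP
  refine (totalDegree_rename_le _ _).trans ((totalDegree_iterPderiv_le _ _).trans ?_)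
  exact (totalDegree_smul_le _ _).trans
    ((totalDegree_recenter_le _ _).trans (totalDegree_rename_le _ _))

end FeynmanDiagram

end BPHZ

/-! ### Characterisation by vanishing -/

section Converse

open MeasureTheory MvPolynomial

variable {d k : ℕ} {𝔏 : LabelSystem d} (K : KernelAssignment 𝔏)

namespace VacuumDiagram

variable (Γ : VacuumDiagram 𝔏) (e : Fin (k + 1) ≃ Γ.V)

/-- The Feynman diagram with one leg at every vertex. -/
def withLegs : FeynmanDiagram 𝔏 (k + 1) :=
  { Γ.toDecoratedGraph with
    leg := e
    legIndex := 0
    exists_leg := fun v => ⟨e.symm v, by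
      rw [e.apply_symm_apply]; exact Relation.EqvGen.refl v⟩ }

/-- The monomial with exponent given by the node decoration, in the variables of all legs but the
first one. -/
def nodePoly : MvPolynomial (Fin k × Fin d) ℝ :=
  monomial (expo fun j => Γ.node (e j.succ)) 1

theorem totalDegree_nodePoly_add_le :
    ((Γ.nodePoly e).totalDegree : ℝ) + Γ.toDecoratedGraph.deg ≤ Γ.degree := by
  have h1 : (Γ.nodePoly e).totalDegree ≤ ∑ v, (Γ.node v).size := by
    refine (totalDegree_monomial_le _ _).trans ?_
    rw [Finsupp.sum_fintype _ _ fun _ => rfl, Fintype.sum_prod_type, ← e.sum_comp,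
      Fin.sum_univ_succ]
    exact le_add_left le_rfl
  have h2 : ((Γ.nodePoly e).totalDegree : ℝ) ≤ ∑ v, ((Γ.node v).size : ℝ) := by
    exact_mod_cast h1
  rw [degree, add_comm]
  exact add_le_add le_rfl h2

/-- If the distinguished vertex carries the first leg and no decoration, then the polynomial of the
test function is the recentred monomial of the node decoration. -/
theorem rename_legPoly_nodePoly (h : Γ.node (e 0) = 0) :
    rename (Prod.map e id) (legPoly (Γ.nodePoly e)) =
      recenter (e 0) (monomial (expo Γ.node) 1) := by
  have h1 : ∀ q : MvPolynomial (Fin (k + 1) × Fin d) ℝ,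
      rename (Prod.map e id) (recenter 0 q) = recenter (e 0) (rename (Prod.map e id) q) := by
    intro q
    unfold recenter
    rw [aeval_rename, ← AlgHom.comp_apply, comp_aeval]
    congr 2
    funext x
    simp
  rw [legPoly, h1, rename_rename, nodePoly, rename_monomial]
  refine congrArg (fun s => recenter (e 0) (monomial s (1 : ℝ))) (Finsupp.ext fun x => ?_)
  obtain ⟨v, i⟩ := x
  obtain ⟨j, rfl⟩ := e.surjective v
  refine Fin.cases ?_ (fun j => ?_) j
  · rw [Finsupp.mapDomain_of_notMem_range, expo_apply, h]
    · rfl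
    · rintro ⟨⟨j, i'⟩, hj⟩
      exact Fin.succ_ne_zero j (e.injective (congrArg Prod.fst hj))
  · have hinj : Function.Injective
        ((Prod.map e id : Fin (k + 1) × Fin d → Γ.V × Fin d) ∘ Prod.map Fin.succ id) :=
      (e.injective.prodMap Function.injective_id).comp
        ((Fin.succ_injective k).prodMap Function.injective_id)
    exact Finsupp.mapDomain_apply hinj _ (j, i)

end VacuumDiagram

/-- If the renormalised valuations of a character vanish on polynomial test functions of low
degree, then so does its convolution with `Π₋^K`. -/
theorem mul'_map_eq_zero_of_renormValuation_eq_zero {g : Character 𝔏}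
    (hg : ∀ (k : ℕ) (Γ : FeynmanDiagram 𝔏 (k + 1)),
      Γ.toDecoratedGraph.Connected → Nonempty Γ.E → Γ.toDecoratedGraph.deg ≤ 0 →
      ∃ C : ℝ, ∀ φ : (Fin (k + 1) → Space d) → ℝ,
        IsPolyTest k Γ.toDecoratedGraph.deg C φ → Γ.renormValuation K g φ = 0)
    (Γ : VacuumDiagram 𝔏) (hΓ : Γ.degree ≤ 0) (hn : Γ.node Γ.root = 0) :
    LinearMap.mul' ℝ ℝ (TensorProduct.map g.toLinearMap (vacCharacter K).toLinearMap
      Γ.coproduct) = 0 := by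
  classical
  -- the first leg is attached to the distinguished vertex
  obtain ⟨k, e, he⟩ : ∃ (k : ℕ) (e : Fin (k + 1) ≃ Γ.V), e 0 = Γ.root := by
    have hcard : Fintype.card Γ.V = Fintype.card Γ.V - 1 + 1 :=
      (Nat.sub_add_cancel (Fintype.card_pos_iff.2 ⟨Γ.root⟩)).symm
    let e := (Fintype.equivFinOfCardEq hcard).symm
    exact ⟨_, e.trans (Equiv.swap (e 0) Γ.root), by simp⟩
  have hdeg := (Γ.totalDegree_nodePoly_add_le e).trans hΓ
  have hdeg' : Γ.toDecoratedGraph.deg ≤ 0 :=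
    (le_add_of_nonneg_left (Nat.cast_nonneg _)).trans hdeg
  obtain ⟨C, hC⟩ := hg k (Γ.withLegs e) Γ.connected Γ.nonempty_edge hdeg'
  obtain ⟨D, hD0, hD⟩ := (Γ.withLegs e).exists_diamBound Γ.connected
  obtain ⟨φ, c, hc, hφ, hφ'⟩ := exists_isPolyTest (d := d) Γ.toDecoratedGraph.deg
    (max C (D + 1)) (Γ.nodePoly e) hdeg
  have h1 := hC φ (hφ.mono (le_max_left _ _))
  rw [(Γ.withLegs e).renormValuation_eq_sum_term_rootAt K Γ.connected Γ.nonempty_edge hD hD0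
    ((lt_add_one D).trans_le (le_max_right _ _)) hφ' g] at h1
  have h2 : rename (Γ.withLegs e).legMap (iterPderiv (expo (Γ.withLegs e).legIndex)
      (c • legPoly (Γ.nodePoly e))) = c • recenter (e 0) (monomial (expo Γ.node) (1 : ℝ)) := by
    have h3 : expo (Γ.withLegs e).legIndex = 0 := by ext; rfl
    rw [h3, iterPderiv_zero, map_smul]
    exact congrArg (c • ·) (Γ.rename_legPoly_nodePoly e (by rw [he, hn]))
  rw [h2] at h1
  have h4 := ((Γ.withLegs e).toVacuum Γ.connected Γ.nonempty_edge).sum_term_smul_recenter g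
    (vacCharacter K) Γ.label (e 0) c (monomial (expo Γ.node) 1)
  have h5 := ((Γ.withLegs e).toVacuum Γ.connected Γ.nonempty_edge).sum_term_monomial g
    (vacCharacter K) Γ.label (e 0) Γ.node
  have h6 : ((Γ.withLegs e).toVacuum Γ.connected Γ.nonempty_edge).vary Γ.label (e 0) Γ.node = Γ :=
    congrArg (fun r => Γ.vary Γ.label r Γ.node) he
  rw [h6] at h5
  exact h5.symm.trans ((mul_eq_zero.1 (h4.symm.trans h1)).resolve_left hc)

end Converse

end Feynman

end

theorem mainTheorem4 {d : ℕ} (hd : 0 < d) (𝔏 : Feynman.LabelSystem d) :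
    (∃! A : Feynman.HMinus 𝔏 →ₐ[ℝ] Feynman.HHat 𝔏, Feynman.IsTwistedAntipode A) ∧
    (∀ K : Feynman.KernelAssignment 𝔏, ∃! g : Feynman.Character 𝔏, Feynman.IsBPHZ K g) ∧
    (∀ (k : ℕ) (Γ : Feynman.FeynmanDiagram 𝔏 (k + 1)),
      Γ.toDecoratedGraph.Connected → Nonempty Γ.E → Γ.toDecoratedGraph.deg ≤ 0 →
      ∃ C : ℝ, ∀ (K : Feynman.KernelAssignment 𝔏) (g : Feynman.Character 𝔏),
        Feynman.IsBPHZ K g →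
        ∀ φ : (Fin (k + 1) → Feynman.Space d) → ℝ,
          Feynman.IsPolyTest k Γ.toDecoratedGraph.deg C φ → Γ.renormValuation K g φ = 0) ∧
    (∀ (K : Feynman.KernelAssignment 𝔏) (g : Feynman.Character 𝔏),
      (∀ (k : ℕ) (Γ : Feynman.FeynmanDiagram 𝔏 (k + 1)),
        Γ.toDecoratedGraph.Connected → Nonempty Γ.E → Γ.toDecoratedGraph.deg ≤ 0 →
        ∃ C : ℝ, ∀ φ : (Fin (k + 1) → Feynman.Space d) → ℝ,
          Feynman.IsPolyTest k Γ.toDecoratedGraph.deg C φ → Γ.renormValuation K g φ = 0) →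
      Feynman.IsBPHZ K g) := by
  refine ⟨⟨_, Feynman.isTwistedAntipode_antipode,
      fun A hA => Feynman.isTwistedAntipode_unique hA Feynman.isTwistedAntipode_antipode⟩,
    fun K => ⟨_, (Feynman.isBPHZ_iff K).2 rfl, fun g hg => (Feynman.isBPHZ_iff K).1 hg⟩,
    fun k Γ hΓ hE _ => ?_, fun K g hg => ?_⟩
  · obtain ⟨C, hC⟩ := Γ.exists_renormValuation_bphz_eq_zero hΓ hE
    refine ⟨C, fun K g hg φ hφ => ?_⟩
    rw [(Feynman.isBPHZ_iff K).1 hg]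
    exact hC K φ hφ
  · refine (Feynman.isBPHZ_iff K).2 (Feynman.eq_of_map_coproduct_eq_zero (Feynman.vacCharacter K)
      (Feynman.mul'_map_eq_zero_of_renormValuation_eq_zero K hg)
      fun Γ hΓ _ => Feynman.mul'_map_bphz_coproduct K Γ hΓ)
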